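/- **Conventions.** Manifolds are smooth, separable and metrizable, with possibly empty boundary. Put $Q=(-1,1)$, $\mathbb H^m=[0,\infty)\times\mathbb R^{m-1}$ for $m\ge1$ and $\mathbb H^0=\mathbb R^0$. A local chart is *normalized* if its image is $Q^m$ (interior chart) or $Q^m\cap\mathbb H^m$ (boundary chart). Let $(Z,g)$ be an $m$-dimensional Riemannian manifold and $S\subset Z$. For an atlas $\mathfrak K$ of $Z$ let $\mathfrak K_S$ be the set of all charts $\kappa\in\mathfrak K$ whose domain $U_\kappa$ meets $S$. The atlas $\mathfrak K$ is *uniformly regular on $S$* if all $\kappa\in\mathfrak K_S$ are normalized; the sets $\kappa^{-1}(\theta\,\kappa(U_\kappa))$, $\kappa\in\mathfrak K_S$, cover $S$ for some $\theta\in(0,1)$; there is $N$ such that no point lies in more than $N$ of the sets $U_\kappa$, $\kappa\in\mathfrak K_S$; and for each $k\in\mathbb N$ the $BC^k$-norms of the transition maps $\tilde\kappa\circ\kappa^{-1}$ on $\kappa(U_\kappa\cap U_{\tilde\kappa})$ are bounded uniformly in $\kappa,\tilde\kappa\in\mathfrak K_S$. A function $\rho\in C^\infty(Z,(0,\infty))$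 is a *singularity function for $(Z,g)$ on $S$* if there are an atlas $\mathfrak K$ of $Z$ which is uniformly regular on $S$ and constants $c\ge 1$ and $c(k)$, $k\in\mathbb N$, such that $|\xi|^2/c\le \kappa_*(g/\rho^2)(x)(\xi,\xi)\le c|\xi|^2$ and $\|\kappa_*(g/\rho^2)\|_{BC^k}\le c(k)$ for all $\kappa\in\mathfrak K_S$, $x\in\kappa(U_\kappa)$, $\xi\in\mathbb R^m$, $k\in\mathbb N$. **Characteristics.** Let $J_0=(0,1]$, $J_\infty=[1,\infty)$ and $J=J_\omega$ with $\omega\in\{0,\infty\}$. A subinterval $I$ of $J$ is *cofinal* if $1\notin I$ and $J\setminus\mathring I$ is a compact interval. Let $\mathcal R(J)$ be the set of all $R\in C^\infty(J,(0,\infty))$ with $R(1)=1$ such that $R(\omega):=\lim_{t\to\omega}R(t)$ exists in $[0,\infty]$. A *cusp characteristic* on $J$, $R\in\mathcal C(J)$, is an $R\in\mathcal R(J)$ with $R(\infty)=0$ if $J=J_\infty$, with $\int_J dt/R(t)=\infty$, and with $\|\partial^kR\|_\infty<\infty$ for all $k\ge1$. A *funnel characteristic*, $R\in\mathcal F(J_\infty)$,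 is an $R\in\mathcal R(J_\infty)$ with $R(\infty)>0$ and $\|\partial^kR\|_\infty<\infty$ for all $k\ge1$. **Wedges.** Let $(M,g)$ be an $m$-dimensional Riemannian manifold, $1\le\ell\le m$, let $B$ be a compact $(\ell-1)$-dimensional submanifold of $\mathbb R^{\bar\ell}$, possibly with boundary, with induced metric $g_B$, and let $(\Gamma,g_\Gamma)$ be a compact connected $(m-\ell)$-dimensional Riemannian manifold without boundary. For $R\in\mathcal R(J)$ and $I\subset J$ put $P(R,B;I)=\{(t,R(t)y): t\in I,\ y\in B\}\subset\mathbb R^{1+\bar\ell}$. Let $P=P(R,B)=P(R,B;\mathring J)$, and let $\varphi[R]\colon P\to\mathring J\times B$, $(t,R(t)y)\mapsto(t,y)$. Let $h_P$ be a Riemannian metric on $P$ and $W=P\times\Gamma$, $g_W=h_P+g_\Gamma$. Let $V\subset M$ be open and suppose that $(V,g)$ is a smooth wedge modelled by $[\Phi,W,g_W]$, that is, $\Phi\colon V\to W$ is a diffeomorphism with $\Phi^*g_W=g$. For $r\in C^\infty(J,(0,\infty))$ let $\Phi^*r$ be the function on $V$ whose value at $q$ is $r(t)$ if $\Phi(q)=((t,R(t)y),z)$.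 A function $\rho$ on $V$ is a *cofinal singularity function for $(V,g)$* if there is a cofinal subinterval $I$ of $J$ such that $\rho$ is a singularity function for $(V,g)$ on $\Phi^{-1}(P(R,B;I)\times\Gamma)$. **Proposition 8.2.** Assume that one of the following conditions is satisfied. (i) $R\in\mathcal C(J)$, or $J=J_\infty$ and $R\in\mathcal F(J_\infty)$; $h_P=g_P$ is the metric induced on $P$ by the Euclidean metric of $\mathbb R^{1+\bar\ell}$; and $r=R$ if $R\in\mathcal C(J)$, whereas $r=1$ if $R\in\mathcal F(J_\infty)$. (ii) $J=J_0$, $\alpha\in(-\infty,1]$ and $R(t)=t^\alpha$; $\beta\ne0$ satisfies $\beta\le\alpha$, and $\beta>0$ if $\alpha>0$; $h_P=\varphi[R]^*\bigl(t^{2(\beta-1)}\,dt^2+g_B\bigr)$; and $r(t)=t^\alpha$ if $0<\alpha\le1$, whereas $r=1$ if $\alpha\le0$. Then $\rho:=\Phi^*r$ is a cofinal singularity function for $(V,g)$. -/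

import Mathlib

open scoped Manifold ContDiff Topology ENNReal

namespace SingularEnds

/-- `ℝ^k` with its Euclidean norm. -/
abbrev E (k : ℕ) : Type := EuclideanSpace ℝ (Fin k)

/-- The open cube `Q^k = (-1, 1)^k`. -/
def cube (k : ℕ) : Set (E k) := {x | ∀ i, |x i| < 1}

/-- The closed half-space `ℍ^k = [0, ∞) × ℝ^(k-1)`; for `k = 0` it is the one-point space `ℝ^0`. -/
def halfSpace (k : ℕ) : Set (E k) := {x | ∀ h : 0 < k, 0 ≤ x ⟨0, h⟩}

/-- `v` belongs to `C^k(s)`, and on `s` all its derivatives of order at most `k` are bounded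
by `c`. It is used only for sets `s` that are relatively open in `ℝ^m` or `ℍ^m`. -/
def BoundedCk {X Y : Type*} [NormedAddCommGroup X] [NormedSpace ℝ X] [NormedAddCommGroup Y]
    [NormedSpace ℝ Y] (k : ℕ) (v : X → Y) (s : Set X) (c : ℝ) : Prop :=
  ContDiffOn ℝ k v s ∧ ∀ j ≤ k, ∀ x ∈ s, ‖iteratedFDerivWithin ℝ j v s x‖ ≤ c

/-- `𝔎_S`: the charts of `𝔎` whose domain meets `S`. -/
def chartsMeeting {M : Type*} {k : ℕ} (𝔎 : Set (PartialEquiv M (E k))) (S : Set M) :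
    Set (PartialEquiv M (E k)) :=
  {κ ∈ 𝔎 | (κ.source ∩ S).Nonempty}

section Charts

variable {F : Type*} [NormedAddCommGroup F] [NormedSpace ℝ F]
  {H : Type*} [TopologicalSpace H] (I : ModelWithCorners ℝ F H)
  {M : Type*} [TopologicalSpace M] [ChartedSpace H M]

/-- `κ` is a `k`-dimensional local chart (possibly a boundary chart) of the subset `Z` of the
manifold `M`: a diffeomorphism from a relatively open subset of `Z` onto a relatively open subset of
`ℝ^k` or `ℍ^k`, where smoothness on a subset of `M` refers to the ambient manifold. For
open `Z` and `k = dim M` these are the local charts of the open submanifold `Z`. -/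
structure IsLocalChart (k : ℕ) (Z : Set M) (κ : PartialEquiv M (E k)) : Prop where
  source_open : ∃ O : Set M, IsOpen O ∧ κ.source = Z ∩ O
  target_open : ∃ O : Set (E k), IsOpen O ∧ (κ.target = O ∨ κ.target = O ∩ halfSpace k)
  smooth : ContMDiffOn I 𝓘(ℝ, E k) ∞ κ κ.source
  smooth_symm : ContMDiffOn 𝓘(ℝ, E k) I ∞ κ.symm κ.target

/-- `Z ⊆ M` is a `k`-dimensional embedded submanifold, possibly with boundary. -/
def IsSubmanifold (k : ℕ) (Z : Set M) : Prop :=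
  ∀ p ∈ Z, ∃ κ : PartialEquiv M (E k), IsLocalChart I k Z κ ∧ p ∈ κ.source

/-- The atlas `𝔎` of `Z` is uniformly regular on `S`. -/
structure IsUniformlyRegularAtlas (k : ℕ) (Z S : Set M) (𝔎 : Set (PartialEquiv M (E k))) :
    Prop where
  charts : ∀ κ ∈ 𝔎, IsLocalChart I k Z κ
  covers : Z ⊆ ⋃ κ ∈ 𝔎, κ.source
  /-- Interior charts have image `Q^k`, boundary charts have image `Q^k ∩ ℍ^k`. -/
  normalized : ∀ κ ∈ chartsMeeting 𝔎 S,
    κ.target = cube k ∨ κ.target = cube k ∩ halfSpace k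
  shrinkable : ∃ r : ℝ, 0 < r ∧ r < 1 ∧
    S ⊆ ⋃ κ ∈ chartsMeeting 𝔎 S, κ.symm '' ((fun x => r • x) '' κ.target)
  finite_multiplicity : ∃ N : ℕ, ∀ p : M, {κ ∈ chartsMeeting 𝔎 S | p ∈ κ.source}.encard ≤ N
  transition : ∀ j : ℕ, ∃ c : ℝ, ∀ κ ∈ chartsMeeting 𝔎 S, ∀ κ' ∈ chartsMeeting 𝔎 S,
    BoundedCk j (κ' ∘ κ.symm) (κ.target ∩ κ.symm ⁻¹' κ'.source) c

/-- The push-forward `κ_* G` of a field `G` of bilinear forms on the tangent spaces, as a function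
on the image of the chart `κ`: `(κ_* G)(x)(ξ, η) = G(κ⁻¹ x)(d(κ⁻¹)_x ξ, d(κ⁻¹)_x η)`. -/
noncomputable def pushForm {k : ℕ} (κ : PartialEquiv M (E k))
    (G : ∀ p : M, TangentSpace I p →L[ℝ] TangentSpace I p →L[ℝ] ℝ) (x : E k) :
    E k →L[ℝ] E k →L[ℝ] ℝ :=
  let A : E k →L[ℝ] F := mfderivWithin 𝓘(ℝ, E k) I κ.symm κ.target x
  let g : F →L[ℝ] F →L[ℝ] ℝ := G (κ.symm x)
  g.bilinearComp A A

/-- `(Z, 𝔎, G)` is uniformly regular on `S`, where `Z` is open in `M` and `G` is a metric. -/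
structure IsUniformlyRegularOn (k : ℕ) (Z S : Set M) (𝔎 : Set (PartialEquiv M (E k)))
    (G : ∀ p : M, TangentSpace I p →L[ℝ] TangentSpace I p →L[ℝ] ℝ) : Prop where
  atlas : IsUniformlyRegularAtlas I k Z S 𝔎
  equivalent : ∃ c : ℝ, 1 ≤ c ∧ ∀ κ ∈ chartsMeeting 𝔎 S, ∀ x ∈ κ.target, ∀ ξ : E k,
    ‖ξ‖ ^ 2 / c ≤ pushForm I κ G x ξ ξ ∧ pushForm I κ G x ξ ξ ≤ c * ‖ξ‖ ^ 2
  bounded : ∀ j : ℕ, ∃ c : ℝ, ∀ κ ∈ chartsMeeting 𝔎 S, BoundedCk j (pushForm I κ G) κ.target c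

/-- `ρ` is a singularity function for the open submanifold `(Z, g)` of `(M, g)` on `S ⊆ Z`:
`ρ ∈ C^∞(Z, (0, ∞))`, and `(Z, 𝔎, g / ρ²)` is uniformly regular on `S` for some atlas `𝔎`. -/
def IsSingularityFunctionOn (k : ℕ) (g : ∀ p : M, TangentSpace I p →L[ℝ] TangentSpace I p →L[ℝ] ℝ)
    (Z S : Set M) (ρ : M → ℝ) : Prop :=
  ContMDiffOn I 𝓘(ℝ, ℝ) ∞ ρ Z ∧ (∀ p ∈ Z, 0 < ρ p) ∧
    ∃ 𝔎 : Set (PartialEquiv M (E k)),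
      IsUniformlyRegularOn I k Z S 𝔎 (fun p => (ρ p ^ 2)⁻¹ • g p)

end Charts

/-! ### Characteristics -/

/-- The end `τ ∈ {0, ∞}` of the intervals `J_0` and `J_∞`. -/
inductive Tip : Type
  | zero : Tip
  | infty : Tip

/-- `J_0 = (0, 1]` and `J_∞ = [1, ∞)`. -/
def Tip.J : Tip → Set ℝ
  | .zero => Set.Ioc 0 1
  | .infty => Set.Ici 1

/-- The filter `t → τ` in `J_τ`. -/
def Tip.lim : Tip → Filter ℝ
  | .zero => 𝓝[>] 0
  | .infty => Filter.atTop

/-- `A` is a cofinal subinterval of `J_τ`. -/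
structure IsCofinal (τ : Tip) (A : Set ℝ) : Prop where
  subset : A ⊆ τ.J
  interval : A.OrdConnected
  one_notMem : (1 : ℝ) ∉ A
  compact_compl : IsCompact (τ.J \ interior A)
  interval_compl : (τ.J \ interior A).OrdConnected

/-- The class `ℛ(J_τ)`. -/
structure IsProfile (τ : Tip) (R : ℝ → ℝ) : Prop where
  smooth : ContDiffOn ℝ ∞ R τ.J
  pos : ∀ t ∈ τ.J, 0 < R t
  one : R 1 = 1
  limit : ∃ L : ℝ≥0∞, Filter.Tendsto (fun t => ENNReal.ofReal (R t)) τ.lim (𝓝 L)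

/-- The class `𝒞(J_τ)` of cusp characteristics. -/
structure IsCuspCharacteristic (τ : Tip) (R : ℝ → ℝ) : Prop extends IsProfile τ R where
  limit_infty : τ = .infty → Filter.Tendsto R Filter.atTop (𝓝 0)
  integral : ∫⁻ t in τ.J, ENNReal.ofReal (1 / R t) = ⊤
  bounded : ∀ k : ℕ, 1 ≤ k → ∃ c : ℝ, ∀ t ∈ τ.J, |iteratedDerivWithin k R τ.J t| ≤ c

/-- The class `ℱ(J_∞)` of funnel characteristics. -/
structure IsFunnelCharacteristic (R : ℝ → ℝ) : Prop extends IsProfile .infty R where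
  limit_pos : ∃ L : ℝ≥0∞, 0 < L ∧
    Filter.Tendsto (fun t => ENNReal.ofReal (R t)) Filter.atTop (𝓝 L)
  bounded : ∀ k : ℕ, 1 ≤ k → ∃ c : ℝ, ∀ t ∈ Tip.infty.J,
    |iteratedDerivWithin k R Tip.infty.J t| ≤ c

/-! ### Pipes, wedges and their metrics -/

section Pipes

variable {n : ℕ}

/-- `P(R, B; A) = {(t, R(t) y) ; t ∈ A, y ∈ B} ⊆ ℝ × ℝ^n`. The norm of the product space
`ℝ × E n` plays no role. -/
def pipe (R : ℝ → ℝ) (B : Set (E n)) (A : Set ℝ) : Set (ℝ × E n) :=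
  {p | ∃ t ∈ A, ∃ y ∈ B, p = (t, R t • y)}

/-- The wedge `P(R, B; A) × Γ`. -/
def wedge (R : ℝ → ℝ) (B : Set (E n)) (A : Set ℝ) (Γ : Type*) : Set ((ℝ × E n) × Γ) :=
  pipe R B A ×ˢ Set.univ

/-- The canonical stretching diffeomorphism `φ[R] : (t, R(t) y) ↦ (t, y)`, written as a map that is
smooth in a neighbourhood of the pipe. -/
noncomputable def stretch (R : ℝ → ℝ) (p : ℝ × E n) : ℝ × E n := (p.1, (R p.1)⁻¹ • p.2)

/-- The Euclidean inner product of `ℝ^n` as a bilinear form. -/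
noncomputable def euclideanForm (n : ℕ) : E n →L[ℝ] E n →L[ℝ] ℝ := innerSL ℝ

/-- The bilinear form `a dt² + |dy|²` on `ℝ × ℝ^n`. -/
noncomputable def splitForm (n : ℕ) (a : ℝ) : (ℝ × E n) →L[ℝ] (ℝ × E n) →L[ℝ] ℝ :=
  a • (ContinuousLinearMap.mul ℝ ℝ).bilinearComp
      (ContinuousLinearMap.fst ℝ ℝ (E n)) (ContinuousLinearMap.fst ℝ ℝ (E n)) +
    (euclideanForm n).bilinearComp
      (ContinuousLinearMap.snd ℝ ℝ (E n)) (ContinuousLinearMap.snd ℝ ℝ (E n))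

/-- A metric on a submanifold of `ℝ × ℝ^n` is given by bilinear forms on `ℝ × ℝ^n`, of which only
the restrictions to the tangent spaces matter. This one is the Euclidean metric of `ℝ^(1+n)`; it
induces the metric `g_P` of the embedded pipe `P`. -/
noncomputable def embeddedMetric (n : ℕ) : ℝ × E n → (ℝ × E n) →L[ℝ] (ℝ × E n) →L[ℝ] ℝ :=
  fun _ => splitForm n 1

/-- The metric `φ[R]^*(t^(2(β-1)) dt² + g_B)`, where `g_B` is the metric that `B` inherits
from `ℝ^n`. -/
noncomputable def anisotropicMetric (n : ℕ) (R : ℝ → ℝ) (β : ℝ) :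
    ℝ × E n → (ℝ × E n) →L[ℝ] (ℝ × E n) →L[ℝ] ℝ :=
  fun p => (splitForm n ((stretch R p).1 ^ (2 * (β - 1)))).bilinearComp
    (fderiv ℝ (stretch R) p) (fderiv ℝ (stretch R) p)

end Pipes

section Wedges

variable {m n e : ℕ} {H : Type*} [TopologicalSpace H] (I : ModelWithCorners ℝ (E m) H)
  {M : Type*} [TopologicalSpace M] [ChartedSpace H M]
  {Γ : Type*} [TopologicalSpace Γ] [ChartedSpace (E e) Γ]

/-- `(V, g)` is a smooth wedge in `(M, g)` modelled by `[Φ, W, h_P + g_Γ]`, where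
`W = P(R, B) × Γ` and `P(R, B)` is the pipe over the interior of `J_τ`: the set `V` is open, and `Φ`
is a diffeomorphism from `V` onto `W` with `Φ^*(h_P + g_Γ) = g`. -/
structure IsModeledBy (g : ∀ p : M, TangentSpace I p →L[ℝ] TangentSpace I p →L[ℝ] ℝ) (V : Set M)
    (Φ : PartialEquiv M ((ℝ × E n) × Γ)) (τ : Tip) (R : ℝ → ℝ) (B : Set (E n))
    (hP : ℝ × E n → (ℝ × E n) →L[ℝ] (ℝ × E n) →L[ℝ] ℝ)
    (gΓ : ∀ z : Γ, TangentSpace (𝓡 e) z →L[ℝ] TangentSpace (𝓡 e) z →L[ℝ] ℝ) : Prop where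
  isOpen : IsOpen V
  source_eq : Φ.source = V
  target_eq : Φ.target = wedge R B (interior τ.J) Γ
  smooth : ContMDiffOn I (𝓘(ℝ, ℝ × E n).prod (𝓡 e)) ∞ Φ V
  smooth_symm : ContMDiffOn (𝓘(ℝ, ℝ × E n).prod (𝓡 e)) I ∞ Φ.symm (wedge R B (interior τ.J) Γ)
  isometry : ∀ p ∈ V, ∀ u v : TangentSpace I p,
    g p u v =
      hP (Φ p).1 (mfderiv I 𝓘(ℝ, ℝ × E n) (fun q => (Φ q).1) p u)
        (mfderiv I 𝓘(ℝ, ℝ × E n) (fun q => (Φ q).1) p v) +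
      gΓ (Φ p).2 (mfderiv I (𝓡 e) (fun q => (Φ q).2) p u)
        (mfderiv I (𝓡 e) (fun q => (Φ q).2) p v)

/-- `Φ^* r = Ψ^*(r ⊗ 1_B ⊗ 1_Γ)` with `Ψ = (φ[R] × id_Γ) ∘ Φ`: the function `r(t)` transported
to `V`. -/
noncomputable def pullbackRadial (Φ : PartialEquiv M ((ℝ × E n) × Γ)) (R r : ℝ → ℝ) (p : M) : ℝ :=
  r (stretch R (Φ p).1).1

/-- `ρ` is a cofinal singularity function for the wedge `(V, g)`: it is a singularity function
for `(V, g)` on `Φ⁻¹(P(R, B; A) × Γ)` for some cofinal subinterval `A` of `J_τ`. -/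
def IsCofinalSingularityFunction
    (g : ∀ p : M, TangentSpace I p →L[ℝ] TangentSpace I p →L[ℝ] ℝ) (V : Set M)
    (Φ : PartialEquiv M ((ℝ × E n) × Γ)) (τ : Tip) (R : ℝ → ℝ) (B : Set (E n)) (ρ : M → ℝ) : Prop :=
  ∃ A : Set ℝ, IsCofinal τ A ∧
    IsSingularityFunctionOn I m g V (V ∩ Φ ⁻¹' wedge R B A Γ) ρ

end Wedges

end SingularEnds

/-! The plan is to replace the radial variable `t` by a variable `s` in `(0, ∞)` that tends to
infinity as `t` approaches the end, so chosen that the radial direction has unit size for `g / ρ²`.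
With `t = T(s)` this metric becomes `ds² + |u y ds + λ dy|² + k² g_Γ`, where `k(s) = 1 / r(T(s))`.
Here `u` is bounded together with all its derivatives, while `λ` and `k` are moderate: bounded below
by a positive constant, with each derivative dominated by the function itself.

The map `T` solves `T' = ±w(T)`. For a cusp, `w = R`, `u = ±R'(T)` and `λ = 1`, because `dt² + |d(R
y)|²` then has the factor `R²`. For a funnel, `w = 1`, `u = R'(T)` and `λ = R(T)`. In case (ii), put
`a = max(α, 0)`; then `w = t^(1 + a - β)`, `u = 0` and `λ = k = T^(-a)`. In each case `∫ dt / w =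
∞`, so `s` exhausts `(0, ∞)` (`exists_timeChange`). These choices are recorded in `RadialData`.

A metric of this shape is uniformly regular although `λ` and `k` may be unbounded, provided that the
charts shrink accordingly. Over `(i - 1, i + 1)`, the bases `B` and `Γ` are cut into lattice cells
of half-widths proportional to `1 / λ(i)` and `1 / k(i)`, which are then blown up to the unit cube.
A moderate function has comparable values at points of distance at most two. Hence the rescaled
coefficients `λ(s) / λ(i)` and `k(s) / k(i)` are bounded above and below, with all derivatives
(`uniformlyBounded_wedgeCoeff`, `exists_equivalent_modelForm`). The same comparison bounds the
transition maps (`exists_transition_bound`), and the lattice bounds the multiplicity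
(`exists_wedge_multiplicity_le`). All other constants come from compactness of `B` and `Γ`.
`RadialData.isCofinalSingularityFunction` assembles these facts on the set `s ≥ 1`. -/

namespace SingularEnds

/-! ### Uniformly bounded families of smooth maps -/

section UniformlyBounded

variable {ι ι' X Y Z : Type*} [NormedAddCommGroup X] [NormedSpace ℝ X] [NormedAddCommGroup Y]
  [NormedSpace ℝ Y] [NormedAddCommGroup Z] [NormedSpace ℝ Z]

/-- The maps `f i`, `i ∈ ι`, are bounded in `BC^k(s i)` uniformly in `i`, for every `k`. -/
def UniformlyBounded (s : ι → Set X) (f : ι → X → Y) : Prop :=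
  ∀ j : ℕ, ∃ c : ℝ, ∀ i, BoundedCk j (f i) (s i) c

/-- Separates the orders: the sum of the bounds for the orders up to `j` serves as the single
constant that `BoundedCk j` demands. -/
theorem uniformlyBounded_iff {s : ι → Set X} {f : ι → X → Y} :
    UniformlyBounded s f ↔ (∀ i, ContDiffOn ℝ ∞ (f i) (s i)) ∧
      ∀ j : ℕ, ∃ c : ℝ, ∀ i, ∀ x ∈ s i, ‖iteratedFDerivWithin ℝ j (f i) (s i) x‖ ≤ c := by
  constructor
  · intro h
    refine ⟨fun i => contDiffOn_infty.2 fun j => ?_, fun j => ?_⟩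
    · obtain ⟨c, hc⟩ := h j
      exact (hc i).1
    · obtain ⟨c, hc⟩ := h j
      exact ⟨c, fun i x hx => (hc i).2 j le_rfl x hx⟩
  · rintro ⟨h, h'⟩ j
    choose c hc using h'
    refine ⟨∑ k ∈ Finset.range (j + 1), |c k|, fun i => ⟨contDiffOn_infty.1 (h i) j, ?_⟩⟩
    intro k hk x hx
    calc _ ≤ c k := hc k i x hx
      _ ≤ |c k| := le_abs_self _
      _ ≤ _ := Finset.single_le_sum (f := fun k => |c k|) (fun _ _ => abs_nonneg _)
          (Finset.mem_range.2 (by omega))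

theorem UniformlyBounded.contDiffOn {s : ι → Set X} {f : ι → X → Y} (h : UniformlyBounded s f)
    (i : ι) : ContDiffOn ℝ ∞ (f i) (s i) := (uniformlyBounded_iff.1 h).1 i

theorem UniformlyBounded.reindex {s : ι → Set X} {f : ι → X → Y} (h : UniformlyBounded s f)
    (a : ι' → ι) : UniformlyBounded (fun i => s (a i)) (fun i => f (a i)) := by
  intro j
  obtain ⟨c, hc⟩ := h j
  exact ⟨c, fun i => hc (a i)⟩

theorem UniformlyBounded.congr {s : ι → Set X} {f g : ι → X → Y} (h : UniformlyBounded s f)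
    (hfg : ∀ i, Set.EqOn (g i) (f i) (s i)) : UniformlyBounded s g := by
  intro j
  obtain ⟨c, hc⟩ := h j
  refine ⟨c, fun i => ⟨(hc i).1.congr (hfg i), fun k hk x hx => ?_⟩⟩
  rw [iteratedFDerivWithin_congr (hfg i) hx]
  exact (hc i).2 k hk x hx

/-- A bound that is at least one lies below its own positive powers, which is the form required by
the estimate for higher derivatives of compositions. -/
theorem UniformlyBounded.exists_pos_bound {s : ι → Set X} {f : ι → X → Y}
    (h : UniformlyBounded s f) (j : ℕ) : ∃ c : ℝ, 1 ≤ c ∧ ∀ i, ∀ k ≤ j, ∀ x ∈ s i,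
      ‖iteratedFDerivWithin ℝ k (f i) (s i) x‖ ≤ c := by
  obtain ⟨c, hc⟩ := h j
  exact ⟨max 1 c, le_max_left _ _, fun i k hk x hx => ((hc i).2 k hk x hx).trans (le_max_right _ _)⟩

theorem UniformlyBounded.comp {s : ι → Set X} {t : ι → Set Y} {f : ι → X → Y} {g : ι → Y → Z}
    (hg : UniformlyBounded t g) (hf : UniformlyBounded s f) (ht : ∀ i, UniqueDiffOn ℝ (t i))
    (hs : ∀ i, UniqueDiffOn ℝ (s i)) (hst : ∀ i, Set.MapsTo (f i) (s i) (t i)) :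
    UniformlyBounded s (fun i => g i ∘ f i) := by
  refine uniformlyBounded_iff.2 ⟨fun i => (hg.contDiffOn i).comp (hf.contDiffOn i) (hst i),
    fun j => ?_⟩
  obtain ⟨C, hC, hgC⟩ := hg.exists_pos_bound j
  obtain ⟨D, hD, hfD⟩ := hf.exists_pos_bound j
  refine ⟨j.factorial * C * D ^ j, fun i x hx => ?_⟩
  refine norm_iteratedFDerivWithin_comp_le (hg.contDiffOn i) (hf.contDiffOn i)
    (by exact_mod_cast le_top) (ht i) (hs i) (hst i) hx
    (fun k hk => hgC i k hk _ (hst i hx)) (fun k hk hkj => ?_)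
  exact (hfD i k hkj x hx).trans (le_self_pow₀ hD (by omega))

theorem UniformlyBounded.prodMk {s : ι → Set X} {f : ι → X → Y} {g : ι → X → Z}
    (hf : UniformlyBounded s f) (hg : UniformlyBounded s g) (hs : ∀ i, UniqueDiffOn ℝ (s i)) :
    UniformlyBounded s (fun i x => (f i x, g i x)) := by
  refine uniformlyBounded_iff.2 ⟨fun i => (hf.contDiffOn i).prodMk (hg.contDiffOn i), fun j => ?_⟩
  obtain ⟨C, hC, hfC⟩ := hf.exists_pos_bound j
  obtain ⟨D, hD, hgD⟩ := hg.exists_pos_bound j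
  refine ⟨max C D, fun i x hx => ?_⟩
  have hj : ((j : ℕ∞) : WithTop ℕ∞) ≤ ((⊤ : ℕ∞) : WithTop ℕ∞) := by exact_mod_cast le_top
  rw [iteratedFDerivWithin_prodMk (hf.contDiffOn i x hx) (hg.contDiffOn i x hx) (hs i) hx hj,
    ContinuousMultilinearMap.opNorm_prod]
  exact max_le_max (hfC i j le_rfl x hx) (hgD i j le_rfl x hx)

theorem uniformlyBounded_const {s : ι → Set X} {y : ι → Y} {C : ℝ} (hy : ∀ i, ‖y i‖ ≤ C) :
    UniformlyBounded s (fun i _ => y i) := by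
  refine uniformlyBounded_iff.2 ⟨fun i => contDiffOn_const, fun j => ⟨C, fun i x hx => ?_⟩⟩
  rcases j with _ | j
  · simpa using hy i
  · simpa [iteratedFDerivWithin_succ_const] using (norm_nonneg _).trans (hy i)

/-- A continuous linear map is bounded with all its derivatives on bounded sets. -/
theorem uniformlyBounded_clm {s : ι → Set X} (A : ι → X →L[ℝ] Y) {C : ℝ} (hA : ∀ i, ‖A i‖ ≤ C)
    {r : ℝ} (hr : ∀ i, ∀ x ∈ s i, ‖x‖ ≤ r) (hs : ∀ i, UniqueDiffOn ℝ (s i)) :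
    UniformlyBounded s (fun i x => A i x) := by
  refine uniformlyBounded_iff.2 ⟨fun i => (A i).contDiff.contDiffOn, fun j => ?_⟩
  refine ⟨|C| * (|r| + 1), fun i x hx => ?_⟩
  have hC : ‖A i‖ ≤ |C| := (hA i).trans (le_abs_self _)
  rcases j with _ | _ | j
  · rw [norm_iteratedFDerivWithin_zero]
    refine ((A i).le_opNorm x).trans ?_
    gcongr
    exact ((hr i x hx).trans (le_abs_self _)).trans (by linarith)
  · rw [← norm_iteratedFDerivWithin_fderivWithin (hs i) hx, norm_iteratedFDerivWithin_zero,
      (A i).fderivWithin (hs i x hx)]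
    refine hC.trans (le_mul_of_one_le_right (abs_nonneg _) (by linarith [abs_nonneg r]))
  · rw [← norm_iteratedFDerivWithin_fderivWithin (hs i) hx,
      iteratedFDerivWithin_congr (f := fun _ => A i) (fun y hy => (A i).fderivWithin (hs i y hy)) hx,
      iteratedFDerivWithin_succ_const]
    simp only [Pi.zero_apply, norm_zero]
    positivity

/-- Smooth maps of proper spaces preserve uniform boundedness. -/
theorem UniformlyBounded.contDiff_comp [FiniteDimensional ℝ Y] {s : ι → Set X} {f : ι → X → Y}
    {g : Y → Z} (hg : ContDiff ℝ ∞ g) (hf : UniformlyBounded s f) (hs : ∀ i, UniqueDiffOn ℝ (s i)) :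
    UniformlyBounded s (fun i x => g (f i x)) := by
  obtain ⟨C, hC, hfC⟩ := hf.exists_pos_bound 0
  -- All values of the family lie in one ball. Its closure is compact by finite dimensionality, so
  -- each derivative of `g` is bounded there.
  have hball : UniformlyBounded (fun _ : ι => Metric.ball (0 : Y) (C + 1)) (fun _ => g) := by
    refine uniformlyBounded_iff.2 ⟨fun i => hg.contDiffOn, fun j => ?_⟩
    have : ProperSpace Y := FiniteDimensional.proper ℝ Y
    obtain ⟨D, hD⟩ := (isCompact_closedBall (0 : Y) (C + 1)).exists_bound_of_continuousOn
      (f := iteratedFDeriv ℝ j g) (hg.continuous_iteratedFDeriv (by exact_mod_cast le_top)).continuousOn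
    refine ⟨D, fun i x hx => ?_⟩
    rw [iteratedFDerivWithin_of_isOpen j Metric.isOpen_ball hx]
    exact hD x (Metric.ball_subset_closedBall hx)
  refine hball.comp hf (fun _ => Metric.isOpen_ball.uniqueDiffOn) hs (fun i x hx => ?_)
  have := hfC i 0 le_rfl x hx
  rw [norm_iteratedFDerivWithin_zero] at this
  simpa using this.trans_lt (by linarith)

theorem UniformlyBounded.add {s : ι → Set X} {f g : ι → X → Y} (hf : UniformlyBounded s f)
    (hg : UniformlyBounded s g) (hs : ∀ i, UniqueDiffOn ℝ (s i)) :
    UniformlyBounded s (fun i x => f i x + g i x) := by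
  refine uniformlyBounded_iff.2 ⟨fun i => (hf.contDiffOn i).add (hg.contDiffOn i), fun j => ?_⟩
  obtain ⟨C, hC, hfC⟩ := hf.exists_pos_bound j
  obtain ⟨D, hD, hgD⟩ := hg.exists_pos_bound j
  refine ⟨C + D, fun i x hx => ?_⟩
  have hj : ((j : ℕ∞) : WithTop ℕ∞) ≤ ((⊤ : ℕ∞) : WithTop ℕ∞) := by exact_mod_cast le_top
  have := iteratedFDerivWithin_add_apply (((hf.contDiffOn i) x hx).of_le hj)
    (((hg.contDiffOn i) x hx).of_le hj) (hs i) hx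
  have e : (fun x => f i x + g i x) = f i + g i := rfl
  rw [e, this]
  exact (norm_add_le _ _).trans (add_le_add (hfC i j le_rfl x hx) (hgD i j le_rfl x hx))

/-- Derivatives of `x ↦ F (c + ε x)`. -/
theorem norm_iteratedFDerivWithin_comp_affine_le {F : X → Y} {s t : Set X} {c x : X} {ε C : ℝ}
    {j : ℕ} (hε : 0 ≤ ε) (hF : ContDiffOn ℝ ∞ F t) (ht : UniqueDiffOn ℝ t) (hs : UniqueDiffOn ℝ s)
    (hst : Set.MapsTo (fun x => c + ε • x) s t) (hx : x ∈ s)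
    (hC : ∀ k ≤ j, ‖iteratedFDerivWithin ℝ k F t (c + ε • x)‖ ≤ C) :
    ‖iteratedFDerivWithin ℝ j (fun x => F (c + ε • x)) s x‖ ≤ j.factorial * C * ε ^ j := by
  have hA : ContDiff ℝ ∞ (fun x : X => c + ε • x) := by fun_prop
  refine norm_iteratedFDerivWithin_comp_le hF hA.contDiffOn (by exact_mod_cast le_top) ht hs hst hx
    hC (fun k hk hkj => ?_)
  -- The inner map has first derivative `ε • id` and vanishing higher ones, so its derivative of
  -- order `k ≥ 1` has norm at most `ε ^ k`.
  have hd : ∀ y ∈ s, fderivWithin ℝ (fun x : X => c + ε • x) s y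
      = ε • ContinuousLinearMap.id ℝ X := by
    intro y hy
    have : HasFDerivAt (fun x : X => c + ε • x) (ε • ContinuousLinearMap.id ℝ X) y :=
      ((hasFDerivAt_id y).const_smul ε).const_add c
    exact this.hasFDerivWithinAt.fderivWithin (hs y hy)
  obtain ⟨k, rfl⟩ : ∃ l, k = l + 1 := ⟨k - 1, by omega⟩
  rw [← norm_iteratedFDerivWithin_fderivWithin hs hx, iteratedFDerivWithin_congr (f :=
    fun _ => ε • ContinuousLinearMap.id ℝ X) (fun y hy => hd y hy) hx]
  rcases k with _ | k
  · rw [norm_iteratedFDerivWithin_zero, norm_smul, Real.norm_of_nonneg hε]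
    simpa using mul_le_of_le_one_right hε ContinuousLinearMap.norm_id_le
  · rw [iteratedFDerivWithin_succ_const]
    simpa using pow_nonneg hε _

end UniformlyBounded

/-! ### Cubes, half-spaces and local charts -/

theorem abs_apply_le_norm {k : ℕ} (x : E k) (i : Fin k) : |x i| ≤ ‖x‖ := by
  simpa using PiLp.norm_apply_le x i

theorem norm_le_of_abs_apply_le {k : ℕ} {x : E k} {r : ℝ} (hr : 0 ≤ r) (h : ∀ i, |x i| ≤ r) :
    ‖x‖ ≤ k * r := by
  rw [EuclideanSpace.norm_eq]
  refine Real.sqrt_le_iff.2 ⟨by positivity, ?_⟩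
  calc ∑ i, ‖x i‖ ^ 2 ≤ ∑ _i : Fin k, r ^ 2 := by
        refine Finset.sum_le_sum fun i _ => ?_
        exact pow_le_pow_left₀ (norm_nonneg _) (h i) 2
    _ = k * r ^ 2 := by simp
    _ ≤ (k * r) ^ 2 := by
        rw [mul_pow]
        refine mul_le_mul_of_nonneg_right ?_ (sq_nonneg r)
        exact_mod_cast Nat.le_self_pow two_ne_zero k

/-- The closed box with centre `c` and half-width `r`. -/
def box {k : ℕ} (c : E k) (r : ℝ) : Set (E k) := {x | ∀ i, |x i - c i| ≤ r}

theorem isClosed_box {k : ℕ} (c : E k) (r : ℝ) : IsClosed (box c r) := by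
  simp only [box, Set.ofPred_forall]
  exact isClosed_iInter fun i => isClosed_le (by fun_prop) continuous_const

theorem isCompact_box {k : ℕ} (c : E k) (r : ℝ) : IsCompact (box c r) := by
  refine Metric.isCompact_of_isClosed_isBounded (isClosed_box c r) ?_
  refine (Metric.isBounded_closedBall (x := c) (r := k * |r|)).subset fun x hx => ?_
  rw [mem_closedBall_iff_norm]
  exact norm_le_of_abs_apply_le (abs_nonneg r) fun i => (hx i).trans (le_abs_self r)

theorem ball_subset_box {k : ℕ} (c : E k) (r : ℝ) : Metric.ball c r ⊆ box c r := by
  intro x hx i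
  rw [mem_ball_iff_norm] at hx
  exact (abs_apply_le_norm (x - c) i).trans hx.le

theorem exists_box_subset {k : ℕ} {O : Set (E k)} (hO : IsOpen O) {c : E k} (hc : c ∈ O) :
    ∃ r > 0, box c (2 * r) ⊆ O := by
  obtain ⟨ε, hε, h⟩ := Metric.isOpen_iff.1 hO c hc
  -- A box of half-width `ε / (k + 1)` lies in the Euclidean ball of radius `ε`, by
  -- `norm_le_of_abs_apply_le`; the `+ 1` makes this strict and admits `k = 0`.
  refine ⟨ε / (2 * (k + 1)), by positivity, fun x hx => h ?_⟩
  rw [mem_ball_iff_norm]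
  have h2 : 2 * (ε / (2 * ((k : ℝ) + 1))) = ε / (k + 1) := by field_simp
  rw [h2] at hx
  refine (norm_le_of_abs_apply_le (by positivity) fun i => hx i).trans_lt ?_
  rw [mul_div_assoc', div_lt_iff₀ (by positivity)]
  nlinarith

theorem isOpen_cube (k : ℕ) : IsOpen (cube k) := by
  simp only [cube, Set.ofPred_forall]
  exact isOpen_iInter_of_finite fun i => isOpen_lt (by fun_prop) continuous_const

theorem isClosed_halfSpace (k : ℕ) : IsClosed (halfSpace k) := by
  simp only [halfSpace, Set.ofPred_forall]
  exact isClosed_iInter fun i => isClosed_le continuous_const (by fun_prop)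

theorem uniqueDiffOn_halfSpace (k : ℕ) : UniqueDiffOn ℝ (halfSpace k) := by
  refine uniqueDiffOn_convex ?_ ?_
  · intro x hx y hy a b ha hb _ h
    have h1 := hx h
    have h2 := hy h
    simp only [PiLp.add_apply, PiLp.smul_apply, smul_eq_mul]
    positivity
  · refine ⟨WithLp.toLp 2 (fun _ => 1), mem_interior.2 ⟨{x | ∀ i, 0 < x i}, ?_, ?_, ?_⟩⟩
    · exact fun x hx h => (hx _).le
    · simp only [Set.ofPred_forall]
      exact isOpen_iInter_of_finite fun i => isOpen_lt continuous_const (by fun_prop)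
    · intro i; simp

/-! ### Base charts and their cells -/

section Cells

variable {X : Type*} {k : ℕ}

/-- A chart with a box about `center` of half-width `2 * radius` that is contained in its image,
where the image is regarded as a subset of `domain`, that is, of `ℝ^k` or `ℍ^k`. -/
structure BaseChart (X : Type*) (k : ℕ) where
  chart : PartialEquiv X (E k)
  center : E k
  radius : ℝ
  domain : Set (E k)

/-- A cell of width `2 * scale` in a base chart, centred at the lattice point `scale * index`. -/
structure Cell (X : Type*) (k : ℕ) where
  base : BaseChart X k
  index : Fin k → ℤ
  scale : ℝ
  scale_pos : 0 < scale

namespace Cell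

/-- The centre of the cell. -/
def center (a : Cell X k) : E k := WithLp.toLp 2 (fun i => a.scale * a.index i)

/-- The normalized chart of the cell. -/
noncomputable def chart (a : Cell X k) : PartialEquiv X (E k) where
  toFun p := a.scale⁻¹ • (a.base.chart p - a.center)
  invFun x := a.base.chart.symm (a.center + a.scale • x)
  source := {p | p ∈ a.base.chart.source ∧ a.scale⁻¹ • (a.base.chart p - a.center) ∈ cube k}
  target := {x | x ∈ cube k ∧ a.center + a.scale • x ∈ a.base.chart.target}
  map_source' p hp := by
    refine ⟨hp.2, ?_⟩
    rw [smul_inv_smul₀ a.scale_pos.ne', add_sub_cancel]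
    exact a.base.chart.map_source hp.1
  map_target' x hx := by
    refine ⟨a.base.chart.map_target hx.2, ?_⟩
    rw [a.base.chart.right_inv hx.2, add_sub_cancel_left, inv_smul_smul₀ a.scale_pos.ne']
    exact hx.1
  left_inv' p hp := by
    rw [smul_inv_smul₀ a.scale_pos.ne', add_sub_cancel, a.base.chart.left_inv hp.1]
  right_inv' x hx := by
    rw [a.base.chart.right_inv hx.2, add_sub_cancel_left, inv_smul_smul₀ a.scale_pos.ne']

theorem chart_apply (a : Cell X k) (p : X) :
    a.chart p = a.scale⁻¹ • (a.base.chart p - a.center) := rfl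

theorem chart_symm_apply (a : Cell X k) (x : E k) :
    a.chart.symm x = a.base.chart.symm (a.center + a.scale • x) := rfl

theorem mem_source_chart {a : Cell X k} {p : X} : p ∈ a.chart.source ↔
    p ∈ a.base.chart.source ∧ a.scale⁻¹ • (a.base.chart p - a.center) ∈ cube k := Iff.rfl

theorem mem_target_chart {a : Cell X k} {x : E k} :
    x ∈ a.chart.target ↔ x ∈ cube k ∧ a.center + a.scale • x ∈ a.base.chart.target := Iff.rfl

/-- The cells used for the base atlas `𝔅`. -/
structure Admissible (𝔅 : Set (BaseChart X k)) (a : Cell X k) : Prop where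
  base_mem : a.base ∈ 𝔅
  center_mem : a.center ∈ box a.base.center a.base.radius
  center_domain : a.center ∈ a.base.domain
  scale_le : a.scale ≤ a.base.radius
  scale_le_one : a.scale ≤ 1

/-- The centre is within one radius of the centre of the base box and the half-width is at most
another radius; hence the factor two in `BaseChart`. -/
theorem affine_mem_box {a : Cell X k} {𝔅 : Set (BaseChart X k)} (ha : a.Admissible 𝔅) {x : E k}
    (hx : x ∈ cube k) : a.center + a.scale • x ∈ box a.base.center (2 * a.base.radius) := by
  intro i
  have h1 := ha.center_mem i
  have h2 : |a.scale * x i| ≤ a.base.radius := by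
    rw [abs_mul, abs_of_pos a.scale_pos]
    exact (mul_le_of_le_one_right a.scale_pos.le (hx i).le).trans ha.scale_le
  have : (a.center + a.scale • x) i - a.base.center i
      = (a.center i - a.base.center i) + a.scale * x i := by
    simp; ring
  rw [this]
  exact (abs_add_le _ _).trans (by linarith)

theorem contDiff_affine (a : Cell X k) : ContDiff ℝ ∞ (fun x : E k => a.center + a.scale • x) := by
  fun_prop

theorem contDiff_affine_symm (a : Cell X k) :
    ContDiff ℝ ∞ (fun x : E k => a.scale⁻¹ • (x - a.center)) := by
  fun_prop

end Cell

end Cells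

/-! ### Local charts, finite base atlases and the charts of lattice cells. -/

section Charts

variable {F : Type*} [NormedAddCommGroup F] [NormedSpace ℝ F]
  {H : Type*} [TopologicalSpace H] {I : ModelWithCorners ℝ F H}
  {X : Type*} [TopologicalSpace X] [ChartedSpace H X] {k : ℕ} {Z : Set X}

theorem IsLocalChart.source_subset {κ : PartialEquiv X (E k)} (h : IsLocalChart I k Z κ) :
    κ.source ⊆ Z := by
  obtain ⟨O, _, hO⟩ := h.source_open
  rw [hO]
  exact Set.inter_subset_left

theorem IsLocalChart.uniqueDiffOn_target {κ : PartialEquiv X (E k)} (h : IsLocalChart I k Z κ) :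
    UniqueDiffOn ℝ κ.target := by
  obtain ⟨O, hO, h | h⟩ := h.target_open
  · rw [h]
    exact hO.uniqueDiffOn
  · rw [h, Set.inter_comm]
    exact (uniqueDiffOn_halfSpace k).inter hO

/-- The inverse chart is continuous and the other source is relatively open in `Z`, so the overlap
is relatively open in the image of the first chart. -/
theorem IsLocalChart.uniqueDiffOn_overlap {κ κ' : PartialEquiv X (E k)}
    (h : IsLocalChart I k Z κ) (h' : IsLocalChart I k Z κ') :
    UniqueDiffOn ℝ (κ.target ∩ κ.symm ⁻¹' κ'.source) := by
  obtain ⟨O, hO, hs⟩ := h'.source_open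
  obtain ⟨u, hu, hu'⟩ := continuousOn_iff'.1 h.smooth_symm.continuousOn O hO
  have : κ.target ∩ κ.symm ⁻¹' κ'.source = κ.target ∩ u := by
    rw [Set.inter_comm _ u, ← hu', hs]
    ext x
    constructor
    · rintro ⟨h1, h2⟩
      exact ⟨h2.2, h1⟩
    · rintro ⟨h1, h2⟩
      exact ⟨h2, h.source_subset (κ.map_target h2), h1⟩
  rw [this]
  exact h.uniqueDiffOn_target.inter hu

theorem IsLocalChart.contDiffOn_overlap {κ κ' : PartialEquiv X (E k)}
    (h : IsLocalChart I k Z κ) (h' : IsLocalChart I k Z κ') :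
    ContDiffOn ℝ ∞ (κ' ∘ κ.symm) (κ.target ∩ κ.symm ⁻¹' κ'.source) := by
  rw [← contMDiffOn_iff_contDiffOn]
  exact h'.smooth.comp (h.smooth_symm.mono Set.inter_subset_left) (fun x hx => hx.2)

/-- `b` is a base chart of `Z`; it is a boundary chart only if `P` holds. -/
structure BaseChart.Fits (I : ModelWithCorners ℝ F H) (Z : Set X) (P : Prop) (b : BaseChart X k) :
    Prop where
  isLocalChart : IsLocalChart I k Z b.chart
  radius_pos : 0 < b.radius
  domain_eq : b.domain = Set.univ ∨ P ∧ b.domain = halfSpace k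
  target_subset : b.chart.target ⊆ b.domain
  box_subset : box b.center (2 * b.radius) ∩ b.domain ⊆ b.chart.target

/-- A finite family of base charts whose central parts cover `Z`. -/
structure IsBaseAtlas (I : ModelWithCorners ℝ F H) (Z : Set X) (P : Prop)
    (𝔅 : Set (BaseChart X k)) : Prop where
  finite : 𝔅.Finite
  fits : ∀ b ∈ 𝔅, b.Fits I Z P
  covers : ∀ p ∈ Z, ∃ b ∈ 𝔅, p ∈ b.chart.source ∧ b.chart p ∈ box b.center (b.radius / 2)

/-- Compactness leaves finitely many charts. The parameter `P` tells whether boundary charts are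
allowed: it is `True` for `B` and `False` for `Γ`. -/
theorem exists_baseAtlas (hZ : IsCompact Z) (P : Prop)
    (h : ∀ p ∈ Z, ∃ κ : PartialEquiv X (E k), IsLocalChart I k Z κ ∧ p ∈ κ.source ∧
      (P ∨ IsOpen κ.target)) :
    ∃ 𝔅 : Set (BaseChart X k), IsBaseAtlas I Z P 𝔅 := by
  have key : ∀ p ∈ Z, ∃ b : BaseChart X k, b.Fits I Z P ∧ ∃ U : Set X, IsOpen U ∧ p ∈ U ∧
      ∀ q ∈ U ∩ Z, q ∈ b.chart.source ∧ b.chart q ∈ box b.center (b.radius / 2) := by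
    intro p hp
    obtain ⟨κ, hκ, hpκ, hP⟩ := h p hp
    obtain ⟨D, O, hD, hO, hOD⟩ : ∃ D O : Set (E k), (D = Set.univ ∨ P ∧ D = halfSpace k) ∧
        IsOpen O ∧ κ.target = O ∩ D := by
      -- Any open image counts as that of an interior chart; only an image that is not open needs
      -- the half-space, and then the hypothesis yields `P`.
      by_cases hop : IsOpen κ.target
      · exact ⟨Set.univ, κ.target, Or.inl rfl, hop, by simp⟩
      · obtain ⟨O, hO, hO' | hO'⟩ := hκ.target_open
        · exact absurd (hO' ▸ hO) hop
        · exact ⟨halfSpace k, O, Or.inr ⟨hP.resolve_right hop, rfl⟩, hO, hO'⟩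
    have hpO : κ p ∈ O := (hOD ▸ κ.map_source hpκ : κ p ∈ O ∩ D).1
    obtain ⟨r, hr, hrO⟩ := exists_box_subset hO hpO
    refine ⟨⟨κ, κ p, r, D⟩, ⟨hκ, hr, hD, by simp [hOD], ?_⟩, ?_⟩
    · rw [hOD]
      exact Set.inter_subset_inter_left _ hrO
    · obtain ⟨O', hO', hs⟩ := hκ.source_open
      obtain ⟨u, hu, hu'⟩ := continuousOn_iff'.1 hκ.smooth.continuousOn
        (Metric.ball (κ p) (r / 2)) Metric.isOpen_ball
      have hpu : p ∈ u ∩ κ.source := by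
        rw [← hu']
        exact ⟨by simp [hr], hpκ⟩
      refine ⟨u ∩ O', hu.inter hO', ⟨hpu.1, (hs ▸ hpκ : p ∈ Z ∩ O').2⟩, ?_⟩
      rintro q ⟨⟨hqu, hqO⟩, hqZ⟩
      have hq : q ∈ κ.source := hs ▸ ⟨hqZ, hqO⟩
      have : q ∈ κ ⁻¹' Metric.ball (κ p) (r / 2) ∩ κ.source := hu' ▸ ⟨hqu, hq⟩
      exact ⟨hq, ball_subset_box _ _ this.1⟩
  rcases Z.eq_empty_or_nonempty with rfl | ⟨p₀, hp₀⟩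
  · exact ⟨∅, Set.finite_empty, by simp, by simp⟩
  have : Nonempty (BaseChart X k) := ⟨(key p₀ hp₀).choose⟩
  choose! b hb U hU hpU hbU using key
  obtain ⟨t, htZ, ht⟩ := hZ.elim_nhds_subcover U (fun p hp => (hU p hp).mem_nhds (hpU p hp))
  refine ⟨b '' (t : Set X), ?_, ?_, ?_⟩
  · exact Set.Finite.image b t.finite_toSet
  · rintro _ ⟨p, hp, rfl⟩
    exact hb p (htZ p hp)
  · intro q hq
    obtain ⟨p, hp, hqp⟩ := Set.mem_iUnion₂.1 (ht hq)
    exact ⟨b p, ⟨p, hp, rfl⟩, hbU p (htZ p hp) q ⟨hqp, hq⟩⟩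

namespace Cell

variable {P : Prop} {𝔅 : Set (BaseChart X k)}

theorem mem_target_iff {a : Cell X k} (h𝔅 : IsBaseAtlas I Z P 𝔅) (ha : a.Admissible 𝔅) {x : E k} :
    x ∈ a.chart.target ↔ x ∈ cube k ∧ a.center + a.scale • x ∈ a.base.domain := by
  have hb := h𝔅.fits _ ha.base_mem
  rw [mem_target_chart]
  exact ⟨fun h => ⟨h.1, hb.target_subset h.2⟩,
    fun h => ⟨h.1, hb.box_subset ⟨affine_mem_box ha h.1, h.2⟩⟩⟩

/-- This is why centres are lattice points. In a boundary chart, the zeroth coordinate of the centre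
is the width times a nonnegative integer. If the integer is zero, the boundary cuts the cell exactly
in half; if it is at least one, the open cell does not meet the boundary. -/
theorem target_eq {a : Cell X k} (h𝔅 : IsBaseAtlas I Z P 𝔅) (ha : a.Admissible 𝔅) :
    a.chart.target = cube k ∨ P ∧ a.chart.target = cube k ∩ halfSpace k := by
  have hb := h𝔅.fits _ ha.base_mem
  rcases hb.domain_eq with hD | ⟨hP, hD⟩
  · left
    ext x
    simp [mem_target_iff h𝔅 ha, hD]
  by_cases hk : 0 < k
  swap
  · left
    ext x
    rw [mem_target_iff h𝔅 ha, hD]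
    exact ⟨fun h => h.1, fun h => ⟨h, fun hk' => absurd hk' hk⟩⟩
  have hc : 0 ≤ a.center ⟨0, hk⟩ := by
    have := ha.center_domain
    rw [hD] at this
    exact this hk
  have hmem : ∀ x, x ∈ a.chart.target ↔
      x ∈ cube k ∧ 0 ≤ a.scale * a.index ⟨0, hk⟩ + a.scale * x ⟨0, hk⟩ := by
    intro x
    rw [mem_target_iff h𝔅 ha, hD]
    refine and_congr_right fun _ => ⟨fun h => ?_, fun h _ => ?_⟩
    · simpa [center] using h hk
    · simpa [center] using h
  have hi : 0 ≤ a.index ⟨0, hk⟩ := by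
    have : (0 : ℝ) ≤ a.index ⟨0, hk⟩ := by
      simp only [center] at hc
      exact nonneg_of_mul_nonneg_right hc a.scale_pos
    exact_mod_cast this
  rcases hi.eq_or_lt with h0 | h0
  · refine Or.inr ⟨hP, ?_⟩
    ext x
    rw [hmem, ← h0]
    refine and_congr_right fun _ => ⟨fun h _ => ?_, fun h => ?_⟩
    · simp only [Int.cast_zero, mul_zero, zero_add] at h
      exact nonneg_of_mul_nonneg_right h a.scale_pos
    · simpa using mul_nonneg a.scale_pos.le (h hk)
  · left
    ext x
    rw [hmem, and_iff_left_iff_imp]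
    intro hx
    have h1 : (1 : ℝ) ≤ a.index ⟨0, hk⟩ := by exact_mod_cast h0
    have h2 := (abs_lt.1 (hx ⟨0, hk⟩)).1
    rw [← mul_add]
    exact mul_nonneg a.scale_pos.le (by linarith)

theorem isLocalChart {a : Cell X k} (h𝔅 : IsBaseAtlas I Z P 𝔅) (ha : a.Admissible 𝔅) :
    IsLocalChart I k Z a.chart := by
  have hb := (h𝔅.fits _ ha.base_mem).isLocalChart
  have hsm : ContMDiffOn I 𝓘(ℝ, E k) ∞ a.chart a.base.chart.source :=
    a.contDiff_affine_symm.contMDiff.comp_contMDiffOn hb.smooth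
  refine ⟨?_, ⟨cube k, isOpen_cube k, ?_⟩, hsm.mono fun p hp => hp.1, ?_⟩
  · obtain ⟨O, hO, hs⟩ := hb.source_open
    obtain ⟨u, hu, hu'⟩ := continuousOn_iff'.1 hsm.continuousOn _ (isOpen_cube k)
    refine ⟨u ∩ O, hu.inter hO, ?_⟩
    have : a.chart.source = a.chart ⁻¹' cube k ∩ a.base.chart.source := by
      ext p
      rw [mem_source_chart, and_comm]
      rfl
    rw [this, hu', hs]
    ext p
    simp only [Set.mem_inter_iff]
    tauto
  · exact (target_eq h𝔅 ha).imp id fun h => h.2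
  · exact hb.smooth_symm.comp a.contDiff_affine.contMDiff.contMDiffOn fun x hx => hx.2

/-- Every point of `Z` lies in the central half of a cell of any given small width. -/
theorem exists_admissible (h𝔅 : IsBaseAtlas I Z P 𝔅) {ε : ℝ} (hε : 0 < ε) (hε1 : ε ≤ 1)
    (hεr : ∀ b ∈ 𝔅, ε ≤ b.radius) {p : X} (hp : p ∈ Z) :
    ∃ a : Cell X k, a.Admissible 𝔅 ∧ a.scale = ε ∧ p ∈ a.chart.source ∧
      ∀ i, |a.chart p i| ≤ 1 / 2 := by
  obtain ⟨b, hb, hpb, hpc⟩ := h𝔅.covers p hp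
  -- The nearest lattice point differs from the image of `p` by at most `ε / 2` in each coordinate,
  -- which puts `p` in the central half of the cell.
  let a : Cell X k := ⟨b, fun i => round (b.chart p i / ε), ε, hε⟩
  have hdiff : ∀ i, |b.chart p i - a.center i| ≤ ε / 2 := by
    intro i
    have h1 := abs_sub_round (b.chart p i / ε)
    have h2 : b.chart p i - a.center i = ε * (b.chart p i / ε - round (b.chart p i / ε)) := by
      simp only [center, a]
      field_simp
    rw [h2, abs_mul, abs_of_pos hε]
    nlinarith
  have hhalf : ∀ i, |a.chart p i| ≤ 1 / 2 := by
    intro i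
    have : a.chart p i = ε⁻¹ * (b.chart p i - a.center i) := by simp [chart_apply, a]
    rw [this, abs_mul, abs_of_pos (inv_pos.2 hε)]
    calc ε⁻¹ * |b.chart p i - a.center i| ≤ ε⁻¹ * (ε / 2) :=
          mul_le_mul_of_nonneg_left (hdiff i) (inv_pos.2 hε).le
      _ = 1 / 2 := by field_simp
  refine ⟨a, ⟨hb, ?_, ?_, hεr b hb, hε1⟩, rfl, ⟨hpb, fun i => (hhalf i).trans_lt (by norm_num)⟩,
    hhalf⟩
  · intro i
    have h1 := hdiff i
    have h2 := hpc i
    have h3 := hεr b hb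
    calc |a.center i - b.center i|
        = |(b.chart p i - b.center i) - (b.chart p i - a.center i)| := by ring_nf
      _ ≤ |b.chart p i - b.center i| + |b.chart p i - a.center i| := abs_sub _ _
      _ ≤ b.radius := by linarith
  -- Rounding keeps a nonnegative coordinate nonnegative, so the centre does not leave the
  -- half-space.
  · have hbD := (h𝔅.fits b hb).target_subset (b.chart.map_source hpb)
    rcases (h𝔅.fits b hb).domain_eq with hD | ⟨_, hD⟩
    · exact hD ▸ Set.mem_univ _
    · change a.center ∈ b.domain
      rw [hD] at hbD ⊢
      intro hk
      have h0 : 0 ≤ b.chart p ⟨0, hk⟩ / ε := div_nonneg (hbD hk) hε.le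
      have : 0 ≤ round (b.chart p ⟨0, hk⟩ / ε) := by
        rw [round_eq]
        exact Int.floor_nonneg.2 (by linarith)
      simp only [center, a]
      exact mul_nonneg hε.le (by exact_mod_cast this)

/-- The number of cells of the same width through a point is bounded. -/
theorem exists_multiplicity_le (h𝔅 : IsBaseAtlas I Z P 𝔅) : ∃ N : ℕ, ∀ ε : ℝ, ∀ p : X,
    {a : Cell X k | a.Admissible 𝔅 ∧ a.scale = ε ∧ p ∈ a.chart.source}.encard ≤ N := by
  classical
  refine ⟨(h𝔅.finite.toFinset.card) * Fintype.card (Fin k → Bool), fun ε p => ?_⟩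
  by_cases hε : 0 < ε
  swap
  · have : {a : Cell X k | a.Admissible 𝔅 ∧ a.scale = ε ∧ p ∈ a.chart.source} = ∅ := by
      ext a
      simp only [Set.mem_ofPred_eq, Set.mem_empty_iff_false, iff_false]
      rintro ⟨_, rfl, _⟩
      exact hε a.scale_pos
    rw [this]
    simp
  -- In a fixed base chart, a cell that contains `p` has each index equal to the floor of the scaled
  -- coordinate or to its successor. A Boolean vector records the choice.
  let f : BaseChart X k × (Fin k → Bool) → Cell X k := fun q =>
    ⟨q.1, fun i => ⌊q.1.chart p i / ε⌋ + if q.2 i then 1 else 0, ε, hε⟩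
  have hsub : {a : Cell X k | a.Admissible 𝔅 ∧ a.scale = ε ∧ p ∈ a.chart.source} ⊆
      f '' (h𝔅.finite.toFinset ×ˢ (Finset.univ : Finset (Fin k → Bool)) :
        Finset (BaseChart X k × (Fin k → Bool))) := by
    rintro ⟨b, z, ε', hε'⟩ ⟨ha, rfl, hp⟩
    refine ⟨(b, fun i => decide (z i ≠ ⌊b.chart p i / ε'⌋)), ?_, ?_⟩
    · simpa using ha.base_mem
    · have hz : ∀ i, z i = ⌊b.chart p i / ε'⌋ ∨ z i = ⌊b.chart p i / ε'⌋ + 1 := by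
        intro i
        have h1 : |ε'⁻¹ * (b.chart p i - ε' * z i)| < 1 := by
          simpa [center] using hp.2 i
        have h2 : ε'⁻¹ * (b.chart p i - ε' * z i) = b.chart p i / ε' - z i := by
          field_simp
        rw [h2, abs_lt] at h1
        have h3 := Int.floor_le (b.chart p i / ε')
        have h4 := Int.lt_floor_add_one (b.chart p i / ε')
        have h5 : ⌊b.chart p i / ε'⌋ - 1 < z i := by
          have : ((⌊b.chart p i / ε'⌋ : ℝ)) - 1 < z i := by linarith
          exact_mod_cast this
        have h6 : z i < ⌊b.chart p i / ε'⌋ + 2 := by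
          have : (z i : ℝ) < (⌊b.chart p i / ε'⌋ : ℝ) + 2 := by linarith
          exact_mod_cast this
        omega
      have : (fun i => ⌊b.chart p i / ε'⌋ +
          if decide (z i ≠ ⌊b.chart p i / ε'⌋) = true then (1 : ℤ) else 0) = z := by
        funext i
        rcases hz i with h | h <;> simp [h]
      simp only [f, this]
  refine (Set.encard_le_encard hsub).trans ((Set.encard_image_le _ _).trans ?_)
  rw [Set.encard_coe_eq_coe_finsetCard, Finset.card_product]
  simp

end Cell

end Charts

/-! ### Uniform bounds on cells -/

/-- Merges the constants of finitely many base charts, and of finitely many orders of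
differentiation, into one. -/
theorem exists_uniform_bound {α : Type*} {s : Set α} (hs : s.Finite) {p : α → ℝ → Prop}
    (hp : ∀ a c c', c ≤ c' → p a c → p a c') (h : ∀ a ∈ s, ∃ c, p a c) :
    ∃ c, 1 ≤ c ∧ ∀ a ∈ s, p a c := by
  choose! f hf using h
  obtain ⟨C, hC⟩ := (hs.image f).bddAbove
  exact ⟨max 1 C, le_max_left _ _, fun a ha => hp a _ _
    ((hC ⟨a, ha, rfl⟩).trans (le_max_right _ _)) (hf a ha)⟩

/-! ### Metrics in local coordinates. -/

section Push

variable {F : Type*} [NormedAddCommGroup F] [NormedSpace ℝ F]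
  {H : Type*} [TopologicalSpace H] {I : ModelWithCorners ℝ F H}
  {X : Type*} [TopologicalSpace X] [ChartedSpace H X] {k : ℕ} {Z : Set X}

/-- Differentiating `κ ∘ κ.symm = id` exhibits a left inverse of the derivative; the image is a set
of unique differentiability, also at the boundary. -/
theorem IsLocalChart.mfderivWithin_symm_injective {κ : PartialEquiv X (E k)}
    (h : IsLocalChart I k Z κ) {x : E k} (hx : x ∈ κ.target) {ξ : E k}
    (hξ : mfderivWithin 𝓘(ℝ, E k) I κ.symm κ.target x ξ = 0) : ξ = 0 := by
  have h1 : HasMFDerivWithinAt 𝓘(ℝ, E k) I κ.symm κ.target x _ :=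
    ((h.smooth_symm x hx).mdifferentiableWithinAt (by simp)).hasMFDerivWithinAt
  have h2 : HasMFDerivWithinAt I 𝓘(ℝ, E k) κ κ.source (κ.symm x) _ :=
    ((h.smooth _ (κ.map_target hx)).mdifferentiableWithinAt (by simp)).hasMFDerivWithinAt
  have h3 := h2.comp x h1 (fun y hy => κ.map_target hy)
  have h4 : HasMFDerivWithinAt 𝓘(ℝ, E k) 𝓘(ℝ, E k) (κ ∘ κ.symm) κ.target x
      (ContinuousLinearMap.id ℝ (E k)) :=
    ((hasFDerivWithinAt_id x κ.target).congr (fun y hy => κ.right_inv hy)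
      (κ.right_inv hx)).hasMFDerivWithinAt
  have hu : UniqueMDiffWithinAt 𝓘(ℝ, E k) κ.target x :=
    (h.uniqueDiffOn_target x hx).uniqueMDiffWithinAt
  have h5 := hu.eq h3 h4
  have h6 : mfderivWithin I 𝓘(ℝ, E k) κ κ.source (κ.symm x)
      (mfderivWithin 𝓘(ℝ, E k) I κ.symm κ.target x ξ) = ξ := DFunLike.congr_fun h5 ξ
  rw [hξ, map_zero] at h6
  exact h6.symm

theorem pushForm_apply {κ : PartialEquiv X (E k)}
    {G : ∀ p : X, TangentSpace I p →L[ℝ] TangentSpace I p →L[ℝ] ℝ} {x ξ η : E k} :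
    pushForm I κ G x ξ η = G (κ.symm x) (mfderivWithin 𝓘(ℝ, E k) I κ.symm κ.target x ξ)
      (mfderivWithin 𝓘(ℝ, E k) I κ.symm κ.target x η) := rfl

theorem IsLocalChart.pushForm_pos {κ : PartialEquiv X (E k)}
    {G : ∀ p : X, TangentSpace I p →L[ℝ] TangentSpace I p →L[ℝ] ℝ}
    (h : IsLocalChart I k Z κ) (hG : ∀ p, ∀ v : TangentSpace I p, v ≠ 0 → 0 < G p v v)
    {x : E k} (hx : x ∈ κ.target) {ξ : E k} (hξ : ξ ≠ 0) : 0 < pushForm I κ G x ξ ξ := by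
  rw [pushForm_apply]
  exact hG _ _ fun h0 => hξ (h.mfderivWithin_symm_injective hx h0)

end Push

section Riemannian

variable {e : ℕ} {Γ : Type*} [TopologicalSpace Γ] [ChartedSpace (E e) Γ] [IsManifold (𝓡 e) ∞ Γ]

/-- A smooth Riemannian metric is smooth in local coordinates. -/
theorem contDiffOn_pushForm
    (g : Bundle.ContMDiffRiemannianMetric (𝓡 e) ∞ (E e) (fun z : Γ => TangentSpace (𝓡 e) z))
    {k : ℕ} {Z : Set Γ} {κ : PartialEquiv Γ (E k)} (h : IsLocalChart (𝓡 e) k Z κ) :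
    ContDiffOn ℝ ∞ (pushForm (𝓡 e) κ g.inner) κ.target := by
  have : IsManifold (𝓡 e) 1 Γ := IsManifold.of_le (n := ∞) (by simp)
  have hu : UniqueMDiffOn 𝓘(ℝ, E k) κ.target := h.uniqueDiffOn_target.uniqueMDiffOn
  have hT := h.smooth_symm.contMDiffOn_tangentMapWithin (m := ∞) (by simp) hu
  -- For a fixed vector `ξ`, this is the tangent map of the inverse chart along a constant section.
  -- Smoothness of the pushed form can thus be tested on fixed pairs of vectors.
  have hv : ∀ ξ : E k, ContMDiffOn 𝓘(ℝ, E k) ((𝓡 e).prod 𝓘(ℝ, E e)) ∞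
      (fun x => (⟨κ.symm x, mfderivWithin 𝓘(ℝ, E k) (𝓡 e) κ.symm κ.target x ξ⟩ :
        TangentBundle (𝓡 e) Γ)) κ.target := by
    intro ξ
    have hs : ContMDiff 𝓘(ℝ, E k) 𝓘(ℝ, E k).tangent ∞
        (fun x : E k => (⟨x, ξ⟩ : TangentBundle 𝓘(ℝ, E k) (E k))) :=
      contMDiff_vectorSpace_iff_contDiff.2 (contDiff_const (c := ξ))
    exact hT.comp hs.contMDiffOn (fun x hx => hx)
  rw [contDiffOn_clm_apply]
  intro ξ
  rw [contDiffOn_clm_apply]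
  intro η
  rw [← contMDiffOn_iff_contDiffOn]
  intro x hx
  have key : ContMDiffWithinAt 𝓘(ℝ, E k) ((𝓡 e).prod 𝓘(ℝ, ℝ)) ∞
      (fun x => Bundle.TotalSpace.mk' ℝ (E := Bundle.Trivial Γ ℝ) (κ.symm x)
        (g.inner (κ.symm x) (mfderivWithin 𝓘(ℝ, E k) (𝓡 e) κ.symm κ.target x ξ)
          (mfderivWithin 𝓘(ℝ, E k) (𝓡 e) κ.symm κ.target x η))) κ.target x := by
    apply ContMDiffWithinAt.clm_bundle_apply₂ (F₁ := E e) (F₂ := E e)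
    · exact ContMDiffAt.comp_contMDiffWithinAt x g.contMDiff.contMDiffAt (h.smooth_symm x hx)
    · exact hv ξ x hx
    · exact hv η x hx
  simp only [Bundle.contMDiffWithinAt_totalSpace] at key
  exact key.2

end Riemannian

/-! ### Compactness bounds in base charts, carried over to cells. -/

section CellBounds

variable {F : Type*} [NormedAddCommGroup F] [NormedSpace ℝ F]
  {H : Type*} [TopologicalSpace H] {I : ModelWithCorners ℝ F H}
  {X : Type*} [TopologicalSpace X] [ChartedSpace H X] {k : ℕ} {Z : Set X} {P : Prop}
  {𝔅 : Set (BaseChart X k)} {Y : Type*} [NormedAddCommGroup Y] [NormedSpace ℝ Y]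

/-- The compact part of the image of a base chart that contains all admissible cells. -/
def BaseChart.core {X : Type*} {k : ℕ} (b : BaseChart X k) : Set (E k) :=
  box b.center (2 * b.radius) ∩ b.domain

theorem BaseChart.Fits.isCompact_core {b : BaseChart X k} (hb : b.Fits I Z P) :
    IsCompact b.core := by
  refine (isCompact_box _ _).inter_right ?_
  rcases hb.domain_eq with h | ⟨_, h⟩
  · rw [h]
    exact isClosed_univ
  · rw [h]
    exact isClosed_halfSpace k

namespace Cell

theorem affine_mem_core {a : Cell X k} (h𝔅 : IsBaseAtlas I Z P 𝔅) (ha : a.Admissible 𝔅) {x : E k}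
    (hx : x ∈ a.chart.target) : a.center + a.scale • x ∈ a.base.core :=
  ⟨affine_mem_box ha hx.1, ((mem_target_iff h𝔅 ha).1 hx).2⟩

theorem uniqueDiffOn_target {a : Cell X k} (h𝔅 : IsBaseAtlas I Z P 𝔅) (ha : a.Admissible 𝔅) :
    UniqueDiffOn ℝ a.chart.target := (isLocalChart h𝔅 ha).uniqueDiffOn_target

/-- Smooth functions in base charts, restricted to cells. -/
theorem uniformlyBounded_rescale (h𝔅 : IsBaseAtlas I Z P 𝔅) {f : BaseChart X k → E k → Y}
    (hf : ∀ b ∈ 𝔅, ContDiffOn ℝ ∞ (f b) b.chart.target) :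
    UniformlyBounded (fun a : {a : Cell X k // a.Admissible 𝔅} => a.1.chart.target)
      (fun a x => f a.1.base (a.1.center + a.1.scale • x)) := by
  have hmaps : ∀ a : {a : Cell X k // a.Admissible 𝔅},
      Set.MapsTo (fun x => a.1.center + a.1.scale • x) a.1.chart.target a.1.base.chart.target :=
    fun a x hx => hx.2
  refine uniformlyBounded_iff.2 ⟨fun a => (hf _ a.2.base_mem).comp a.1.contDiff_affine.contDiffOn
    (hmaps a), fun j => ?_⟩
  -- The cores are compact, there are finitely many of them, and they contain all admissible cells.
  -- Rescaling by a factor at most one does not spoil the bounds.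
  obtain ⟨C, hC1, hC⟩ : ∃ C : ℝ, 1 ≤ C ∧ ∀ q ∈ 𝔅 ×ˢ Set.Iic j, ∀ x ∈ q.1.core,
      ‖iteratedFDerivWithin ℝ q.2 (f q.1) q.1.chart.target x‖ ≤ C := by
    refine exists_uniform_bound (h𝔅.finite.prod (Set.finite_Iic j))
      (fun q c c' hc h x hx => (h x hx).trans hc) ?_
    rintro ⟨b, l⟩ ⟨hb, _⟩
    have hfit := h𝔅.fits b hb
    exact hfit.isCompact_core.exists_bound_of_continuousOn
      (((hf b hb).continuousOn_iteratedFDerivWithin (by exact_mod_cast le_top)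
        hfit.isLocalChart.uniqueDiffOn_target).mono hfit.box_subset)
  refine ⟨j.factorial * C, fun a x hx => ?_⟩
  have hb := h𝔅.fits _ a.2.base_mem
  refine (norm_iteratedFDerivWithin_comp_affine_le a.1.scale_pos.le (hf _ a.2.base_mem)
    hb.isLocalChart.uniqueDiffOn_target (uniqueDiffOn_target h𝔅 a.2) (hmaps a) hx
    (fun l hl => hC (a.1.base, l) ⟨a.2.base_mem, hl⟩ _ (affine_mem_core h𝔅 a.2 hx))).trans ?_
  exact mul_le_of_le_one_right (by positivity)
    (pow_le_one₀ a.1.scale_pos.le a.2.scale_le_one)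

/-- The transition maps between cells of comparable widths. -/
theorem uniformlyBounded_transition [T2Space X] (h𝔅 : IsBaseAtlas I Z P 𝔅) (K : ℝ) :
    UniformlyBounded (fun q : {q : Cell X k × Cell X k // q.1.Admissible 𝔅 ∧ q.2.Admissible 𝔅 ∧
        q.1.scale ≤ K * q.2.scale} => q.1.1.chart.target ∩ q.1.1.chart.symm ⁻¹' q.1.2.chart.source)
      (fun q => q.1.2.chart ∘ q.1.1.chart.symm) := by
  refine uniformlyBounded_iff.2 ⟨fun q => (isLocalChart h𝔅 q.2.1).contDiffOn_overlap
    (isLocalChart h𝔅 q.2.2.1), fun j => ?_⟩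
  let D : BaseChart X k × BaseChart X k → Set (E k) := fun b =>
    b.1.chart.target ∩ b.1.chart.symm ⁻¹' b.2.chart.source
  let f : BaseChart X k × BaseChart X k → E k → E k := fun b => b.2.chart ∘ b.1.chart.symm
  have hf : ∀ b ∈ 𝔅 ×ˢ 𝔅, ContDiffOn ℝ ∞ (f b) (D b) := fun b hb =>
    (h𝔅.fits _ hb.1).isLocalChart.contDiffOn_overlap (h𝔅.fits _ hb.2).isLocalChart
  have hD : ∀ b ∈ 𝔅 ×ˢ 𝔅, UniqueDiffOn ℝ (D b) := fun b hb =>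
    (h𝔅.fits _ hb.1).isLocalChart.uniqueDiffOn_overlap (h𝔅.fits _ hb.2).isLocalChart
  -- The overlap of the base charts is not compact, but its part belonging to both cores is, since
  -- the image of a core is closed in the Hausdorff space `X`. Overlaps of admissible cells lie in
  -- that part.
  let S : BaseChart X k × BaseChart X k → Set (E k) := fun b =>
    b.1.core ∩ b.1.chart.symm ⁻¹' (b.2.chart.symm '' b.2.core)
  have hSD : ∀ b ∈ 𝔅 ×ˢ 𝔅, S b ⊆ D b := by
    rintro b hb x ⟨hx1, y, hy, hyx⟩
    refine ⟨(h𝔅.fits _ hb.1).box_subset hx1, ?_⟩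
    rw [Set.mem_preimage, ← hyx]
    exact b.2.chart.map_target ((h𝔅.fits _ hb.2).box_subset hy)
  have hS : ∀ b ∈ 𝔅 ×ˢ 𝔅, IsCompact (S b) := by
    intro b hb
    have h1 := h𝔅.fits _ hb.1
    have h2 := h𝔅.fits _ hb.2
    have hc : IsCompact (b.2.chart.symm '' b.2.core) := h2.isCompact_core.image_of_continuousOn
      (h2.isLocalChart.smooth_symm.continuousOn.mono h2.box_subset)
    exact h1.isCompact_core.of_isClosed_subset
      ((h1.isLocalChart.smooth_symm.continuousOn.mono h1.box_subset).preimage_isClosed_of_isClosed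
        h1.isCompact_core.isClosed hc.isClosed) Set.inter_subset_left
  obtain ⟨C, hC1, hC⟩ : ∃ C : ℝ, 1 ≤ C ∧ ∀ q ∈ (𝔅 ×ˢ 𝔅) ×ˢ Set.Iic j, ∀ x ∈ S q.1,
      ‖iteratedFDerivWithin ℝ q.2 (f q.1) (D q.1) x‖ ≤ C := by
    refine exists_uniform_bound ((h𝔅.finite.prod h𝔅.finite).prod (Set.finite_Iic j))
      (fun q c c' hc h x hx => (h x hx).trans hc) ?_
    rintro ⟨b, l⟩ ⟨hb, _⟩
    exact (hS b hb).exists_bound_of_continuousOn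
      (((hf b hb).continuousOn_iteratedFDerivWithin (by exact_mod_cast le_top)
        (hD b hb)).mono (hSD b hb))
  refine ⟨max k (|K| * (j.factorial * C)), ?_⟩
  rintro ⟨⟨a, a'⟩, ha, ha', hK⟩ x hx
  -- The values lie in the cube, which settles order zero. For order `j + 1`, rescaling yields the
  -- factor `a.scale ^ (j + 1) / a'.scale`: one quotient of widths is at most `|K|`, and the
  -- remaining power is at most one.
  rcases j with _ | j
  · rw [norm_iteratedFDerivWithin_zero]
    refine le_max_of_le_left ?_
    simpa using norm_le_of_abs_apply_le zero_le_one fun i => ((a'.chart.map_source hx.2).1 i).le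
  · refine le_max_of_le_right ?_
    set T := a.chart.target ∩ a.chart.symm ⁻¹' a'.chart.source with hT
    have hb : (a.base, a'.base) ∈ 𝔅 ×ˢ 𝔅 := ⟨ha.base_mem, ha'.base_mem⟩
    have hTu : UniqueDiffOn ℝ T :=
      (isLocalChart h𝔅 ha).uniqueDiffOn_overlap (isLocalChart h𝔅 ha')
    have hmaps : Set.MapsTo (fun x => a.center + a.scale • x) T (D (a.base, a'.base)) :=
      fun y hy => ⟨hy.1.2, hy.2.1⟩
    have hmem : a.center + a.scale • x ∈ S (a.base, a'.base) := by
      refine ⟨affine_mem_core h𝔅 ha hx.1, a'.base.chart (a.chart.symm x), ?_, ?_⟩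
      · have h1 := a'.chart.map_source hx.2
        have h2 := affine_mem_core h𝔅 ha' h1
        rwa [chart_apply, smul_inv_smul₀ a'.scale_pos.ne', add_sub_cancel] at h2
      · exact a'.base.chart.left_inv hx.2.1
    have hbound := norm_iteratedFDerivWithin_comp_affine_le (j := j + 1) a.scale_pos.le (hf _ hb)
      (hD _ hb) hTu hmaps hx
      (fun l hl => hC ((a.base, a'.base), l) ⟨hb, hl⟩ _ hmem)
    let G : E k → E k := fun x => f (a.base, a'.base) (a.center + a.scale • x)
    have hG : ContDiffOn ℝ ∞ G T := (hf _ hb).comp a.contDiff_affine.contDiffOn hmaps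
    have hle : ((j + 1 : ℕ) : WithTop ℕ∞) ≤ ((⊤ : ℕ∞) : WithTop ℕ∞) := by exact_mod_cast le_top
    have hfun : (a'.chart ∘ a.chart.symm) = a'.scale⁻¹ • G + fun _ => -(a'.scale⁻¹ • a'.center) := by
      funext y
      simp only [Function.comp_apply, chart_apply, chart_symm_apply, Pi.add_apply, Pi.smul_apply,
        G, f]
      rw [smul_sub, sub_eq_add_neg]
    have hsm : ContDiffWithinAt ℝ (j + 1 : ℕ) G T x := (hG x hx).of_le hle
    have hcs : ContDiffWithinAt ℝ (j + 1 : ℕ) (a'.scale⁻¹ • G) T x :=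
      contDiffWithinAt_const.smul hsm
    have hder : iteratedFDerivWithin ℝ (j + 1) (a'.chart ∘ a.chart.symm) T x =
        a'.scale⁻¹ • iteratedFDerivWithin ℝ (j + 1) G T x := by
      rw [hfun, iteratedFDerivWithin_add_apply hcs contDiffWithinAt_const hTu hx,
        iteratedFDerivWithin_const_smul_apply hsm hTu hx, iteratedFDerivWithin_succ_const]
      simp
    rw [hder, norm_smul, Real.norm_of_nonneg (inv_pos.2 a'.scale_pos).le]
    have h3 : a'.scale⁻¹ * a.scale ≤ |K| := by
      rw [inv_mul_le_iff₀ a'.scale_pos, mul_comm]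
      exact hK.trans (mul_le_mul_of_nonneg_right (le_abs_self K) a'.scale_pos.le)
    have h4 : a.scale ^ j ≤ 1 := pow_le_one₀ a.scale_pos.le ha.scale_le_one
    calc a'.scale⁻¹ * ‖iteratedFDerivWithin ℝ (j + 1) G T x‖
        ≤ a'.scale⁻¹ * ((j + 1).factorial * C * a.scale ^ (j + 1)) :=
          mul_le_mul_of_nonneg_left hbound (inv_pos.2 a'.scale_pos).le
      _ = (a'.scale⁻¹ * a.scale) * ((j + 1).factorial * C) * a.scale ^ j := by ring
      _ ≤ (a'.scale⁻¹ * a.scale) * ((j + 1).factorial * C) := by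
          refine mul_le_of_le_one_right ?_ h4
          have := a'.scale_pos
          have := a.scale_pos
          positivity
      _ ≤ |K| * ((j + 1).factorial * C) := mul_le_mul_of_nonneg_right h3 (by positivity)

end Cell

/-- A continuous field of positive forms on a compact set is equivalent to the Euclidean one. -/
theorem exists_equivalent_of_isCompact {S : Set (E k)} (hS : IsCompact S)
    {a : E k → E k →L[ℝ] E k →L[ℝ] ℝ} (ha : ContinuousOn a S)
    (hpos : ∀ x ∈ S, ∀ ξ, ξ ≠ 0 → 0 < a x ξ ξ) :
    ∃ c : ℝ, 0 < c ∧ ∀ x ∈ S, ∀ ξ, ‖ξ‖ ^ 2 / c ≤ a x ξ ξ ∧ a x ξ ξ ≤ c * ‖ξ‖ ^ 2 := by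
  obtain ⟨C, hC⟩ := hS.exists_bound_of_continuousOn (f := a) ha
  have hcont : ContinuousOn (fun q : E k × E k => a q.1 q.2 q.2)
      (S ×ˢ Metric.sphere (0 : E k) 1) := by
    have h1 : ContinuousOn (fun q : E k × E k => a q.1) (S ×ˢ Metric.sphere (0 : E k) 1) :=
      ha.comp continuousOn_fst fun q hq => hq.1
    exact (h1.clm_apply continuousOn_snd).clm_apply continuousOn_snd
  -- The least value on unit vectors over the compact set gives the lower constant; homogeneity
  -- extends it to all vectors.
  obtain ⟨δ, hδ, hmin⟩ := (hS.prod (isCompact_sphere (0 : E k) 1)).exists_forall_le' hcont (a := 0)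
    (by
      rintro ⟨x, ξ⟩ ⟨hx, hξ⟩
      exact hpos x hx ξ (ne_zero_of_mem_unit_sphere (⟨ξ, hξ⟩ : Metric.sphere (0 : E k) 1)))
  refine ⟨max (δ⁻¹) (max C 1), lt_max_of_lt_left (inv_pos.2 hδ), fun x hx ξ => ⟨?_, ?_⟩⟩
  · have h1 : ‖ξ‖ ^ 2 * δ ≤ a x ξ ξ := by
      rcases eq_or_ne ξ 0 with rfl | h0
      · simp
      · have hn : ‖ξ‖ ≠ 0 := norm_ne_zero_iff.2 h0
        have h2 := hmin (x, ‖ξ‖⁻¹ • ξ) ⟨hx, by simp [norm_smul, hn]⟩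
        simp only [map_smul, smul_apply, smul_eq_mul] at h2
        calc ‖ξ‖ ^ 2 * δ ≤ ‖ξ‖ ^ 2 * (‖ξ‖⁻¹ * (‖ξ‖⁻¹ * a x ξ ξ)) := by gcongr
          _ = a x ξ ξ := by field_simp
    refine le_trans ?_ h1
    rw [div_eq_mul_inv]
    refine mul_le_mul_of_nonneg_left ?_ (sq_nonneg _)
    exact inv_le_of_inv_le₀ hδ (le_max_left _ _)
  · calc a x ξ ξ ≤ ‖a x ξ ξ‖ := Real.le_norm_self _
      _ ≤ ‖a x‖ * ‖ξ‖ * ‖ξ‖ := (a x).le_opNorm₂ ξ ξ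
      _ ≤ max (δ⁻¹) (max C 1) * ‖ξ‖ * ‖ξ‖ := by
          gcongr
          exact (hC x hx).trans ((le_max_left _ _).trans (le_max_right _ _))
      _ = _ := by ring

theorem IsBaseAtlas.exists_equivalent (h𝔅 : IsBaseAtlas I Z P 𝔅)
    {a : BaseChart X k → E k → E k →L[ℝ] E k →L[ℝ] ℝ}
    (ha : ∀ b ∈ 𝔅, ContinuousOn (a b) b.chart.target)
    (hpos : ∀ b ∈ 𝔅, ∀ x ∈ b.chart.target, ∀ ξ, ξ ≠ 0 → 0 < a b x ξ ξ) :
    ∃ c : ℝ, 1 ≤ c ∧ ∀ b ∈ 𝔅, ∀ x ∈ b.core, ∀ ξ,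
      ‖ξ‖ ^ 2 / c ≤ a b x ξ ξ ∧ a b x ξ ξ ≤ c * ‖ξ‖ ^ 2 := by
  obtain ⟨c, hc1, hc⟩ := exists_uniform_bound h𝔅.finite (p := fun b c => 0 < c ∧ ∀ x ∈ b.core, ∀ ξ,
      ‖ξ‖ ^ 2 / c ≤ a b x ξ ξ ∧ a b x ξ ξ ≤ c * ‖ξ‖ ^ 2)
    (by
      rintro b c c' hcc' ⟨hc0, h⟩
      refine ⟨hc0.trans_le hcc', fun x hx ξ => ⟨le_trans ?_ (h x hx ξ).1, (h x hx ξ).2.trans ?_⟩⟩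
      · gcongr
      · gcongr)
    (fun b hb => exists_equivalent_of_isCompact (h𝔅.fits b hb).isCompact_core
      ((ha b hb).mono (h𝔅.fits b hb).box_subset)
      (fun x hx => hpos b hb x ((h𝔅.fits b hb).box_subset hx)))
  exact ⟨c, hc1, fun b hb => (hc b hb).2⟩

end CellBounds

/-! ### Moderate functions on `(0, ∞)` -/

/-- `f` is bounded below by a positive constant, and each derivative of `f` is bounded by a multiple
of `f`. -/
structure IsModerate (f : ℝ → ℝ) : Prop where
  smooth : ContDiffOn ℝ ∞ f (Set.Ioi 0)
  lower : ∃ c : ℝ, 0 < c ∧ ∀ s ∈ Set.Ioi (0 : ℝ), c ≤ f s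
  deriv_le : ∀ j : ℕ, ∃ c : ℝ, ∀ s ∈ Set.Ioi (0 : ℝ),
    |iteratedDerivWithin j f (Set.Ioi 0) s| ≤ c * f s

namespace IsModerate

variable {f : ℝ → ℝ}

theorem pos (hf : IsModerate f) {s : ℝ} (hs : 0 < s) : 0 < f s := by
  obtain ⟨c, hc, h⟩ := hf.lower
  exact hc.trans_le (h s hs)

/-- Values at bounded distance are comparable. -/
theorem exists_ratio_le (hf : IsModerate f) : ∃ K : ℝ, 1 ≤ K ∧ ∀ s s' : ℝ, 0 < s → 0 < s' →
    |s - s'| ≤ 2 → f s ≤ K * f s' := by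
  obtain ⟨c, hc⟩ := hf.deriv_le 1
  have hd : ∀ s ∈ Set.Ioi (0 : ℝ), HasDerivWithinAt (fun s => Real.log (f s))
      (deriv f s / f s) (Set.Ioi 0) s := by
    intro s hs
    have h1 : DifferentiableAt ℝ f s :=
      (hf.smooth.contDiffAt (isOpen_Ioi.mem_nhds hs)).differentiableAt (by simp)
    exact (h1.hasDerivAt.log (hf.pos hs).ne').hasDerivWithinAt
  have hb : ∀ s ∈ Set.Ioi (0 : ℝ), ‖deriv f s / f s‖ ≤ |c| := by
    intro s hs
    have h1 := hc s hs
    rw [iteratedDerivWithin_one, derivWithin_of_isOpen isOpen_Ioi hs] at h1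
    rw [norm_div, Real.norm_eq_abs, Real.norm_of_nonneg (hf.pos hs).le, div_le_iff₀ (hf.pos hs)]
    exact h1.trans (mul_le_mul_of_nonneg_right (le_abs_self c) (hf.pos hs).le)
  -- Since `log f` has derivative bounded by `|c|`, it changes by at most `2 |c|` over the distance
  -- two.
  refine ⟨Real.exp (|c| * 2), Real.one_le_exp (by positivity), fun s s' hs hs' h => ?_⟩
  have h1 := (convex_Ioi (0 : ℝ)).norm_image_sub_le_of_norm_hasDerivWithin_le hd hb hs' hs
  rw [Real.norm_eq_abs, Real.norm_eq_abs] at h1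
  have h2 : Real.log (f s) ≤ |c| * 2 + Real.log (f s') := by
    have := (le_abs_self _).trans (h1.trans (mul_le_mul_of_nonneg_left h (abs_nonneg c)))
    linarith
  rw [← Real.exp_log (hf.pos hs), ← Real.exp_log (hf.pos hs'), ← Real.exp_add]
  exact Real.exp_le_exp.2 (by simpa [Real.exp_log (hf.pos hs), Real.exp_log (hf.pos hs')] using h2)

/-- The functions `f (i + x) / f i` are uniformly bounded on `(-1, 1)`. -/
theorem uniformlyBounded (hf : IsModerate f) :
    UniformlyBounded (fun _ : {i : ℕ // 1 ≤ i} => Set.Ioo (-1 : ℝ) 1)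
      (fun i x => (f i.1)⁻¹ * f (i.1 + x)) := by
  obtain ⟨K, hK1, hK⟩ := hf.exists_ratio_le
  have hmaps : ∀ i : {i : ℕ // 1 ≤ i},
      Set.MapsTo (fun x : ℝ => (i.1 : ℝ) + (1 : ℝ) • x) (Set.Ioo (-1) 1) (Set.Ioi 0) := by
    intro i x hx
    have : (1 : ℝ) ≤ i.1 := by exact_mod_cast i.2
    simp only [one_smul, Set.mem_Ioi]
    linarith [hx.1]
  have hcd : ∀ i : {i : ℕ // 1 ≤ i}, ContDiffOn ℝ ∞ (fun x : ℝ => f (i.1 + (1 : ℝ) • x))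
      (Set.Ioo (-1) 1) := fun i => hf.smooth.comp (by fun_prop) (hmaps i)
  refine UniformlyBounded.congr (f := fun i x => (f i.1)⁻¹ • f (i.1 + (1 : ℝ) • x)) ?_
    (fun i x _ => by simp)
  refine uniformlyBounded_iff.2 ⟨fun i => (hcd i).const_smul _, fun j => ?_⟩
  choose c hc using hf.deriv_le
  obtain ⟨C, hC1, hC⟩ := exists_uniform_bound (Set.finite_Iic j) (p := fun l C => c l ≤ C)
    (fun _ _ _ h h' => h'.trans h) (fun l _ => ⟨c l, le_rfl⟩)
  refine ⟨j.factorial * C * K, fun i x hx => ?_⟩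
  have hi : (0 : ℝ) < i.1 := by exact_mod_cast i.2
  have hx0 := hmaps i hx
  -- The estimate needs bounds only at the image of the point `x`, so the constant may contain the
  -- value of `f` there. The division by `f i` then leaves a ratio controlled by `K`.
  have h1 := norm_iteratedFDerivWithin_comp_affine_le (j := j) zero_le_one hf.smooth
    isOpen_Ioi.uniqueDiffOn isOpen_Ioo.uniqueDiffOn (hmaps i) hx (C := C * f (i.1 + (1 : ℝ) • x))
    (fun l hl => by
      rw [norm_iteratedFDerivWithin_eq_norm_iteratedDerivWithin]
      exact (hc l _ hx0).trans (mul_le_mul_of_nonneg_right (hC l hl) (hf.pos hx0).le))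
  have h2 : iteratedFDerivWithin ℝ j (fun x => (f i.1)⁻¹ • f (i.1 + (1 : ℝ) • x)) (Set.Ioo (-1) 1) x
      = (f i.1)⁻¹ • iteratedFDerivWithin ℝ j (fun x => f (i.1 + (1 : ℝ) • x)) (Set.Ioo (-1) 1) x :=
    iteratedFDerivWithin_const_smul_apply (a := (f i.1)⁻¹) (i := j)
      (f := fun x => f (i.1 + (1 : ℝ) • x)) ((hcd i x hx).of_le (by exact_mod_cast le_top))
      isOpen_Ioo.uniqueDiffOn hx
  have h3 : f (i.1 + (1 : ℝ) • x) ≤ K * f i.1 := by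
    refine hK _ _ hx0 hi ?_
    simp only [one_smul, add_sub_cancel_left]
    exact (abs_le.2 ⟨hx.1.le, hx.2.le⟩).trans one_le_two
  rw [h2, norm_smul, norm_inv, Real.norm_of_nonneg (hf.pos hi).le, inv_mul_le_iff₀ (hf.pos hi)]
  refine h1.trans ?_
  rw [one_pow, mul_one]
  calc (j.factorial : ℝ) * (C * f (i.1 + (1 : ℝ) • x)) ≤ j.factorial * (C * (K * f i.1)) := by
        gcongr
    _ = f i.1 * (j.factorial * C * K) := by ring

end IsModerate

/-! ### Splitting the coordinates -/

/-- `ℝ^m = ℝ^d × ℝ × ℝ^e` for `m = 1 + d + e`. -/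
noncomputable def splitEquiv {d e m : ℕ} (hm : m = 1 + d + e) : E m ≃L[ℝ] E d × ℝ × E e :=
  LinearEquiv.toContinuousLinearEquiv
    { toFun := fun x => (WithLp.toLp 2 fun j => x ⟨j, by omega⟩, x ⟨d, by omega⟩,
        WithLp.toLp 2 fun j => x ⟨d + 1 + j, by omega⟩)
      map_add' := fun x y => rfl
      map_smul' := fun c x => rfl
      invFun := fun q => WithLp.toLp 2 fun i =>
        if h : i.1 < d then q.1 ⟨i, h⟩ else if h' : i.1 = d then q.2.1 else q.2.2 ⟨i - (d + 1), by omega⟩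
      left_inv := fun x => by
        ext i
        simp only
        split_ifs with h h'
        · rfl
        · exact congrArg x (Fin.ext h'.symm)
        · exact congrArg x (Fin.ext (by simp; omega))
      right_inv := fun q => by
        refine Prod.ext ?_ (Prod.ext ?_ ?_)
        · ext j
          simp
        · simp
        · ext j
          have h1 : ¬ (d + 1 + j.1 < d) := by omega
          have h2 : ¬ (d + 1 + j.1 = d) := by omega
          simp [h1, h2] }

section Split

variable {d e m : ℕ} (hm : m = 1 + d + e)

theorem splitEquiv_fst (x : E m) (j : Fin d) :
    (splitEquiv hm x).1 j = x ⟨j, by omega⟩ := rfl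

theorem splitEquiv_snd_fst (x : E m) : (splitEquiv hm x).2.1 = x ⟨d, by omega⟩ := rfl

theorem splitEquiv_snd_snd (x : E m) (j : Fin e) :
    (splitEquiv hm x).2.2 j = x ⟨d + 1 + j, by omega⟩ := rfl

theorem mem_cube_iff_split {x : E m} : x ∈ cube m ↔
    (splitEquiv hm x).1 ∈ cube d ∧ |(splitEquiv hm x).2.1| < 1 ∧ (splitEquiv hm x).2.2 ∈ cube e := by
  constructor
  · exact fun h => ⟨fun j => h _, h _, fun j => h _⟩
  · rintro ⟨h1, h2, h3⟩ i
    rcases lt_trichotomy i.1 d with h | h | h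
    · exact h1 ⟨i, h⟩
    · have : i = ⟨d, by omega⟩ := Fin.ext h
      rw [this]
      exact h2
    · have := h3 ⟨i - (d + 1), by omega⟩
      rw [splitEquiv_snd_snd] at this
      have hi : (⟨d + 1 + (i.1 - (d + 1)), by omega⟩ : Fin m) = i := Fin.ext (by simp; omega)
      rwa [hi] at this

/-- The factor `ℝ^d` comes first in the splitting, so that the boundary coordinate of `B` becomes
that of `ℝ^m`. -/
theorem mem_halfSpace_iff_split (hd : 0 < d) {x : E m} :
    x ∈ halfSpace m ↔ (splitEquiv hm x).1 ∈ halfSpace d :=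
  ⟨fun h _ => h (by omega), fun h _ => h hd⟩

end Split

/-! ### Radial data -/

/-- A change `t = T(s)` of the radial variable such that `T'(s) dt`-directions become normalized:
with `s` instead of `t`, the metric `h_P / r²` is `ds² + |u y ds + λ dy|²`. -/
structure RadialData {n : ℕ} (τ : Tip) (R r : ℝ → ℝ)
    (hP : ℝ × E n → (ℝ × E n) →L[ℝ] (ℝ × E n) →L[ℝ] ℝ) where
  sigma : ℝ → ℝ
  T : ℝ → ℝ
  u : ℝ → ℝ
  lam : ℝ → ℝ
  sigma_pos : ∀ t ∈ interior τ.J, 0 < sigma t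
  T_mem : ∀ s, 0 < s → T s ∈ interior τ.J
  T_sigma : ∀ t ∈ interior τ.J, T (sigma t) = t
  sigma_T : ∀ s, 0 < s → sigma (T s) = s
  smooth_sigma : ContDiffOn ℝ ∞ sigma (interior τ.J)
  smooth_T : ContDiffOn ℝ ∞ T (Set.Ioi 0)
  smooth_R : ContDiffOn ℝ ∞ R (interior τ.J)
  R_pos : ∀ t ∈ interior τ.J, 0 < R t
  smooth_r : ContDiffOn ℝ ∞ r (interior τ.J)
  r_pos : ∀ t ∈ interior τ.J, 0 < r t
  cofinal : IsCofinal τ {t | t ∈ interior τ.J ∧ 1 ≤ sigma t}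
  bounded_u : UniformlyBounded (fun _ : Unit => Set.Ioi (0 : ℝ)) (fun _ => u)
  moderate_lam : IsModerate lam
  moderate_inv_r : IsModerate (fun s => (r (T s))⁻¹)
  form : ∀ s, 0 < s → ∀ (y v v' : E n) (a a' : ℝ),
    hP (T s, R (T s) • y) (deriv T s * a, (deriv (R ∘ T) s * a) • y + R (T s) • v)
      (deriv T s * a', (deriv (R ∘ T) s * a') • y + R (T s) • v') =
    r (T s) ^ 2 * (a * a' + inner ℝ ((u s * a) • y + lam s • v) ((u s * a') • y + lam s • v'))

/-! ### Charts of the wedge -/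

/-- A product of the interval `(i - 1, i + 1)` with cells of `B` and `Γ`. -/
structure WedgeCell (n d e : ℕ) (Γ : Type*) where
  i : ℕ
  one_le : 1 ≤ i
  cB : Cell (E n) d
  cΓ : Cell Γ e

section WedgeCharts

variable {d e m n : ℕ} (hm : m = 1 + d + e) {Γ : Type*} {τ : Tip} {R r : ℝ → ℝ}
  {hP : ℝ × E n → (ℝ × E n) →L[ℝ] (ℝ × E n) →L[ℝ] ℝ} (D : RadialData τ R r hP)

theorem WedgeCell.add_pos (w : WedgeCell n d e Γ) {x : ℝ} (hx : |x| < 1) : 0 < w.i + x := by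
  have h1 : (1 : ℝ) ≤ w.i := by exact_mod_cast w.one_le
  linarith [(abs_lt.1 hx).1]

/-- The chart of the wedge that belongs to a product cell. -/
noncomputable def wedgeChart (w : WedgeCell n d e Γ) : PartialEquiv ((ℝ × E n) × Γ) (E m) where
  toFun p := (splitEquiv hm).symm
    (w.cB.chart ((R p.1.1)⁻¹ • p.1.2), D.sigma p.1.1 - w.i, w.cΓ.chart p.2)
  invFun x := ((D.T (w.i + (splitEquiv hm x).2.1),
    R (D.T (w.i + (splitEquiv hm x).2.1)) • w.cB.chart.symm (splitEquiv hm x).1),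
    w.cΓ.chart.symm (splitEquiv hm x).2.2)
  source := {p | p.1.1 ∈ interior τ.J ∧ |D.sigma p.1.1 - w.i| < 1 ∧
    (R p.1.1)⁻¹ • p.1.2 ∈ w.cB.chart.source ∧ p.2 ∈ w.cΓ.chart.source}
  target := {x | (splitEquiv hm x).1 ∈ w.cB.chart.target ∧ |(splitEquiv hm x).2.1| < 1 ∧
    (splitEquiv hm x).2.2 ∈ w.cΓ.chart.target}
  map_source' := by
    rintro p ⟨h0, h1, h2, h3⟩
    simp only [Set.mem_ofPred_eq, ContinuousLinearEquiv.apply_symm_apply]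
    exact ⟨w.cB.chart.map_source h2, h1, w.cΓ.chart.map_source h3⟩
  map_target' := by
    rintro x ⟨h1, h2, h3⟩
    have h0 := w.add_pos h2
    have hT := D.T_mem _ h0
    refine ⟨hT, ?_, ?_, w.cΓ.chart.map_target h3⟩
    · simpa only [D.sigma_T _ h0, add_sub_cancel_left] using h2
    · simpa only [inv_smul_smul₀ (D.R_pos _ hT).ne'] using w.cB.chart.map_target h1
  left_inv' := by
    rintro p ⟨h0, h1, h2, h3⟩
    simp only [ContinuousLinearEquiv.apply_symm_apply, add_sub_cancel, D.T_sigma _ h0,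
      w.cB.chart.left_inv h2, w.cΓ.chart.left_inv h3, smul_inv_smul₀ (D.R_pos _ h0).ne']
  right_inv' := by
    rintro x ⟨h1, h2, h3⟩
    have h0 := w.add_pos h2
    have hT := D.T_mem _ h0
    simp only [D.sigma_T _ h0, inv_smul_smul₀ (D.R_pos _ hT).ne', w.cB.chart.right_inv h1,
      w.cΓ.chart.right_inv h3, add_sub_cancel_left, Prod.mk.eta,
      ContinuousLinearEquiv.symm_apply_apply]

theorem wedgeChart_apply (w : WedgeCell n d e Γ) (p : (ℝ × E n) × Γ) :
    wedgeChart hm D w p = (splitEquiv hm).symm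
      (w.cB.chart ((R p.1.1)⁻¹ • p.1.2), D.sigma p.1.1 - w.i, w.cΓ.chart p.2) := rfl

theorem wedgeChart_symm_apply (w : WedgeCell n d e Γ) (x : E m) :
    (wedgeChart hm D w).symm x = ((D.T (w.i + (splitEquiv hm x).2.1),
      R (D.T (w.i + (splitEquiv hm x).2.1)) • w.cB.chart.symm (splitEquiv hm x).1),
      w.cΓ.chart.symm (splitEquiv hm x).2.2) := rfl

theorem mem_wedgeChart_source {w : WedgeCell n d e Γ} {p : (ℝ × E n) × Γ} :
    p ∈ (wedgeChart hm D w).source ↔ p.1.1 ∈ interior τ.J ∧ |D.sigma p.1.1 - w.i| < 1 ∧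
      (R p.1.1)⁻¹ • p.1.2 ∈ w.cB.chart.source ∧ p.2 ∈ w.cΓ.chart.source := Iff.rfl

theorem mem_wedgeChart_target {w : WedgeCell n d e Γ} {x : E m} :
    x ∈ (wedgeChart hm D w).target ↔ (splitEquiv hm x).1 ∈ w.cB.chart.target ∧
      |(splitEquiv hm x).2.1| < 1 ∧ (splitEquiv hm x).2.2 ∈ w.cΓ.chart.target := Iff.rfl

theorem mem_wedge_iff (hR : ∀ t ∈ interior τ.J, 0 < R t) {B : Set (E n)} {p : (ℝ × E n) × Γ} :
    p ∈ wedge R B (interior τ.J) Γ ↔ p.1.1 ∈ interior τ.J ∧ (R p.1.1)⁻¹ • p.1.2 ∈ B := by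
  constructor
  · rintro ⟨⟨t, ht, y, hy, h⟩, -⟩
    rw [h]
    exact ⟨ht, by simpa only [inv_smul_smul₀ (hR t ht).ne'] using hy⟩
  · rintro ⟨ht, hy⟩
    exact ⟨⟨p.1.1, ht, _, hy, by rw [smul_inv_smul₀ (hR _ ht).ne']⟩, Set.mem_univ _⟩

/-- The cells used for given base atlases of `B` and `Γ`. -/
structure WedgeCell.Admissible (𝔅 : Set (BaseChart (E n) d)) (𝔊 : Set (BaseChart Γ e)) (θ θ' : ℝ)
    (w : WedgeCell n d e Γ) : Prop where
  cB : w.cB.Admissible 𝔅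
  cΓ : w.cΓ.Admissible 𝔊
  scale_cB : w.cB.scale = θ / D.lam w.i
  scale_cΓ : w.cΓ.scale = θ' / (r (D.T w.i))⁻¹

theorem wedgeChart_source_subset {B : Set (E n)} {𝔅 : Set (BaseChart (E n) d)}
    {𝔊 : Set (BaseChart Γ e)} (h𝔅 : IsBaseAtlas 𝓘(ℝ, E n) B True 𝔅) {θ θ' : ℝ}
    {w : WedgeCell n d e Γ} (hw : w.Admissible D 𝔅 𝔊 θ θ') :
    (wedgeChart hm D w).source ⊆ wedge R B (interior τ.J) Γ :=
  fun _ hp => (mem_wedge_iff D.R_pos).2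
    ⟨hp.1, (Cell.isLocalChart h𝔅 hw.cB).source_subset hp.2.2.1⟩

variable [TopologicalSpace Γ] [ChartedSpace (E e) Γ] {B : Set (E n)} {𝔅 : Set (BaseChart (E n) d)}
  {𝔊 : Set (BaseChart Γ e)} (h𝔅 : IsBaseAtlas 𝓘(ℝ, E n) B True 𝔅)
  (h𝔊 : IsBaseAtlas (𝓡 e) Set.univ False 𝔊) {θ θ' : ℝ} {w : WedgeCell n d e Γ}
  (hw : w.Admissible D 𝔅 𝔊 θ θ')

variable {H : Type*} [TopologicalSpace H] {I : ModelWithCorners ℝ (E m) H}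
  {M : Type*} [TopologicalSpace M] [ChartedSpace H M]
  {g : ∀ p : M, TangentSpace I p →L[ℝ] TangentSpace I p →L[ℝ] ℝ}
  {V : Set M} {Φ : PartialEquiv M ((ℝ × E n) × Γ)}
  {gΓ : ∀ z : Γ, TangentSpace (𝓡 e) z →L[ℝ] TangentSpace (𝓡 e) z →L[ℝ] ℝ}
  (hV : IsModeledBy I g V Φ τ R B hP gΓ)

include h𝔅 hw hV in
theorem trans_wedgeChart_target :
    (Φ.trans (wedgeChart hm D w)).target = (wedgeChart hm D w).target := by
  rw [PartialEquiv.trans_target, Set.inter_eq_left]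
  intro x hx
  rw [Set.mem_preimage, hV.target_eq]
  exact wedgeChart_source_subset hm D h𝔅 hw ((wedgeChart hm D w).map_target hx)

include h𝔅 h𝔊 hw

/-- Only `B` can contribute a boundary: the cells of `Γ` are full cubes because its base atlas has
`P = False`, and for `d = 0` the half-space is no restriction. -/
theorem wedgeChart_target_eq : (wedgeChart hm D w).target = cube m ∨
    (wedgeChart hm D w).target = cube m ∩ halfSpace m := by
  have hΓ : w.cΓ.chart.target = cube e := (Cell.target_eq h𝔊 hw.cΓ).resolve_right fun h => h.1
  rcases Nat.eq_zero_or_pos d with hd | hd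
  · left
    have hB : w.cB.chart.target = cube d := by
      rcases Cell.target_eq h𝔅 hw.cB with h | ⟨-, h⟩
      · exact h
      · rw [h, Set.inter_eq_left]
        exact fun x _ h0 => absurd h0 (by omega)
    ext x
    rw [mem_wedgeChart_target, mem_cube_iff_split hm, hΓ, hB]
  · rcases Cell.target_eq h𝔅 hw.cB with h | ⟨-, h⟩
    · left
      ext x
      rw [mem_wedgeChart_target, mem_cube_iff_split hm, hΓ, h]
    · right
      ext x
      rw [mem_wedgeChart_target, Set.mem_inter_iff, mem_cube_iff_split hm,
        mem_halfSpace_iff_split hm hd, hΓ, h]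
      simp only [Set.mem_inter_iff]
      tauto

theorem contMDiffOn_wedgeChart : ContMDiffOn (𝓘(ℝ, ℝ × E n).prod (𝓡 e)) 𝓘(ℝ, E m) ∞
    (wedgeChart hm D w) (wedgeChart hm D w).source := by
  have hfst : ContMDiffOn (𝓘(ℝ, ℝ × E n).prod (𝓡 e)) 𝓘(ℝ, ℝ × E n) ∞
      (Prod.fst : (ℝ × E n) × Γ → ℝ × E n) (wedgeChart hm D w).source := contMDiffOn_fst
  have h1 : ContDiffOn ℝ ∞ (fun q : ℝ × E n => (R q.1)⁻¹ • q.2) {q | q.1 ∈ interior τ.J} :=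
    ((D.smooth_R.comp contDiffOn_fst fun q hq => hq).inv fun q hq => (D.R_pos _ hq).ne').smul
      contDiffOn_snd
  have h2 : ContDiffOn ℝ ∞ (fun q : ℝ × E n => D.sigma q.1 - w.i) {q | q.1 ∈ interior τ.J} :=
    (D.smooth_sigma.comp contDiffOn_fst fun q hq => hq).sub contDiffOn_const
  have hB := (Cell.isLocalChart h𝔅 hw.cB).smooth.comp
    (h1.contMDiffOn.comp hfst fun p hp => hp.1) (fun p hp => hp.2.2.1)
  have hs := h2.contMDiffOn.comp hfst fun p hp => hp.1
  have hΓ := (Cell.isLocalChart h𝔊 hw.cΓ).smooth.comp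
    (contMDiffOn_snd (I := 𝓘(ℝ, ℝ × E n)) (s := (wedgeChart hm D w).source))
    (fun p hp => hp.2.2.2)
  exact (splitEquiv hm).symm.contDiff.contMDiff.comp_contMDiffOn
    (hB.prodMk_space (hs.prodMk_space hΓ))

theorem contMDiffOn_wedgeChart_symm : ContMDiffOn 𝓘(ℝ, E m) (𝓘(ℝ, ℝ × E n).prod (𝓡 e)) ∞
    (wedgeChart hm D w).symm (wedgeChart hm D w).target := by
  have hL : ContDiff ℝ ∞ (fun x : E m => splitEquiv hm x) := (splitEquiv hm).contDiff
  have hT : ContDiffOn ℝ ∞ (fun x : E m => D.T (w.i + (splitEquiv hm x).2.1))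
      (wedgeChart hm D w).target :=
    D.smooth_T.comp (contDiff_const.add hL.snd.fst).contDiffOn fun x hx => w.add_pos hx.2.1
  have hR := D.smooth_R.comp hT fun x hx => D.T_mem _ (w.add_pos hx.2.1)
  have hB : ContDiffOn ℝ ∞ (fun x : E m => w.cB.chart.symm (splitEquiv hm x).1)
      (wedgeChart hm D w).target :=
    (contMDiffOn_iff_contDiffOn.1 (Cell.isLocalChart h𝔅 hw.cB).smooth_symm).comp
      hL.fst.contDiffOn fun x hx => hx.1
  have hΓ := (Cell.isLocalChart h𝔊 hw.cΓ).smooth_symm.comp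
    hL.snd.snd.contMDiff.contMDiffOn (s := (wedgeChart hm D w).target) fun x hx => hx.2.2
  exact ((hT.prodMk (hR.smul hB)).contMDiffOn).prodMk hΓ


include hV

theorem isLocalChart_trans_wedgeChart : IsLocalChart I m V (Φ.trans (wedgeChart hm D w)) := by
  have hB := Cell.isLocalChart h𝔅 hw.cB
  have hΓ := Cell.isLocalChart h𝔊 hw.cΓ
  refine ⟨?_, ?_, ?_, ?_⟩
  · obtain ⟨O₁, hO₁, hs₁⟩ := hB.source_open
    obtain ⟨O₂, hO₂, hs₂⟩ := hΓ.source_open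
    have hmem : ∀ p ∈ V, (Φ p).1.1 ∈ interior τ.J ∧ (R (Φ p).1.1)⁻¹ • (Φ p).1.2 ∈ B := by
      intro p hp
      rw [← mem_wedge_iff D.R_pos, ← hV.target_eq]
      exact Φ.map_source (hV.source_eq ▸ hp)
    have hc : ContinuousOn (fun p => (D.sigma (Φ p).1.1, (R (Φ p).1.1)⁻¹ • (Φ p).1.2, (Φ p).2)) V := by
      have h0 := hV.smooth.continuousOn
      have h1 : ContinuousOn (fun p => (Φ p).1) V := continuous_fst.comp_continuousOn h0
      have h2 : ContinuousOn (fun p => (Φ p).1.1) V := continuous_fst.comp_continuousOn h1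
      have h3 := D.smooth_sigma.continuousOn.comp h2 fun p hp => (hmem p hp).1
      have h4 := D.smooth_R.continuousOn.comp h2 fun p hp => (hmem p hp).1
      exact h3.prodMk (((h4.inv₀ fun p hp => (D.R_pos _ (hmem p hp).1).ne').smul
        (continuous_snd.comp_continuousOn h1)).prodMk (continuous_snd.comp_continuousOn h0))
    -- As `V` is open in `M`, the source is the preimage of an open set under the continuous
    -- coordinates `(s, y, z)` on `V`.
    have hopen := hc.isOpen_inter_preimage hV.isOpen
      ((isOpen_lt (by fun_prop : Continuous fun s : ℝ => |s - w.i|) continuous_const).prod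
        (hO₁.prod hO₂) : IsOpen ({s : ℝ | |s - w.i| < 1} ×ˢ (O₁ ×ˢ O₂)))
    refine ⟨_, hopen, ?_⟩
    ext p
    rw [PartialEquiv.trans_source, hV.source_eq]
    simp only [Set.mem_inter_iff, Set.mem_preimage, mem_wedgeChart_source, hs₁, hs₂, Set.mem_prod,
      Set.mem_univ, true_and, Set.mem_ofPred_eq]
    constructor
    · rintro ⟨hp, -, h1, ⟨-, h2⟩, h3⟩
      exact ⟨hp, hp, h1, h2, h3⟩
    · rintro ⟨hp, -, h1, h2, h3⟩
      exact ⟨hp, (hmem p hp).1, h1, ⟨(hmem p hp).2, h2⟩, h3⟩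
  · rw [trans_wedgeChart_target hm D h𝔅 hw hV]
    exact ⟨cube m, isOpen_cube m, wedgeChart_target_eq hm D h𝔅 h𝔊 hw⟩
  · refine (contMDiffOn_wedgeChart hm D h𝔅 h𝔊 hw).comp (hV.smooth.mono ?_) fun p hp => hp.2
    rw [PartialEquiv.trans_source, hV.source_eq]
    exact Set.inter_subset_left
  · rw [trans_wedgeChart_target hm D h𝔅 hw hV]
    exact hV.smooth_symm.comp (contMDiffOn_wedgeChart_symm hm D h𝔅 h𝔊 hw)
      fun x hx => wedgeChart_source_subset hm D h𝔅 hw ((wedgeChart hm D w).map_target hx)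

end WedgeCharts

/-! ### The metric in the charts of the wedge -/

/-- Translates of a function that is bounded with all its derivatives on `(0, ∞)`. -/
theorem uniformlyBounded_shift {f : ℝ → ℝ}
    (hf : UniformlyBounded (fun _ : Unit => Set.Ioi (0 : ℝ)) (fun _ => f)) :
    UniformlyBounded (fun _ : {i : ℕ // 1 ≤ i} => Set.Ioo (-1 : ℝ) 1)
      (fun i x => f (i.1 + x)) := by
  have hmaps : ∀ i : {i : ℕ // 1 ≤ i},
      Set.MapsTo (fun x : ℝ => (i.1 : ℝ) + (1 : ℝ) • x) (Set.Ioo (-1) 1) (Set.Ioi 0) := by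
    intro i x hx
    have : (1 : ℝ) ≤ i.1 := by exact_mod_cast i.2
    simp only [one_smul, Set.mem_Ioi]
    linarith [hx.1]
  refine UniformlyBounded.congr (f := fun i x => f (i.1 + (1 : ℝ) • x)) ?_ (fun i x _ => by simp)
  refine uniformlyBounded_iff.2 ⟨fun i => (hf.contDiffOn ()).comp (by fun_prop) (hmaps i),
    fun j => ?_⟩
  obtain ⟨C, hC1, hC⟩ := hf.exists_pos_bound j
  exact ⟨_, fun i x hx => norm_iteratedFDerivWithin_comp_affine_le zero_le_one (hf.contDiffOn ())
    isOpen_Ioi.uniqueDiffOn isOpen_Ioo.uniqueDiffOn (hmaps i) hx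
    (fun l hl => hC () l hl _ (hmaps i hx))⟩

theorem max_max_sq_le (a b c : ℝ) : max a (max b c) ^ 2 ≤ a ^ 2 + b ^ 2 + c ^ 2 := by
  have ha := sq_nonneg a
  have hb := sq_nonneg b
  have hc := sq_nonneg c
  rcases max_choice a (max b c) with h | h
  · rw [h]; linarith
  · rw [h]
    rcases max_choice b c with h' | h' <;> rw [h'] <;> linarith

section ModelForm

variable {d e m n : ℕ} (hm : m = 1 + d + e)

/-- The projections of `ℝ^m = ℝ^d × ℝ × ℝ^e`. -/
noncomputable def projB : E m →L[ℝ] E d :=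
  (ContinuousLinearMap.fst ℝ _ _).comp (splitEquiv hm : E m →L[ℝ] E d × ℝ × E e)

/-- The projections of `ℝ^m = ℝ^d × ℝ × ℝ^e`. -/
noncomputable def projS : E m →L[ℝ] ℝ :=
  (ContinuousLinearMap.fst ℝ _ _).comp ((ContinuousLinearMap.snd ℝ _ _).comp
    (splitEquiv hm : E m →L[ℝ] E d × ℝ × E e))

/-- The projections of `ℝ^m = ℝ^d × ℝ × ℝ^e`. -/
noncomputable def projΓ : E m →L[ℝ] E e :=
  (ContinuousLinearMap.snd ℝ _ _).comp ((ContinuousLinearMap.snd ℝ _ _).comp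
    (splitEquiv hm : E m →L[ℝ] E d × ℝ × E e))

theorem projB_apply (x : E m) : projB hm x = (splitEquiv hm x).1 := rfl

theorem projS_apply (x : E m) : projS hm x = (splitEquiv hm x).2.1 := rfl

theorem projΓ_apply (x : E m) : projΓ hm x = (splitEquiv hm x).2.2 := rfl

/-- The form `ds² + |u y ds + l dy|² + k² a` for `q = (u, l, y, Y, k, a)`, where `dy = Y`. -/
noncomputable def modelForm
    (q : ℝ × ℝ × E n × (E d →L[ℝ] E n) × ℝ × (E e →L[ℝ] E e →L[ℝ] ℝ)) : E m →L[ℝ] E m →L[ℝ] ℝ :=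
  (ContinuousLinearMap.mul ℝ ℝ).bilinearComp (projS hm) (projS hm) +
    (euclideanForm n).bilinearComp
      ((projS hm).smulRight (q.1 • q.2.2.1) + q.2.1 • (q.2.2.2.1).comp (projB hm))
      ((projS hm).smulRight (q.1 • q.2.2.1) + q.2.1 • (q.2.2.2.1).comp (projB hm)) +
    q.2.2.2.2.1 ^ 2 • (q.2.2.2.2.2).bilinearComp (projΓ hm) (projΓ hm)

theorem modelForm_apply (q : ℝ × ℝ × E n × (E d →L[ℝ] E n) × ℝ × (E e →L[ℝ] E e →L[ℝ] ℝ))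
    (ξ η : E m) : modelForm hm q ξ η = projS hm ξ * projS hm η +
      inner ℝ (projS hm ξ • q.1 • q.2.2.1 + q.2.1 • q.2.2.2.1 (projB hm ξ))
        (projS hm η • q.1 • q.2.2.1 + q.2.1 • q.2.2.2.1 (projB hm η)) +
      q.2.2.2.2.1 ^ 2 * q.2.2.2.2.2 (projΓ hm ξ) (projΓ hm η) := rfl

/-- The form is polynomial in its coefficients. Hence uniform bounds for the coefficients, with all
derivatives, pass to the metric. -/
theorem contDiff_modelForm : ContDiff ℝ ∞ (modelForm (n := n) hm) := by
  rw [contDiff_clm_apply_iff]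
  intro ξ
  rw [contDiff_clm_apply_iff]
  intro η
  simp only [modelForm_apply]
  have h1 : ContDiff ℝ ∞ (fun q : ℝ × ℝ × E n × (E d →L[ℝ] E n) × ℝ × (E e →L[ℝ] E e →L[ℝ] ℝ) =>
      q.2.2.2.1) := by fun_prop
  have h2 : ContDiff ℝ ∞ (fun q : ℝ × ℝ × E n × (E d →L[ℝ] E n) × ℝ × (E e →L[ℝ] E e →L[ℝ] ℝ) =>
      q.2.2.2.2.2) := by fun_prop
  have h3 : ∀ ζ, ContDiff ℝ ∞ (fun q : ℝ × ℝ × E n × (E d →L[ℝ] E n) × ℝ ×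
      (E e →L[ℝ] E e →L[ℝ] ℝ) => q.2.2.2.1 ζ) := fun ζ => h1.clm_apply contDiff_const
  have h4 := (h2.clm_apply (contDiff_const (c := projΓ hm ξ))).clm_apply
    (contDiff_const (c := projΓ hm η))
  have h5 : ∀ ζ : E m, ContDiff ℝ ∞ (fun q : ℝ × ℝ × E n × (E d →L[ℝ] E n) × ℝ ×
      (E e →L[ℝ] E e →L[ℝ] ℝ) => projS hm ζ • q.1 • q.2.2.1 + q.2.1 • q.2.2.2.1 (projB hm ζ)) := by
    intro ζ
    have := h3 (projB hm ζ)
    fun_prop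
  exact (contDiff_const.add ((h5 ξ).inner ℝ (h5 η))).add
    (((contDiff_fst.comp (contDiff_snd.comp (contDiff_snd.comp (contDiff_snd.comp contDiff_snd))))).pow 2 |>.mul h4)

/-- The model form is bounded below if its coefficients are bounded and nondegenerate. -/
theorem exists_le_modelForm {Cu Cy l₀ k₀ cB cΓ : ℝ} (hl : 0 < l₀) (hk : 0 < k₀) (hcB : 1 ≤ cB)
    (hcΓ : 1 ≤ cΓ) : ∃ c : ℝ, 1 ≤ c ∧
    ∀ q : ℝ × ℝ × E n × (E d →L[ℝ] E n) × ℝ × (E e →L[ℝ] E e →L[ℝ] ℝ),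
      |q.1| ≤ Cu → l₀ ≤ q.2.1 → ‖q.2.2.1‖ ≤ Cy → (∀ η, ‖η‖ ^ 2 / cB ≤ ‖q.2.2.2.1 η‖ ^ 2) →
      k₀ ≤ q.2.2.2.2.1 → (∀ ζ, ‖ζ‖ ^ 2 / cΓ ≤ q.2.2.2.2.2 ζ ζ) →
      ∀ ξ : E m, ‖ξ‖ ^ 2 / c ≤ modelForm hm q ξ ξ := by
  obtain ⟨CL, hCL0, hCL⟩ : ∃ CL : ℝ, 0 ≤ CL ∧ ∀ q : E d × ℝ × E e,
      ‖(splitEquiv hm).symm q‖ ≤ CL * ‖q‖ :=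
    ⟨‖((splitEquiv hm).symm : E d × ℝ × E e →L[ℝ] E m)‖, norm_nonneg _,
      fun q => ((splitEquiv hm).symm : E d × ℝ × E e →L[ℝ] E m).le_opNorm q⟩
  -- The three inner summands are the constants that bound `‖η‖²`, `t²` and `‖ζ‖²` by the form `Q`.
  -- The factor `CL ^ 2` passes from components to `ξ`, and the leading `1` secures `1 ≤ c`.
  refine ⟨1 + CL ^ 2 * (cB * (2 + 2 * (Cu * Cy) ^ 2) / l₀ ^ 2 + 1 + cΓ / k₀ ^ 2), by
    have : 0 ≤ CL ^ 2 * (cB * (2 + 2 * (Cu * Cy) ^ 2) / l₀ ^ 2 + 1 + cΓ / k₀ ^ 2) := by positivity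
    linarith, ?_⟩
  rintro ⟨u, l, y, Y, k, a⟩ hu hl' hy hY hk' ha ξ
  dsimp only at hu hl' hy hY hk' ha
  rw [modelForm_apply]
  dsimp only
  set η := projB hm ξ with hη
  set t := projS hm ξ with ht
  set ζ := projΓ hm ξ with hζ
  set v := t • u • y + l • Y η with hv
  rw [real_inner_self_eq_norm_sq]
  set Q := t * t + ‖v‖ ^ 2 + k ^ 2 * a ζ ζ with hQ
  have haζ : 0 ≤ a ζ ζ := le_trans (by positivity) (ha ζ)
  have hkaζ : 0 ≤ k ^ 2 * a ζ ζ := mul_nonneg (sq_nonneg k) haζ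
  have hQ0 : 0 ≤ Q := add_nonneg (add_nonneg (mul_self_nonneg t) (sq_nonneg _)) hkaζ
  have hv2 : ‖v‖ ^ 2 + t ^ 2 ≤ Q := by
    rw [hQ]; linarith [sq t]
  have ht2 : t ^ 2 ≤ Q := by linarith [sq_nonneg ‖v‖]
  have hζ2 : ‖ζ‖ ^ 2 ≤ cΓ / k₀ ^ 2 * Q := by
    have h1 : k ^ 2 * a ζ ζ ≤ Q := by
      rw [hQ]; linarith [sq_nonneg ‖v‖, mul_self_nonneg t]
    have h2 : k₀ ^ 2 * a ζ ζ ≤ Q := le_trans (by gcongr) h1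
    have h3 : ‖ζ‖ ^ 2 ≤ cΓ * a ζ ζ := by
      have := ha ζ
      rwa [div_le_iff₀ (by linarith), mul_comm] at this
    rw [div_mul_eq_mul_div, le_div_iff₀ (by positivity)]
    calc ‖ζ‖ ^ 2 * k₀ ^ 2 ≤ cΓ * a ζ ζ * k₀ ^ 2 := by gcongr
      _ = cΓ * (k₀ ^ 2 * a ζ ζ) := by ring
      _ ≤ cΓ * Q := by gcongr
  have hη2 : ‖η‖ ^ 2 ≤ cB * (2 + 2 * (Cu * Cy) ^ 2) / l₀ ^ 2 * Q := by
    have h1 : ‖η‖ ^ 2 ≤ cB * ‖Y η‖ ^ 2 := by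
      have := hY η
      rwa [div_le_iff₀ (by linarith), mul_comm] at this
    -- The mixed term is absorbed: both `‖v‖²` and `t²` are bounded by `Q`, and `u y` is bounded, so
    -- `l • Y η` is controlled without any smallness of `u`.
    have h2 : l • Y η = v - t • u • y := by rw [hv]; abel
    have h3 : ‖t • u • y‖ ≤ |t| * (Cu * Cy) := by
      rw [norm_smul, norm_smul, Real.norm_eq_abs, Real.norm_eq_abs]
      have : 0 ≤ Cu := (abs_nonneg u).trans hu
      gcongr
    have h4 : l₀ * ‖Y η‖ ≤ ‖v‖ + |t| * (Cu * Cy) := by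
      calc l₀ * ‖Y η‖ ≤ l * ‖Y η‖ := by gcongr
        _ = ‖l • Y η‖ := by rw [norm_smul, Real.norm_of_nonneg (hl.le.trans hl')]
        _ ≤ ‖v‖ + ‖t • u • y‖ := by rw [h2]; exact norm_sub_le _ _
        _ ≤ _ := by gcongr
    have h5 : l₀ ^ 2 * ‖Y η‖ ^ 2 ≤ (2 + 2 * (Cu * Cy) ^ 2) * Q := by
      calc l₀ ^ 2 * ‖Y η‖ ^ 2 = (l₀ * ‖Y η‖) ^ 2 := by ring
        _ ≤ (‖v‖ + |t| * (Cu * Cy)) ^ 2 := by gcongr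
        _ ≤ 2 * ‖v‖ ^ 2 + 2 * (|t| * (Cu * Cy)) ^ 2 := by
            nlinarith [sq_nonneg (‖v‖ - |t| * (Cu * Cy))]
        _ = 2 * ‖v‖ ^ 2 + 2 * (Cu * Cy) ^ 2 * t ^ 2 := by rw [mul_pow, sq_abs]; ring
        _ ≤ 2 * Q + 2 * (Cu * Cy) ^ 2 * Q := by
            have : ‖v‖ ^ 2 ≤ Q := by linarith [sq_nonneg t]
            gcongr
        _ = _ := by ring
    rw [div_mul_eq_mul_div, le_div_iff₀ (by positivity)]
    calc ‖η‖ ^ 2 * l₀ ^ 2 ≤ cB * ‖Y η‖ ^ 2 * l₀ ^ 2 := by gcongr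
      _ = cB * (l₀ ^ 2 * ‖Y η‖ ^ 2) := by ring
      _ ≤ cB * ((2 + 2 * (Cu * Cy) ^ 2) * Q) := by gcongr
      _ = _ := by ring
  clear_value v Q
  have hξ : ‖ξ‖ ^ 2 ≤ CL ^ 2 * (‖η‖ ^ 2 + t ^ 2 + ‖ζ‖ ^ 2) := by
    have h1 := hCL (splitEquiv hm ξ)
    rw [ContinuousLinearEquiv.symm_apply_apply] at h1
    have h2 : ‖splitEquiv hm ξ‖ ^ 2 ≤ ‖η‖ ^ 2 + t ^ 2 + ‖ζ‖ ^ 2 := by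
      have h3 : ‖splitEquiv hm ξ‖ = max ‖η‖ (max |t| ‖ζ‖) := rfl
      rw [h3, ← sq_abs t]
      exact max_max_sq_le _ _ _
    calc ‖ξ‖ ^ 2 ≤ (CL * ‖splitEquiv hm ξ‖) ^ 2 := by gcongr
      _ = CL ^ 2 * ‖splitEquiv hm ξ‖ ^ 2 := by ring
      _ ≤ _ := by gcongr
  rw [div_le_iff₀ (by positivity)]
  calc ‖ξ‖ ^ 2 ≤ CL ^ 2 * (‖η‖ ^ 2 + t ^ 2 + ‖ζ‖ ^ 2) := hξ
    _ ≤ CL ^ 2 * (cB * (2 + 2 * (Cu * Cy) ^ 2) / l₀ ^ 2 * Q + Q + cΓ / k₀ ^ 2 * Q) := by gcongr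
    _ = Q * (CL ^ 2 * (cB * (2 + 2 * (Cu * Cy) ^ 2) / l₀ ^ 2 + 1 + cΓ / k₀ ^ 2)) := by ring
    _ ≤ Q * (1 + CL ^ 2 * (cB * (2 + 2 * (Cu * Cy) ^ 2) / l₀ ^ 2 + 1 + cΓ / k₀ ^ 2)) := by
        gcongr
        linarith

end ModelForm

/-! ### Identification of the rescaled metric with the model form. -/

section WedgeMetric

variable {d e m n : ℕ} (hm : m = 1 + d + e) {Γ : Type*} [TopologicalSpace Γ]
  [ChartedSpace (E e) Γ] {τ : Tip} {R r : ℝ → ℝ}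
  {hP : ℝ × E n → (ℝ × E n) →L[ℝ] (ℝ × E n) →L[ℝ] ℝ} (D : RadialData τ R r hP) {B : Set (E n)}
  {𝔅 : Set (BaseChart (E n) d)} {𝔊 : Set (BaseChart Γ e)}
  (h𝔅 : IsBaseAtlas 𝓘(ℝ, E n) B True 𝔅) (h𝔊 : IsBaseAtlas (𝓡 e) Set.univ False 𝔊) {θ θ' : ℝ}
  {H : Type*} [TopologicalSpace H] {I : ModelWithCorners ℝ (E m) H}
  {M : Type*} [TopologicalSpace M] [ChartedSpace H M]
  {g : ∀ p : M, TangentSpace I p →L[ℝ] TangentSpace I p →L[ℝ] ℝ}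
  {V : Set M} {Φ : PartialEquiv M ((ℝ × E n) × Γ)}
  {gΓ : ∀ z : Γ, TangentSpace (𝓡 e) z →L[ℝ] TangentSpace (𝓡 e) z →L[ℝ] ℝ}
  (hV : IsModeledBy I g V Φ τ R B hP gΓ)

/-- The derivative of the inverse of a chart of `B`. -/
noncomputable def BaseChart.symmDeriv (b : BaseChart (E n) d) (x : E d) : E d →L[ℝ] E n :=
  fderivWithin ℝ b.chart.symm b.chart.target x

/-- The coefficients of the model form in a chart of the wedge. -/
noncomputable def wedgeCoeff (gΓ : ∀ z : Γ, TangentSpace (𝓡 e) z →L[ℝ] TangentSpace (𝓡 e) z →L[ℝ] ℝ)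
    (w : WedgeCell n d e Γ) (x : E m) :
    ℝ × ℝ × E n × (E d →L[ℝ] E n) × ℝ × (E e →L[ℝ] E e →L[ℝ] ℝ) :=
  (D.u (w.i + projS hm x), D.lam (w.i + projS hm x) * w.cB.scale, w.cB.chart.symm (projB hm x),
    w.cB.base.symmDeriv (w.cB.center + w.cB.scale • projB hm x),
    (r (D.T (w.i + projS hm x)))⁻¹ * w.cΓ.scale,
    pushForm (𝓡 e) w.cΓ.base.chart gΓ (w.cΓ.center + w.cΓ.scale • projΓ hm x))

include h𝔅 h𝔊 hV in
-- Since `Φ` is an isometry, only the derivatives of the pipe component and the `Γ` component of the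
-- inverse wedge chart enter. `D.form` evaluates the pipe part, and the widths of the cells appear
-- through the chain rule.
theorem pushForm_trans_wedgeChart {w : WedgeCell n d e Γ} (hw : w.Admissible D 𝔅 𝔊 θ θ') {x : E m}
    (hx : x ∈ (wedgeChart hm D w).target) :
    pushForm I (Φ.trans (wedgeChart hm D w))
      (fun p => (pullbackRadial Φ R r p ^ 2)⁻¹ • g p) x = modelForm hm (wedgeCoeff hm D gΓ w x) := by
  have hκ := isLocalChart_trans_wedgeChart hm D h𝔅 h𝔊 hw hV
  have htarget := trans_wedgeChart_target hm D h𝔅 hw hV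
  set κ := Φ.trans (wedgeChart hm D w) with hκdef
  have hxκ : x ∈ κ.target := htarget ▸ hx
  have hu : UniqueDiffWithinAt ℝ κ.target x := hκ.uniqueDiffOn_target x hxκ
  have huM : UniqueMDiffWithinAt 𝓘(ℝ, E m) κ.target x := hu.uniqueMDiffWithinAt
  have hs : 0 < w.i + projS hm x := w.add_pos hx.2.1
  have hΦκ : ∀ y ∈ κ.target, Φ (κ.symm y) = (wedgeChart hm D w).symm y := by
    intro y hy
    exact Φ.right_inv hy.2
  have hp : κ.symm x ∈ V := hκ.source_subset (κ.map_target hxκ)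
  have hVn : V ∈ 𝓝 (κ.symm x) := hV.isOpen.mem_nhds hp
  have hA : HasMFDerivWithinAt 𝓘(ℝ, E m) I κ.symm κ.target x
      (mfderivWithin 𝓘(ℝ, E m) I κ.symm κ.target x) :=
    ((hκ.smooth_symm x hxκ).mdifferentiableWithinAt (by simp)).hasMFDerivWithinAt
  have hΦ : ContMDiffAt I (𝓘(ℝ, ℝ × E n).prod (𝓡 e)) ∞ Φ (κ.symm x) :=
    (hV.smooth _ hp).contMDiffAt hVn
  have hB := (h𝔅.fits _ hw.cB.base_mem).isLocalChart
  have hΓ := (h𝔊.fits _ hw.cΓ.base_mem).isLocalChart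
  -- the first component
  have hy : HasFDerivWithinAt (fun x => w.cB.chart.symm (projB hm x))
      ((w.cB.base.symmDeriv (w.cB.center + w.cB.scale • projB hm x)).comp
        (w.cB.scale • projB hm)) κ.target x := by
    have h1 : HasFDerivWithinAt w.cB.base.chart.symm
        (w.cB.base.symmDeriv (w.cB.center + w.cB.scale • projB hm x)) w.cB.base.chart.target
        (w.cB.center + w.cB.scale • projB hm x) :=
      (((contMDiffOn_iff_contDiffOn.1 hB.smooth_symm).differentiableOn (by simp)) _
        hx.1.2).hasFDerivWithinAt
    have h2 : HasFDerivWithinAt (fun x => w.cB.center + w.cB.scale • projB hm x)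
        (w.cB.scale • projB hm) κ.target x :=
      (((projB hm).hasFDerivWithinAt).const_smul w.cB.scale).const_add _
    refine HasFDerivWithinAt.comp (g := w.cB.base.chart.symm)
      (f := fun x => w.cB.center + w.cB.scale • projB hm x) x h1 h2 fun z hz => ?_
    rw [htarget] at hz
    exact hz.1.2
  have hshift : HasFDerivWithinAt (fun x => (w.i : ℝ) + projS hm x) (projS hm) κ.target x :=
    (projS hm).hasFDerivWithinAt.const_add _
  have hT : DifferentiableAt ℝ D.T (w.i + projS hm x) :=
    (D.smooth_T.contDiffAt (isOpen_Ioi.mem_nhds hs)).differentiableAt (by simp)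
  have hRT : DifferentiableAt ℝ (R ∘ D.T) (w.i + projS hm x) :=
    ((D.smooth_R.comp D.smooth_T fun s hs => D.T_mem s hs).contDiffAt
      (isOpen_Ioi.mem_nhds hs)).differentiableAt (by simp)
  have hT' := hT.hasDerivAt.comp_hasFDerivWithinAt x hshift
  have hRT' := hRT.hasDerivAt.comp_hasFDerivWithinAt x hshift
  have hF1 := hT'.prodMk (hRT'.smul hy)
  have hΦ1 : HasMFDerivAt I 𝓘(ℝ, ℝ × E n) (fun q => (Φ q).1) (κ.symm x)
      (mfderiv I 𝓘(ℝ, ℝ × E n) (fun q => (Φ q).1) (κ.symm x)) :=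
    ((contMDiff_fst.contMDiffAt.comp _ hΦ).mdifferentiableAt (by simp)).hasMFDerivAt
  -- The derivative of `Φ ∘ κ.symm` is obtained twice, abstractly by the chain rule and explicitly
  -- in coordinates. Unique differentiability of the image, including boundary points, identifies
  -- the two.
  have hD1 := huM.eq (hΦ1.comp_hasMFDerivWithinAt x hA)
    (hF1.congr (f₁ := (fun q => (Φ q).1) ∘ κ.symm)
      (fun y hy => congrArg Prod.fst (hΦκ y hy))
      (congrArg Prod.fst (hΦκ x hxκ))).hasMFDerivWithinAt
  -- the second component
  have hF2 : HasMFDerivWithinAt 𝓘(ℝ, E m) (𝓡 e) ((fun q => (Φ q).2) ∘ κ.symm) κ.target x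
      ((mfderivWithin 𝓘(ℝ, E e) (𝓡 e) w.cΓ.base.chart.symm w.cΓ.base.chart.target
        (w.cΓ.center + w.cΓ.scale • projΓ hm x)).comp (w.cΓ.scale • projΓ hm)) := by
    have h1 : HasMFDerivWithinAt 𝓘(ℝ, E e) (𝓡 e) w.cΓ.base.chart.symm w.cΓ.base.chart.target
        (w.cΓ.center + w.cΓ.scale • projΓ hm x)
        (mfderivWithin 𝓘(ℝ, E e) (𝓡 e) w.cΓ.base.chart.symm w.cΓ.base.chart.target
        (w.cΓ.center + w.cΓ.scale • projΓ hm x)) :=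
      ((hΓ.smooth_symm _ hx.2.2.2).mdifferentiableWithinAt (by simp)).hasMFDerivWithinAt
    have h2 : HasFDerivWithinAt (fun x => w.cΓ.center + w.cΓ.scale • projΓ hm x)
        (w.cΓ.scale • projΓ hm) κ.target x :=
      (((projΓ hm).hasFDerivWithinAt).const_smul w.cΓ.scale).const_add _
    refine (h1.comp x h2.hasMFDerivWithinAt fun z hz => ?_).congr_mono
      (fun y hy => congrArg Prod.snd (hΦκ y hy)) (congrArg Prod.snd (hΦκ x hxκ)) subset_rfl
    rw [htarget] at hz
    exact hz.2.2.2
  have hΦ2 : HasMFDerivAt I (𝓡 e) (fun q => (Φ q).2) (κ.symm x)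
      (mfderiv I (𝓡 e) (fun q => (Φ q).2) (κ.symm x)) :=
    ((contMDiff_snd.contMDiffAt.comp _ hΦ).mdifferentiableAt (by simp)).hasMFDerivAt
  have hD2 := huM.eq (hΦ2.comp_hasMFDerivWithinAt x hA) hF2
  have hv1 : ∀ ξ : E m, mfderiv I 𝓘(ℝ, ℝ × E n) (fun q => (Φ q).1) (κ.symm x)
      (mfderivWithin 𝓘(ℝ, E m) I κ.symm κ.target x ξ) =
      ((deriv D.T (w.i + projS hm x) * projS hm ξ,
        (deriv (R ∘ D.T) (w.i + projS hm x) * projS hm ξ) • w.cB.chart.symm (projB hm x) +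
        R (D.T (w.i + projS hm x)) • w.cB.scale •
          w.cB.base.symmDeriv (w.cB.center + w.cB.scale • projB hm x) (projB hm ξ)) : ℝ × E n) := by
    intro ξ
    refine (DFunLike.congr_fun hD1 ξ).trans (Prod.ext rfl ?_)
    change R (D.T (w.i + projS hm x)) •
        w.cB.base.symmDeriv (w.cB.center + w.cB.scale • projB hm x) (w.cB.scale • projB hm ξ) +
      (deriv (R ∘ D.T) (w.i + projS hm x) * projS hm ξ) • w.cB.chart.symm (projB hm x) = _
    rw [map_smul, add_comm]
  have hv2 : ∀ ξ : E m, mfderiv I (𝓡 e) (fun q => (Φ q).2) (κ.symm x)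
      (mfderivWithin 𝓘(ℝ, E m) I κ.symm κ.target x ξ) =
      w.cΓ.scale • mfderivWithin 𝓘(ℝ, E e) (𝓡 e) w.cΓ.base.chart.symm w.cΓ.base.chart.target
        (w.cΓ.center + w.cΓ.scale • projΓ hm x) (projΓ hm ξ) := by
    intro ξ
    refine (DFunLike.congr_fun hD2 ξ).trans ?_
    exact ContinuousLinearMap.map_smul (mfderivWithin 𝓘(ℝ, E e) (𝓡 e) w.cΓ.base.chart.symm
      w.cΓ.base.chart.target (w.cΓ.center + w.cΓ.scale • projΓ hm x) : E e →L[ℝ] E e)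
      w.cΓ.scale (projΓ hm ξ)
  have hr : 0 < r (D.T (w.i + projS hm x)) := D.r_pos _ (D.T_mem _ hs)
  ext ξ η
  have hiso := hV.isometry _ hp (mfderivWithin 𝓘(ℝ, E m) I κ.symm κ.target x ξ)
    (mfderivWithin 𝓘(ℝ, E m) I κ.symm κ.target x η)
  rw [hv1, hv1, hv2, hv2] at hiso
  have e1 : (Φ (κ.symm x)).1 = (D.T (w.i + projS hm x),
    R (D.T (w.i + projS hm x)) • w.cB.chart.symm (projB hm x)) := congrArg Prod.fst (hΦκ x hxκ)
  have e2 : (Φ (κ.symm x)).2 = w.cΓ.base.chart.symm (w.cΓ.center + w.cΓ.scale • projΓ hm x) :=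
    congrArg Prod.snd (hΦκ x hxκ)
  have e3 : pullbackRadial Φ R r (κ.symm x) = r (D.T (w.i + projS hm x)) := by
    change r (Φ (κ.symm x)).1.1 = _
    rw [e1]
  set v : E m → E n := fun ξ =>
    w.cB.base.symmDeriv (w.cB.center + w.cB.scale • projB hm x) (projB hm ξ) with hv
  have hP1 := D.form _ hs (w.cB.chart.symm (projB hm x)) (w.cB.scale • v ξ) (w.cB.scale • v η)
    (projS hm ξ) (projS hm η)
  have hΓ1 : gΓ (Φ (κ.symm x)).2
      (w.cΓ.scale • mfderivWithin 𝓘(ℝ, E e) (𝓡 e) w.cΓ.base.chart.symm w.cΓ.base.chart.target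
        (w.cΓ.center + w.cΓ.scale • projΓ hm x) (projΓ hm ξ))
      (w.cΓ.scale • mfderivWithin 𝓘(ℝ, E e) (𝓡 e) w.cΓ.base.chart.symm w.cΓ.base.chart.target
        (w.cΓ.center + w.cΓ.scale • projΓ hm x) (projΓ hm η)) = w.cΓ.scale ^ 2 *
      pushForm (𝓡 e) w.cΓ.base.chart gΓ (w.cΓ.center + w.cΓ.scale • projΓ hm x)
        (projΓ hm ξ) (projΓ hm η) := by
    rw [e2]
    generalize w.cΓ.center + w.cΓ.scale • projΓ hm x = z
    rw [pushForm_apply]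
    generalize mfderivWithin 𝓘(ℝ, E e) (𝓡 e) w.cΓ.base.chart.symm w.cΓ.base.chart.target z = A
    simp only [map_smul, smul_apply, smul_eq_mul]
    ring
  rw [hΓ1, e1, hP1] at hiso
  calc pushForm I κ (fun p => (pullbackRadial Φ R r p ^ 2)⁻¹ • g p) x ξ η
      = (pullbackRadial Φ R r (κ.symm x) ^ 2)⁻¹ * g (κ.symm x)
        (mfderivWithin 𝓘(ℝ, E m) I κ.symm κ.target x ξ)
        (mfderivWithin 𝓘(ℝ, E m) I κ.symm κ.target x η) := rfl
    _ = _ := by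
      rw [hiso, e3, modelForm_apply]
      simp only [wedgeCoeff, mul_add, smul_smul, mul_pow, inv_pow]
      -- In the pipe part, `r⁻²` cancels the factor `r²` supplied by `D.form`; in the `Γ` part it
      -- remains inside the squared coefficient.
      rw [inv_mul_cancel_left₀ (by positivity), inv_mul_cancel_left₀ (by positivity), mul_assoc]
      rw [mul_comm (D.u _) (projS hm ξ), mul_comm (D.u _) (projS hm η)]

end WedgeMetric

theorem norm_le_of_mem_cube {k : ℕ} {x : E k} (hx : x ∈ cube k) : ‖x‖ ≤ k := by
  simpa using norm_le_of_abs_apply_le zero_le_one fun i => (hx i).le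

theorem WedgeCell.mem_Ioo {d e m n : ℕ} (hm : m = 1 + d + e) {Γ : Type*} {τ : Tip} {R r : ℝ → ℝ}
    {hP : ℝ × E n → (ℝ × E n) →L[ℝ] (ℝ × E n) →L[ℝ] ℝ} (D : RadialData τ R r hP)
    {w : WedgeCell n d e Γ} {x : E m} (hx : x ∈ (wedgeChart hm D w).target) :
    projS hm x ∈ Set.Ioo (-1 : ℝ) 1 :=
  ⟨(abs_lt.1 hx.2.1).1, (abs_lt.1 hx.2.1).2⟩

/-! ### Uniform bounds for the metric in the wedge charts. -/

section WedgeBounds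

variable {d e m n : ℕ} (hm : m = 1 + d + e) {Γ : Type*} [TopologicalSpace Γ]
  [ChartedSpace (E e) Γ] {τ : Tip} {R r : ℝ → ℝ}
  {hP : ℝ × E n → (ℝ × E n) →L[ℝ] (ℝ × E n) →L[ℝ] ℝ} (D : RadialData τ R r hP) {B : Set (E n)}
  {𝔅 : Set (BaseChart (E n) d)} {𝔊 : Set (BaseChart Γ e)}
  (h𝔅 : IsBaseAtlas 𝓘(ℝ, E n) B True 𝔅) (h𝔊 : IsBaseAtlas (𝓡 e) Set.univ False 𝔊) {θ θ' : ℝ}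
  {H : Type*} [TopologicalSpace H] {I : ModelWithCorners ℝ (E m) H}
  {M : Type*} [TopologicalSpace M] [ChartedSpace H M]
  {g : ∀ p : M, TangentSpace I p →L[ℝ] TangentSpace I p →L[ℝ] ℝ}
  {V : Set M} {Φ : PartialEquiv M ((ℝ × E n) × Γ)}

include h𝔅 h𝔊 in
theorem norm_le_of_mem_wedgeChart_target {w : WedgeCell n d e Γ} (hw : w.Admissible D 𝔅 𝔊 θ θ')
    {x : E m} (hx : x ∈ (wedgeChart hm D w).target) : ‖x‖ ≤ m := by
  refine norm_le_of_mem_cube ?_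
  rcases wedgeChart_target_eq hm D h𝔅 h𝔊 hw with h | h
  · exact h ▸ hx
  · rw [h] at hx
    exact hx.1

section Coefficients

variable [IsManifold (𝓡 e) ∞ Γ]
  (gΓ : Bundle.ContMDiffRiemannianMetric (𝓡 e) ∞ (E e) (fun z : Γ => TangentSpace (𝓡 e) z))
  (hV : IsModeledBy I g V Φ τ R B hP gΓ.inner)

include h𝔅 h𝔊 hV in
theorem uniqueDiffOn_wedgeChart_target {w : WedgeCell n d e Γ} (hw : w.Admissible D 𝔅 𝔊 θ θ') :
    UniqueDiffOn ℝ (wedgeChart hm D w).target := by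
  rw [← trans_wedgeChart_target hm D h𝔅 hw hV]
  exact (isLocalChart_trans_wedgeChart hm D h𝔅 h𝔊 hw hV).uniqueDiffOn_target

include h𝔅 h𝔊 hV in
-- The width `θ / λ(i)` turns the coefficient `λ(i + x)` into `θ λ(i + x) / λ(i)`, whose derivatives
-- are bounded uniformly in `i` by moderateness; likewise for `1 / r`. The remaining coefficients
-- are translates of `u` or rescaled functions from finitely many base charts.
theorem uniformlyBounded_wedgeCoeff :
    UniformlyBounded
      (fun w : {w : WedgeCell n d e Γ // w.Admissible D 𝔅 𝔊 θ θ'} => (wedgeChart hm D w.1).target)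
      (fun w => wedgeCoeff hm D gΓ.inner w.1) := by
  have hu : ∀ w : {w : WedgeCell n d e Γ // w.Admissible D 𝔅 𝔊 θ θ'},
      UniqueDiffOn ℝ (wedgeChart hm D w.1).target :=
    fun w => uniqueDiffOn_wedgeChart_target hm D h𝔅 h𝔊 gΓ hV w.2
  have hr : ∀ w : {w : WedgeCell n d e Γ // w.Admissible D 𝔅 𝔊 θ θ'},
      ∀ x ∈ (wedgeChart hm D w.1).target, ‖x‖ ≤ (m : ℝ) :=
    fun w x hx => norm_le_of_mem_wedgeChart_target hm D h𝔅 h𝔊 w.2 hx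
  have hS := uniformlyBounded_clm (fun _ => projS hm) (fun _ => le_rfl) hr hu
  have hB := uniformlyBounded_clm (fun _ => projB hm) (fun _ => le_rfl) hr hu
  have hΓ := uniformlyBounded_clm (fun _ => projΓ hm) (fun _ => le_rfl) hr hu
  have radial : ∀ {f : {i : ℕ // 1 ≤ i} → ℝ → ℝ},
      UniformlyBounded (fun _ : {i : ℕ // 1 ≤ i} => Set.Ioo (-1 : ℝ) 1) f →
      UniformlyBounded
      (fun w : {w : WedgeCell n d e Γ // w.Admissible D 𝔅 𝔊 θ θ'} => (wedgeChart hm D w.1).target)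
      (fun w x => f ⟨w.1.i, w.1.one_le⟩ (projS hm x)) := fun hf =>
    (hf.reindex fun w : {w : WedgeCell n d e Γ // w.Admissible D 𝔅 𝔊 θ θ'} =>
      ⟨w.1.i, w.1.one_le⟩).comp hS (fun _ => isOpen_Ioo.uniqueDiffOn) hu
      fun w x hx => WedgeCell.mem_Ioo hm D hx
  have h1 := radial (uniformlyBounded_shift D.bounded_u)
  have h2 := (radial D.moderate_lam.uniformlyBounded).contDiff_comp (g := fun y => θ * y)
    (by fun_prop) hu
  have h5 := (radial D.moderate_inv_r.uniformlyBounded).contDiff_comp (g := fun y => θ' * y)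
    (by fun_prop) hu
  have baseB : ∀ {Y : Type} [NormedAddCommGroup Y] [NormedSpace ℝ Y]
      {f : BaseChart (E n) d → E d → Y}, (∀ b ∈ 𝔅, ContDiffOn ℝ ∞ (f b) b.chart.target) →
      UniformlyBounded
      (fun w : {w : WedgeCell n d e Γ // w.Admissible D 𝔅 𝔊 θ θ'} => (wedgeChart hm D w.1).target)
      (fun w x => f w.1.cB.base (w.1.cB.center + w.1.cB.scale • projB hm x)) := fun hf =>
    ((Cell.uniformlyBounded_rescale h𝔅 hf).reindex
      fun w : {w : WedgeCell n d e Γ // w.Admissible D 𝔅 𝔊 θ θ'} => ⟨w.1.cB, w.2.cB⟩).comp hB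
      (fun w => Cell.uniqueDiffOn_target h𝔅 w.2.cB) hu fun w x hx => hx.1
  have h3 := baseB (f := fun b => b.chart.symm) fun b hb =>
    contMDiffOn_iff_contDiffOn.1 (h𝔅.fits b hb).isLocalChart.smooth_symm
  have h4 := baseB (f := fun b => b.symmDeriv) fun b hb =>
    (contMDiffOn_iff_contDiffOn.1 (h𝔅.fits b hb).isLocalChart.smooth_symm).fderivWithin
      (h𝔅.fits b hb).isLocalChart.uniqueDiffOn_target (by simp)
  have h6 := ((Cell.uniformlyBounded_rescale h𝔊 (f := fun b => pushForm (𝓡 e) b.chart gΓ.inner)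
    fun b hb => contDiffOn_pushForm gΓ (h𝔊.fits b hb).isLocalChart).reindex
      fun w : {w : WedgeCell n d e Γ // w.Admissible D 𝔅 𝔊 θ θ'} => ⟨w.1.cΓ, w.2.cΓ⟩).comp hΓ
      (fun w => Cell.uniqueDiffOn_target h𝔊 w.2.cΓ) hu fun w x hx => hx.2.2
  refine (h1.prodMk (h2.prodMk (h3.prodMk (h4.prodMk (h5.prodMk h6 hu) hu) hu) hu) hu).congr
    fun w x _ => ?_
  refine Prod.ext rfl (Prod.ext ?_ (Prod.ext rfl (Prod.ext rfl (Prod.ext ?_ rfl))))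
  · change D.lam (w.1.i + projS hm x) * w.1.cB.scale =
      θ * ((D.lam w.1.i)⁻¹ * D.lam (w.1.i + projS hm x))
    rw [w.2.scale_cB]
    ring
  · change (r (D.T (w.1.i + projS hm x)))⁻¹ * w.1.cΓ.scale =
      θ' * ((r (D.T w.1.i))⁻¹⁻¹ * (r (D.T (w.1.i + projS hm x)))⁻¹)
    rw [w.2.scale_cΓ]
    ring

/-- The inequality `f(i) ≤ K f(i + x)` bounds the rescaled coefficients from below; this
nondegeneracy is what `exists_le_modelForm` needs. -/
theorem wedgeCoeff_bounds (hθ : 0 < θ) (hθ' : 0 < θ') :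
    ∃ K K' : ℝ, 0 < K ∧ 0 < K' ∧ ∀ w : WedgeCell n d e Γ, w.Admissible D 𝔅 𝔊 θ θ' →
      ∀ x ∈ (wedgeChart hm D w).target, θ / K ≤ (wedgeCoeff hm D gΓ.inner w x).2.1 ∧
        θ' / K' ≤ (wedgeCoeff hm D gΓ.inner w x).2.2.2.2.1 := by
  have aux : ∀ {f : ℝ → ℝ}, IsModerate f → ∃ K : ℝ, 0 < K ∧ ∀ θ : ℝ, 0 < θ →
      ∀ w : WedgeCell n d e Γ, ∀ x ∈ (wedgeChart hm D w).target,
      θ / K ≤ f (w.i + projS hm x) * (θ / f w.i) := by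
    intro f hf
    obtain ⟨K, hK1, hK⟩ := hf.exists_ratio_le
    refine ⟨K, by linarith, fun θ hθ w x hx => ?_⟩
    have h0 := w.add_pos hx.2.1
    have hi : (0 : ℝ) < w.i := by exact_mod_cast w.one_le
    have h1 := hK w.i (w.i + projS hm x) hi h0 (by
      have : |projS hm x| < 1 := hx.2.1
      rw [sub_add_cancel_left, abs_neg]
      linarith)
    have h2 := hf.pos hi
    rw [mul_div_assoc', div_le_div_iff₀ (by linarith) h2]
    nlinarith
  obtain ⟨K, hK, h1⟩ := aux D.moderate_lam
  obtain ⟨K', hK', h2⟩ := aux D.moderate_inv_r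
  refine ⟨K, K', hK, hK', fun w hw x hx => ⟨?_, ?_⟩⟩
  · simp only [wedgeCoeff, hw.scale_cB]
    exact h1 θ hθ w x hx
  · simp only [wedgeCoeff, hw.scale_cΓ]
    exact h2 θ' hθ' w x hx

include h𝔅 h𝔊 hV in
-- The upper estimate is the order-zero bound of the form. The lower one combines bounded and
-- nondegenerate coefficients with the positivity of the metrics of `B` and `Γ` on compact cores.
theorem exists_equivalent_modelForm (hθ : 0 < θ) (hθ' : 0 < θ') :
    ∃ c : ℝ, 1 ≤ c ∧ ∀ w : WedgeCell n d e Γ, w.Admissible D 𝔅 𝔊 θ θ' →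
      ∀ x ∈ (wedgeChart hm D w).target, ∀ ξ : E m,
        ‖ξ‖ ^ 2 / c ≤ modelForm hm (wedgeCoeff hm D gΓ.inner w x) ξ ξ ∧
        modelForm hm (wedgeCoeff hm D gΓ.inner w x) ξ ξ ≤ c * ‖ξ‖ ^ 2 := by
  have hcoeff := uniformlyBounded_wedgeCoeff hm D h𝔅 h𝔊 (θ := θ) (θ' := θ') gΓ hV
  obtain ⟨C, hC1, hC⟩ := hcoeff.exists_pos_bound 0
  obtain ⟨C', hC1', hC'⟩ := (hcoeff.contDiff_comp (contDiff_modelForm hm) fun w =>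
    uniqueDiffOn_wedgeChart_target hm D h𝔅 h𝔊 gΓ hV w.2).exists_pos_bound 0
  obtain ⟨K, K', hK, hK', hKb⟩ := wedgeCoeff_bounds hm D (𝔅 := 𝔅) (𝔊 := 𝔊) gΓ hθ hθ'
  obtain ⟨cB, hcB1, hcB⟩ := h𝔅.exists_equivalent
    (a := fun b x => (euclideanForm n).bilinearComp (b.symmDeriv x) (b.symmDeriv x))
    (fun b hb => by
      have h1 : ContinuousOn b.symmDeriv b.chart.target :=
        (contMDiffOn_iff_contDiffOn.1
          (h𝔅.fits b hb).isLocalChart.smooth_symm).continuousOn_fderivWithin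
          (h𝔅.fits b hb).isLocalChart.uniqueDiffOn_target (by simp)
      refine continuousOn_clm_apply.2 fun ξ => continuousOn_clm_apply.2 fun η => ?_
      exact (h1.clm_apply continuousOn_const).inner (𝕜 := ℝ) (h1.clm_apply continuousOn_const))
    (fun b hb x hx ξ hξ => by
      have h2 : b.symmDeriv x ξ ≠ 0 → 0 < inner ℝ (b.symmDeriv x ξ) (b.symmDeriv x ξ) :=
        fun h => real_inner_self_pos.2 h
      refine h2 fun h0 => hξ ?_
      refine (h𝔅.fits b hb).isLocalChart.mfderivWithin_symm_injective hx ?_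
      rw [mfderivWithin_eq_fderivWithin]
      exact h0)
  obtain ⟨cΓ, hcΓ1, hcΓ⟩ := h𝔊.exists_equivalent
    (a := fun b => pushForm (𝓡 e) b.chart gΓ.inner)
    (fun b hb => (contDiffOn_pushForm gΓ (h𝔊.fits b hb).isLocalChart).continuousOn)
    (fun b hb x hx ξ hξ => (h𝔊.fits b hb).isLocalChart.pushForm_pos gΓ.pos hx hξ)
  obtain ⟨c, hc1, hc⟩ := exists_le_modelForm (n := n) hm (Cu := C) (Cy := C) (div_pos hθ hK)
    (div_pos hθ' hK') hcB1 hcΓ1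
  refine ⟨max c C', le_max_of_le_left hc1, fun w hw x hx ξ => ⟨?_, ?_⟩⟩
  · have h0 := hC ⟨w, hw⟩ 0 le_rfl x hx
    rw [norm_iteratedFDerivWithin_zero] at h0
    -- The norm of the nested product dominates every entry, which gives the bounds for `u` and `y`.
    have h1 := (norm_fst_le _).trans h0
    have h2 := (norm_fst_le _).trans ((norm_snd_le _).trans ((norm_snd_le _).trans h0))
    refine le_trans ?_ (hc _ h1 (hKb w hw x hx).1 h2 (fun η => ?_) (hKb w hw x hx).2
      (fun ζ => ?_) ξ)
    · gcongr
      exact le_max_left _ _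
    · refine ((hcB _ hw.cB.base_mem _ (Cell.affine_mem_core h𝔅 hw.cB hx.1) η).1).trans (le_of_eq ?_)
      exact real_inner_self_eq_norm_sq
        (w.cB.base.symmDeriv (w.cB.center + w.cB.scale • projB hm x) η)
    · exact (hcΓ _ hw.cΓ.base_mem _ (Cell.affine_mem_core h𝔊 hw.cΓ hx.2.2) ζ).1
  · have h0 := hC' ⟨w, hw⟩ 0 le_rfl x hx
    rw [norm_iteratedFDerivWithin_zero] at h0
    calc modelForm hm (wedgeCoeff hm D gΓ.inner w x) ξ ξ
        ≤ ‖modelForm hm (wedgeCoeff hm D gΓ.inner w x) ξ ξ‖ := Real.le_norm_self _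
      _ ≤ ‖modelForm hm (wedgeCoeff hm D gΓ.inner w x)‖ * ‖ξ‖ * ‖ξ‖ :=
          ContinuousLinearMap.le_opNorm₂ _ ξ ξ
      _ ≤ max c C' * ‖ξ‖ * ‖ξ‖ := by
          gcongr
          exact h0.trans (le_max_right _ _)
      _ = _ := by ring

end Coefficients

end WedgeBounds

/-! ### Transition maps, multiplicity and covering by wedge charts. -/

section WedgeAtlas

variable {d e m n : ℕ} (hm : m = 1 + d + e) {Γ : Type*} [TopologicalSpace Γ]
  [ChartedSpace (E e) Γ] {τ : Tip} {R r : ℝ → ℝ}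
  {hP : ℝ × E n → (ℝ × E n) →L[ℝ] (ℝ × E n) →L[ℝ] ℝ} (D : RadialData τ R r hP) {B : Set (E n)}
  {𝔅 : Set (BaseChart (E n) d)} {𝔊 : Set (BaseChart Γ e)}
  (h𝔅 : IsBaseAtlas 𝓘(ℝ, E n) B True 𝔅) (h𝔊 : IsBaseAtlas (𝓡 e) Set.univ False 𝔊) {θ θ' : ℝ}
  {H : Type*} [TopologicalSpace H] {I : ModelWithCorners ℝ (E m) H}
  {M : Type*} [TopologicalSpace M] [ChartedSpace H M]
  {g : ∀ p : M, TangentSpace I p →L[ℝ] TangentSpace I p →L[ℝ] ℝ}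
  {V : Set M} {Φ : PartialEquiv M ((ℝ × E n) × Γ)}
  {gΓ : ∀ z : Γ, TangentSpace (𝓡 e) z →L[ℝ] TangentSpace (𝓡 e) z →L[ℝ] ℝ}
  (hV : IsModeledBy I g V Φ τ R B hP gΓ)

/-- The widths of neighbouring cells are comparable. -/
theorem IsModerate.scale_le {f : ℝ → ℝ} (hf : IsModerate f) (θ : ℝ) (hθ : 0 < θ) :
    ∃ K : ℝ, ∀ i i' : ℕ, 1 ≤ i → 1 ≤ i' → |(i : ℝ) - i'| ≤ 2 → θ / f i ≤ K * (θ / f i') := by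
  obtain ⟨K, hK1, hK⟩ := hf.exists_ratio_le
  refine ⟨K, fun i i' hi hi' h => ?_⟩
  have hi0 : (0 : ℝ) < i := by exact_mod_cast hi
  have hi0' : (0 : ℝ) < i' := by exact_mod_cast hi'
  have h1 := hK i' i hi0' hi0 (by rwa [abs_sub_comm])
  have h2 := hf.pos hi0
  have h3 := hf.pos hi0'
  rw [mul_div_assoc', div_le_div_iff₀ h2 h3]
  nlinarith

include h𝔅 h𝔊 hV in
-- In the coordinates `(y, s, z)` a transition map splits into a transition of cells of `B`, a
-- translation by `i - i'`, and a transition of cells of `Γ`. If the domains meet, `|i - i'| ≤ 2`,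
-- so the widths are comparable.
theorem exists_transition_bound [T2Space Γ] (hθ : 0 < θ) (hθ' : 0 < θ') (j : ℕ) :
    ∃ c : ℝ, ∀ w w' : WedgeCell n d e Γ, w.Admissible D 𝔅 𝔊 θ θ' → w'.Admissible D 𝔅 𝔊 θ θ' →
      BoundedCk j ((Φ.trans (wedgeChart hm D w')) ∘ (Φ.trans (wedgeChart hm D w)).symm)
        ((Φ.trans (wedgeChart hm D w)).target ∩
          (Φ.trans (wedgeChart hm D w)).symm ⁻¹' (Φ.trans (wedgeChart hm D w')).source) c := by
  obtain ⟨K, hK⟩ := D.moderate_lam.scale_le θ hθ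
  obtain ⟨K', hK'⟩ := D.moderate_inv_r.scale_le θ' hθ'
  let ι := {q : WedgeCell n d e Γ × WedgeCell n d e Γ // q.1.Admissible D 𝔅 𝔊 θ θ' ∧
    q.2.Admissible D 𝔅 𝔊 θ θ' ∧ |(q.1.i : ℝ) - q.2.i| ≤ 2}
  let κ : WedgeCell n d e Γ → PartialEquiv M (E m) := fun w => Φ.trans (wedgeChart hm D w)
  let S : ι → Set (E m) := fun q => (κ q.1.1).target ∩ (κ q.1.1).symm ⁻¹' (κ q.1.2).source
  have hchart : ∀ w : WedgeCell n d e Γ, w.Admissible D 𝔅 𝔊 θ θ' → IsLocalChart I m V (κ w) :=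
    fun w hw => isLocalChart_trans_wedgeChart hm D h𝔅 h𝔊 hw hV
  have hu : ∀ q, UniqueDiffOn ℝ (S q) := fun q =>
    (hchart _ q.2.1).uniqueDiffOn_overlap (hchart _ q.2.2.1)
  have hmem : ∀ w w' : WedgeCell n d e Γ, ∀ x ∈ (κ w).target ∩ (κ w).symm ⁻¹' (κ w').source,
      x ∈ (wedgeChart hm D w).target ∧ (wedgeChart hm D w).symm x ∈ (wedgeChart hm D w').source ∧
      Φ ((κ w).symm x) = (wedgeChart hm D w).symm x := by
    rintro w w' x ⟨hx1, hx2⟩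
    have h1 : Φ ((κ w).symm x) = (wedgeChart hm D w).symm x := Φ.right_inv hx1.2
    exact ⟨hx1.1, h1 ▸ hx2.2, h1⟩
  have hcoord : ∀ w w' : WedgeCell n d e Γ, ∀ x ∈ (κ w).target ∩ (κ w).symm ⁻¹' (κ w').source,
      |w.i + projS hm x - w'.i| < 1 ∧ w.cB.chart.symm (projB hm x) ∈ w'.cB.chart.source ∧
      w.cΓ.chart.symm (projΓ hm x) ∈ w'.cΓ.chart.source ∧
      (κ w' ∘ (κ w).symm) x = (splitEquiv hm).symm (w'.cB.chart (w.cB.chart.symm (projB hm x)),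
        w.i + projS hm x - w'.i, w'.cΓ.chart (w.cΓ.chart.symm (projΓ hm x))) := by
    intro w w' x hx
    obtain ⟨h1, h2, h3⟩ := hmem w w' x hx
    have h0 : 0 < w.i + projS hm x := w.add_pos h1.2.1
    have hR := (D.R_pos _ (D.T_mem _ h0)).ne'
    have hval : (κ w' ∘ (κ w).symm) x = wedgeChart hm D w' ((wedgeChart hm D w).symm x) :=
      congrArg (wedgeChart hm D w') h3
    rw [hval, wedgeChart_apply]
    rw [mem_wedgeChart_source] at h2
    rw [wedgeChart_symm_apply] at h2 ⊢
    simp only [← projS_apply, ← projB_apply, ← projΓ_apply, D.sigma_T _ h0,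
      inv_smul_smul₀ hR] at h2 ⊢
    exact ⟨h2.2.1, h2.2.2.1, h2.2.2.2, trivial⟩
  have hr : ∀ q : ι, ∀ x ∈ S q, ‖x‖ ≤ (m : ℝ) := fun q x hx =>
    norm_le_of_mem_wedgeChart_target hm D h𝔅 h𝔊 q.2.1 (hmem _ _ x hx).1
  have hS := uniformlyBounded_clm (fun _ => projS hm) (fun _ => le_rfl) hr hu
  have hB := uniformlyBounded_clm (fun _ => projB hm) (fun _ => le_rfl) hr hu
  have hΓ := uniformlyBounded_clm (fun _ => projΓ hm) (fun _ => le_rfl) hr hu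
  have h1 := ((Cell.uniformlyBounded_transition h𝔅 K).reindex fun q : ι =>
    ⟨(q.1.1.cB, q.1.2.cB), q.2.1.cB, q.2.2.1.cB, by
      rw [q.2.1.scale_cB, q.2.2.1.scale_cB]
      exact hK _ _ q.1.1.one_le q.1.2.one_le q.2.2.2⟩).comp hB
    (fun q => (Cell.isLocalChart h𝔅 q.2.1.cB).uniqueDiffOn_overlap
      (Cell.isLocalChart h𝔅 q.2.2.1.cB)) hu
    (fun q x hx => ⟨(hmem _ _ x hx).1.1, (hcoord _ _ x hx).2.1⟩)
  have h3 := ((Cell.uniformlyBounded_transition h𝔊 K').reindex fun q : ι =>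
    ⟨(q.1.1.cΓ, q.1.2.cΓ), q.2.1.cΓ, q.2.2.1.cΓ, by
      rw [q.2.1.scale_cΓ, q.2.2.1.scale_cΓ]
      exact hK' _ _ q.1.1.one_le q.1.2.one_le q.2.2.2⟩).comp hΓ
    (fun q => (Cell.isLocalChart h𝔊 q.2.1.cΓ).uniqueDiffOn_overlap
      (Cell.isLocalChart h𝔊 q.2.2.1.cΓ)) hu
    (fun q x hx => ⟨(hmem _ _ x hx).1.2.2, (hcoord _ _ x hx).2.2.1⟩)
  have h2 := hS.add (uniformlyBounded_const (s := S) (y := fun q : ι => (q.1.1.i : ℝ) - q.1.2.i)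
    (C := 2) fun q => q.2.2.2) hu
  have htot : UniformlyBounded S (fun q => κ q.1.2 ∘ (κ q.1.1).symm) := by
    refine ((h1.prodMk (h2.prodMk h3 hu) hu).contDiff_comp
      (g := fun y => (splitEquiv hm).symm y) (splitEquiv hm).symm.contDiff hu).congr
      fun q x hx => ?_
    rw [(hcoord _ _ x hx).2.2.2]
    refine congrArg _ (Prod.ext rfl (Prod.ext ?_ rfl))
    change _ = projS hm x + ((q.1.1.i : ℝ) - q.1.2.i)
    ring
  obtain ⟨c, hc⟩ := htot j
  refine ⟨c, fun w w' hw hw' => ?_⟩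
  by_cases hi : |(w.i : ℝ) - w'.i| ≤ 2
  · exact hc ⟨(w, w'), hw, hw', hi⟩
  -- Charts over distant intervals do not overlap, so their bound is vacuous.
  · have hempty : (κ w).target ∩ (κ w).symm ⁻¹' (κ w').source = ∅ := by
      rw [Set.eq_empty_iff_forall_notMem]
      intro x hx
      refine hi ?_
      have h1 := abs_lt.1 (hcoord w w' x hx).1
      have h2 : |projS hm x| < 1 := (hmem w w' x hx).1.2.1
      have h2 := abs_lt.1 h2
      exact abs_le.2 ⟨by linarith, by linarith⟩
    have : (Φ.trans (wedgeChart hm D w)).target ∩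
          (Φ.trans (wedgeChart hm D w)).symm ⁻¹' (Φ.trans (wedgeChart hm D w')).source = ∅ := hempty
    rw [this]
    exact ⟨contDiffOn_empty, fun _ _ x hx => absurd hx (Set.notMem_empty x)⟩

include h𝔅 h𝔊 in
-- An open interval of half-width one about the integer `i` contains `s` only for `i = ⌊s⌋` or `i =
-- ⌊s⌋ + 1`. For a fixed `i` all cell widths are fixed, and the lattice count applies to each
-- factor.
theorem exists_wedge_multiplicity_le {X : Type*} {Φ : PartialEquiv X ((ℝ × E n) × Γ)} :
    ∃ N : ℕ, ∀ p : X,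
    {κ | ∃ w : WedgeCell n d e Γ, w.Admissible D 𝔅 𝔊 θ θ' ∧ κ = Φ.trans (wedgeChart hm D w) ∧
      p ∈ κ.source}.encard ≤ N := by
  obtain ⟨N, hN⟩ := Cell.exists_multiplicity_le h𝔅
  obtain ⟨N', hN'⟩ := Cell.exists_multiplicity_le h𝔊
  refine ⟨N * N' + N * N', fun p => ?_⟩
  set s := D.sigma (Φ p).1.1
  let T : ℕ → Set (PartialEquiv X (E m)) := fun i =>
    {κ | ∃ w : WedgeCell n d e Γ, w.Admissible D 𝔅 𝔊 θ θ' ∧ κ = Φ.trans (wedgeChart hm D w) ∧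
      p ∈ κ.source ∧ w.i = i}
  have hT : ∀ i, (T i).encard ≤ (N * N' : ℕ) := by
    intro i
    by_cases hi : 1 ≤ i
    swap
    · have : T i = ∅ := by
        rw [Set.eq_empty_iff_forall_notMem]
        rintro κ ⟨w, -, -, -, rfl⟩
        exact hi w.one_le
      rw [this]
      simp
    let AB := {a : Cell (E n) d | a.Admissible 𝔅 ∧ a.scale = θ / D.lam i ∧
      (R (Φ p).1.1)⁻¹ • (Φ p).1.2 ∈ a.chart.source}
    let AΓ := {a : Cell Γ e | a.Admissible 𝔊 ∧ a.scale = θ' / (r (D.T i))⁻¹ ∧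
      (Φ p).2 ∈ a.chart.source}
    have hsub : T i ⊆ (fun q : Cell (E n) d × Cell Γ e =>
        Φ.trans (wedgeChart hm D ⟨i, hi, q.1, q.2⟩)) '' (AB ×ˢ AΓ) := by
      rintro κ ⟨w, hw, rfl, hp, rfl⟩
      exact ⟨(w.cB, w.cΓ), ⟨⟨hw.cB, hw.scale_cB, hp.2.2.2.1⟩, ⟨hw.cΓ, hw.scale_cΓ, hp.2.2.2.2⟩⟩, rfl⟩
    refine (Set.encard_le_encard hsub).trans ((Set.encard_image_le _ _).trans ?_)
    rw [Set.encard_prod]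
    push_cast
    exact mul_le_mul' (hN _ _) (hN' _ _)
  have hsub : {κ | ∃ w : WedgeCell n d e Γ, w.Admissible D 𝔅 𝔊 θ θ' ∧
      κ = Φ.trans (wedgeChart hm D w) ∧ p ∈ κ.source} ⊆ T ⌊s⌋.toNat ∪ T (⌊s⌋.toNat + 1) := by
    rintro κ ⟨w, hw, rfl, hp⟩
    have h1 : |s - w.i| < 1 := hp.2.2.1
    have h2 := abs_lt.1 h1
    have h3 := Int.floor_le s
    have h4 := Int.lt_floor_add_one s
    have h5 : (w.i : ℤ) < ⌊s⌋ + 2 := by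
      have : (w.i : ℝ) < ⌊s⌋ + 2 := by linarith
      exact_mod_cast this
    have h6 : ⌊s⌋ < (w.i : ℤ) + 1 := by
      have : (⌊s⌋ : ℝ) < w.i + 1 := by linarith
      exact_mod_cast this
    have h7 := w.one_le
    rcases (by omega : w.i = ⌊s⌋.toNat ∨ w.i = ⌊s⌋.toNat + 1) with h | h
    · exact Or.inl ⟨w, hw, rfl, hp, h⟩
    · exact Or.inr ⟨w, hw, rfl, hp, h⟩
  refine (Set.encard_le_encard hsub).trans ((Set.encard_union_le _ _).trans ?_)
  push_cast
  have h := add_le_add (hT ⌊s⌋.toNat) (hT (⌊s⌋.toNat + 1))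
  push_cast at h
  exact h

theorem exists_pos_le_radius {F : Type*} [NormedAddCommGroup F] [NormedSpace ℝ F] {H X : Type*}
    [TopologicalSpace H] {I : ModelWithCorners ℝ F H} [TopologicalSpace X] [ChartedSpace H X]
    {k : ℕ} {Z : Set X} {P : Prop} {𝔅 : Set (BaseChart X k)} (h𝔅 : IsBaseAtlas I Z P 𝔅) :
    ∃ δ : ℝ, 0 < δ ∧ δ ≤ 1 ∧ ∀ b ∈ 𝔅, δ ≤ b.radius := by
  obtain ⟨c, hc1, hc⟩ := exists_uniform_bound h𝔅.finite (p := fun b c => b.radius⁻¹ ≤ c)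
    (fun _ _ _ h h' => h'.trans h) (fun b _ => ⟨_, le_rfl⟩)
  refine ⟨c⁻¹, by positivity, inv_le_one_of_one_le₀ hc1, fun b hb => ?_⟩
  exact inv_le_of_inv_le₀ (h𝔅.fits b hb).radius_pos (hc b hb)

include h𝔅 h𝔊 hV in
/-- Every point of the wedge lies in the central part of an admissible cell. -/
theorem exists_wedgeCell {c c' δ δ' : ℝ} (hc : 0 < c) (hlam : ∀ s ∈ Set.Ioi (0 : ℝ), c ≤ D.lam s)
    (hc' : 0 < c') (hr : ∀ s ∈ Set.Ioi (0 : ℝ), c' ≤ (r (D.T s))⁻¹)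
    (hδ : 0 < δ) (hδ1 : δ ≤ 1) (hδr : ∀ b ∈ 𝔅, δ ≤ b.radius)
    (hδ' : 0 < δ') (hδ1' : δ' ≤ 1) (hδr' : ∀ b ∈ 𝔊, δ' ≤ b.radius)
    {p : M} (hp : p ∈ V) {i : ℕ} (hi : 1 ≤ i) (hpi : |D.sigma (Φ p).1.1 - i| < 1) :
    ∃ w : WedgeCell n d e Γ, w.Admissible D 𝔅 𝔊 (δ * c) (δ' * c') ∧ w.i = i ∧
      p ∈ (Φ.trans (wedgeChart hm D w)).source ∧
      (∀ j, |w.cB.chart ((R (Φ p).1.1)⁻¹ • (Φ p).1.2) j| ≤ 1 / 2) ∧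
      ∀ j, |w.cΓ.chart (Φ p).2 j| ≤ 1 / 2 := by
  have hpΦ : p ∈ Φ.source := hV.source_eq ▸ hp
  have hmem := (mem_wedge_iff D.R_pos).1 (hV.target_eq ▸ Φ.map_source hpΦ)
  have hi0 : (i : ℝ) ∈ Set.Ioi (0 : ℝ) := by
    have : (0 : ℝ) < i := by exact_mod_cast hi
    exact this
  -- The lower bound `c ≤ f` keeps the widths `δ c / f` below `δ`, hence below one and below every
  -- base radius.
  have hscale : ∀ {δ c f : ℝ}, 0 < δ → 0 < c → c ≤ f → 0 < δ * c / f ∧ δ * c / f ≤ δ := by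
    intro δ c f hδ hc hf
    have hf0 := hc.trans_le hf
    refine ⟨by positivity, ?_⟩
    rw [div_le_iff₀ hf0]
    exact mul_le_mul_of_nonneg_left hf hδ.le
  obtain ⟨hε, hεδ⟩ := hscale hδ hc (hlam i hi0)
  obtain ⟨hε', hεδ'⟩ := hscale hδ' hc' (hr i hi0)
  obtain ⟨a, ha, has, hpa, hah⟩ := Cell.exists_admissible h𝔅 hε (hεδ.trans hδ1)
    (fun b hb => hεδ.trans (hδr b hb)) hmem.2
  obtain ⟨a', ha', has', hpa', hah'⟩ := Cell.exists_admissible h𝔊 hε' (hεδ'.trans hδ1')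
    (fun b hb => hεδ'.trans (hδr' b hb)) (Set.mem_univ (Φ p).2)
  exact ⟨⟨i, hi, a, a'⟩, ⟨ha, ha', has, has'⟩, rfl, ⟨hpΦ, hmem.1, hpi, hpa, hpa'⟩, hah, hah'⟩

end WedgeAtlas

/-- A wedge with radial data has a cofinal singularity function. -/
theorem RadialData.isCofinalSingularityFunction {d e m n : ℕ} (hm : m = 1 + d + e)
    {H : Type*} [TopologicalSpace H] {I : ModelWithCorners ℝ (E m) H}
    {M : Type*} [TopologicalSpace M] [ChartedSpace H M]
    {g : ∀ p : M, TangentSpace I p →L[ℝ] TangentSpace I p →L[ℝ] ℝ}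
    {Γ : Type*} [TopologicalSpace Γ] [T2Space Γ] [CompactSpace Γ] [ChartedSpace (E e) Γ]
    [IsManifold (𝓡 e) ∞ Γ]
    (gΓ : Bundle.ContMDiffRiemannianMetric (𝓡 e) ∞ (E e) (fun z : Γ => TangentSpace (𝓡 e) z))
    {B : Set (E n)} (hBc : IsCompact B) (hB : IsSubmanifold 𝓘(ℝ, E n) d B) {τ : Tip} {R r : ℝ → ℝ}
    {hP : ℝ × E n → (ℝ × E n) →L[ℝ] (ℝ × E n) →L[ℝ] ℝ} (D : RadialData τ R r hP)
    {V : Set M} {Φ : PartialEquiv M ((ℝ × E n) × Γ)}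
    (hV : IsModeledBy I g V Φ τ R B hP gΓ.inner) :
    IsCofinalSingularityFunction I g V Φ τ R B (pullbackRadial Φ R r) := by
  obtain ⟨𝔅, h𝔅⟩ := exists_baseAtlas (I := 𝓘(ℝ, E n)) (k := d) hBc True fun p hp => by
    obtain ⟨κ, hκ, hpκ⟩ := hB p hp
    exact ⟨κ, hκ, hpκ, Or.inl trivial⟩
  obtain ⟨𝔊, h𝔊⟩ := exists_baseAtlas (I := 𝓡 e) (k := e) (isCompact_univ (X := Γ)) False
    fun z _ => by
      refine ⟨extChartAt (𝓡 e) z, ⟨⟨_, isOpen_extChartAt_source (I := 𝓡 e) z, by simp⟩,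
        ⟨_, isOpen_extChartAt_target z, Or.inl rfl⟩, ?_, contMDiffOn_extChartAt_symm z⟩,
        mem_extChartAt_source z, Or.inr (isOpen_extChartAt_target z)⟩
      rw [extChartAt_source]
      exact contMDiffOn_extChartAt
  obtain ⟨δ, hδ, hδ1, hδr⟩ := exists_pos_le_radius h𝔅
  obtain ⟨δ', hδ', hδ1', hδr'⟩ := exists_pos_le_radius h𝔊
  obtain ⟨c, hc, hlam⟩ := D.moderate_lam.lower
  obtain ⟨c', hc', hr'⟩ := D.moderate_inv_r.lower
  have hθ : 0 < δ * c := mul_pos hδ hc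
  have hθ' : 0 < δ' * c' := mul_pos hδ' hc'
  have hmemV : ∀ p ∈ V, (Φ p).1.1 ∈ interior τ.J := fun p hp =>
    ((mem_wedge_iff D.R_pos).1 (hV.target_eq ▸ Φ.map_source (hV.source_eq ▸ hp))).1
  let 𝔎 : Set (PartialEquiv M (E m)) := {κ | ∃ w : WedgeCell n d e Γ,
    w.Admissible D 𝔅 𝔊 (δ * c) (δ' * c') ∧ κ = Φ.trans (wedgeChart hm D w)}
  have htarget : ∀ w : WedgeCell n d e Γ, w.Admissible D 𝔅 𝔊 (δ * c) (δ' * c') →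
      (Φ.trans (wedgeChart hm D w)).target = (wedgeChart hm D w).target :=
    fun w hw => trans_wedgeChart_target hm D h𝔅 hw hV
  -- Points with `0 < s < 1` lie over the first interval `(0, 2)` but may be close to its end. For
  -- `s ≥ 1` rounding leaves an error of at most `1 / 2`, which is why uniform regularity is
  -- asserted only on `s ≥ 1`.
  have hround : ∀ s : ℝ, 0 < s → ∃ i : ℕ, 1 ≤ i ∧ |s - i| < 1 ∧ (1 ≤ s → |s - i| ≤ 1 / 2) := by
    intro s hs
    rcases le_total 1 s with h1 | h1
    · have h2 : 1 ≤ round s := by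
        rw [round_eq, Int.le_floor]
        push_cast
        linarith
      have h3 : ((round s).toNat : ℝ) = (round s : ℝ) := by
        exact_mod_cast Int.toNat_of_nonneg (by omega)
      have h4 := abs_sub_round s
      refine ⟨(round s).toNat, by omega, ?_, fun _ => ?_⟩ <;> rw [h3] <;> linarith
    · refine ⟨1, le_rfl, ?_, fun h => ?_⟩
      · rw [abs_lt]; constructor <;> push_cast <;> linarith
      · rw [le_antisymm h1 h]; norm_num
  refine ⟨_, D.cofinal, ?_, fun p hp => D.r_pos _ (hmemV p hp), 𝔎, ⟨?_, ?_, ?_, ?_, ?_, ?_⟩, ?_, ?_⟩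
  · have h1 : ContMDiffOn I 𝓘(ℝ, ℝ) ∞ (fun p => (Φ p).1.1) V :=
      contDiff_fst.contMDiff.comp_contMDiffOn (contMDiff_fst.comp_contMDiffOn hV.smooth)
    exact D.smooth_r.contMDiffOn.comp h1 hmemV
  · rintro _ ⟨w, hw, rfl⟩
    exact isLocalChart_trans_wedgeChart hm D h𝔅 h𝔊 hw hV
  · intro p hp
    obtain ⟨i, hi, hpi, -⟩ := hround _ (D.sigma_pos _ (hmemV p hp))
    obtain ⟨w, hw, -, hpw, -⟩ := exists_wedgeCell hm D h𝔅 h𝔊 hV hc hlam hc' hr' hδ hδ1 hδr hδ'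
      hδ1' hδr' hp hi hpi
    exact Set.mem_biUnion (⟨w, hw, rfl⟩ : _ ∈ 𝔎) hpw
  · rintro _ ⟨⟨w, hw, rfl⟩, -⟩
    rw [htarget w hw]
    exact wedgeChart_target_eq hm D h𝔅 h𝔊 hw
  -- The coordinates of the image of `p` are at most `1 / 2`, so dilation by `4 / 3` keeps them
  -- below one. The half-space is a cone and is preserved too.
  · refine ⟨3 / 4, by norm_num, by norm_num, ?_⟩
    rintro p ⟨hp, hpA⟩
    have hs1 : 1 ≤ D.sigma (Φ p).1.1 := by
      obtain ⟨⟨t, ht, y, -, hty⟩, -⟩ := hpA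
      rw [hty]
      exact ht.2
    obtain ⟨i, hi, hpi, hpi2⟩ := hround _ (D.sigma_pos _ (hmemV p hp))
    obtain ⟨w, hw, rfl, hpw, hB2, hΓ2⟩ := exists_wedgeCell hm D h𝔅 h𝔊 hV hc hlam hc' hr' hδ hδ1
      hδr hδ' hδ1' hδr' hp hi hpi
    have hmeet : Φ.trans (wedgeChart hm D w) ∈ chartsMeeting 𝔎
        (V ∩ Φ ⁻¹' wedge R B {t | t ∈ interior τ.J ∧ 1 ≤ D.sigma t} Γ) :=
      ⟨⟨w, hw, rfl⟩, p, hpw, hp, hpA⟩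
    refine Set.mem_biUnion hmeet ?_
    set κ := Φ.trans (wedgeChart hm D w) with hκ
    refine ⟨κ p, ⟨(4 / 3 : ℝ) • κ p, ?_, ?_⟩, κ.left_inv hpw⟩
    · have hmem : κ p ∈ κ.target := κ.map_source hpw
      have hhalf : ∀ j, |κ p j| ≤ 1 / 2 := by
        have hκp : splitEquiv hm (κ p) = (w.cB.chart ((R (Φ p).1.1)⁻¹ • (Φ p).1.2),
            D.sigma (Φ p).1.1 - w.i, w.cΓ.chart (Φ p).2) :=
          (splitEquiv hm).apply_symm_apply _
        intro j
        rcases lt_trichotomy j.1 d with h | h | h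
        · have := splitEquiv_fst hm (κ p) ⟨j, h⟩
          rw [hκp] at this
          exact (congrArg abs this).symm.le.trans (hB2 _)
        · have := splitEquiv_snd_fst hm (κ p)
          rw [hκp] at this
          have hj : j = ⟨d, by omega⟩ := Fin.ext h
          rw [hj]
          exact (congrArg abs this).symm.le.trans (hpi2 hs1)
        · have := splitEquiv_snd_snd hm (κ p) ⟨j - (d + 1), by omega⟩
          rw [hκp] at this
          have hj : (⟨d + 1 + (j.1 - (d + 1)), by omega⟩ : Fin m) = j := Fin.ext (by simp; omega)
          rw [hj] at this
          exact (congrArg abs this).symm.le.trans (hΓ2 _)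
      have hcube : (4 / 3 : ℝ) • κ p ∈ cube m := by
        intro j
        have := hhalf j
        rw [PiLp.smul_apply, smul_eq_mul, abs_mul, abs_of_pos (by norm_num : (0 : ℝ) < 4 / 3)]
        linarith
      have hT := wedgeChart_target_eq hm D h𝔅 h𝔊 hw
      rw [← htarget w hw] at hT
      rcases hT with h | h
      · rw [h]
        exact hcube
      · rw [h] at hmem ⊢
        refine ⟨hcube, fun h0 => ?_⟩
        have := hmem.2 h0
        rw [PiLp.smul_apply, smul_eq_mul]
        positivity
    · simp only [smul_smul]
      norm_num
  · obtain ⟨N, hN⟩ := exists_wedge_multiplicity_le hm D h𝔅 h𝔊 (θ := δ * c) (θ' := δ' * c') (Φ := Φ)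
    refine ⟨N, fun p => (Set.encard_le_encard ?_).trans (hN p)⟩
    rintro κ ⟨⟨⟨w, hw, rfl⟩, -⟩, hp⟩
    exact ⟨w, hw, rfl, hp⟩
  · intro j
    obtain ⟨C, hC⟩ := exists_transition_bound hm D h𝔅 h𝔊 hV hθ hθ' j
    refine ⟨C, ?_⟩
    rintro _ ⟨⟨w, hw, rfl⟩, -⟩ _ ⟨⟨w', hw', rfl⟩, -⟩
    exact hC w w' hw hw'
  · obtain ⟨C, hC1, hC⟩ := exists_equivalent_modelForm hm D h𝔅 h𝔊 gΓ hV hθ hθ'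
    refine ⟨C, hC1, ?_⟩
    rintro _ ⟨⟨w, hw, rfl⟩, -⟩ x hx ξ
    rw [htarget w hw] at hx
    rw [pushForm_trans_wedgeChart hm D h𝔅 h𝔊 hV hw hx]
    exact hC w hw x hx ξ
  · intro j
    obtain ⟨C, hC⟩ := ((uniformlyBounded_wedgeCoeff hm D h𝔅 h𝔊 gΓ hV).contDiff_comp
      (contDiff_modelForm hm) fun w =>
      uniqueDiffOn_wedgeChart_target hm D h𝔅 h𝔊 gΓ hV w.2).congr
      (g := fun w : {w : WedgeCell n d e Γ // w.Admissible D 𝔅 𝔊 (δ * c) (δ' * c')} =>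
        pushForm I (Φ.trans (wedgeChart hm D w.1))
          (fun p => (pullbackRadial Φ R r p ^ 2)⁻¹ • g p))
      (fun w x hx => pushForm_trans_wedgeChart hm D h𝔅 h𝔊 hV w.2 hx) j
    refine ⟨C, ?_⟩
    rintro _ ⟨⟨w, hw, rfl⟩, -⟩
    rw [htarget w hw]
    exact hC ⟨w, hw⟩

/-! ### Functions of one variable with bounded derivatives -/

/-- `f` is smooth on `S ⊆ ℝ`, and it is bounded there together with all its derivatives. -/
def BCInf (S : Set ℝ) (f : ℝ → ℝ) : Prop :=
  UniformlyBounded (fun _ : Unit => S) (fun _ => f)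

section BCInf

variable {S U : Set ℝ} {f g q w T : ℝ → ℝ}

theorem bcInf_iff : BCInf S f ↔ ContDiffOn ℝ ∞ f S ∧
    ∀ j : ℕ, ∃ c : ℝ, ∀ x ∈ S, |iteratedDerivWithin j f S x| ≤ c := by
  unfold BCInf
  rw [uniformlyBounded_iff]
  simp only [norm_iteratedFDerivWithin_eq_norm_iteratedDerivWithin, Real.norm_eq_abs,
    forall_const]

theorem BCInf.contDiffOn (hf : BCInf S f) : ContDiffOn ℝ ∞ f S := (bcInf_iff.1 hf).1

theorem bcInf_const (c : ℝ) : BCInf S fun _ => c :=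
  uniformlyBounded_const (y := fun _ : Unit => c) fun _ => le_rfl

theorem BCInf.mul (hS : IsOpen S) (hf : BCInf S f) (hg : BCInf S g) :
    BCInf S fun x => f x * g x :=
  (UniformlyBounded.prodMk hf hg fun _ => hS.uniqueDiffOn).contDiff_comp
    (g := fun p : ℝ × ℝ => p.1 * p.2) (by fun_prop) fun _ => hS.uniqueDiffOn

theorem BCInf.add (hS : IsOpen S) (hf : BCInf S f) (hg : BCInf S g) :
    BCInf S fun x => f x + g x :=
  UniformlyBounded.add hf hg fun _ => hS.uniqueDiffOn

theorem iteratedDerivWithin_succ_eq (hS : IsOpen S) (h : ∀ x ∈ S, HasDerivAt f (g x) x) (j : ℕ)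
    {x : ℝ} (hx : x ∈ S) :
    iteratedDerivWithin (j + 1) f S x = iteratedDerivWithin j g S x := by
  rw [iteratedDerivWithin_succ']
  exact iteratedDerivWithin_congr
    (fun y hy => (h y hy).hasDerivWithinAt.derivWithin (hS.uniqueDiffWithinAt hy)) hx

theorem hasDerivAt_of_contDiffOn (hS : IsOpen S) (hf : ContDiffOn ℝ ∞ f S) {x : ℝ} (hx : x ∈ S) :
    HasDerivAt f (deriv f x) x :=
  ((hf.differentiableOn (by simp)).differentiableAt (hS.mem_nhds hx)).hasDerivAt

theorem BCInf.deriv (hS : IsOpen S) (hf : BCInf S f) : BCInf S (deriv f) := by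
  rw [bcInf_iff] at hf ⊢
  refine ⟨((contDiffOn_infty_iff_deriv_of_isOpen hS).1 hf.1).2, fun j => ?_⟩
  obtain ⟨c, hc⟩ := hf.2 (j + 1)
  refine ⟨c, fun x hx => ?_⟩
  rw [← iteratedDerivWithin_succ_eq hS (fun y hy => hasDerivAt_of_contDiffOn hS hf.1 hy) j hx]
  exact hc x hx

/-- Composition with a solution of the differential equation `T' = w(T)`. -/
theorem BCInf.comp_flow (hS : IsOpen S) (hU : IsOpen U) (hw : BCInf U w)
    (hT : ContDiffOn ℝ ∞ T S) (hTU : Set.MapsTo T S U) (hT' : ∀ s ∈ S, HasDerivAt T (w (T s)) s)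
    (hf : BCInf U f) : BCInf S (f ∘ T) := by
  refine bcInf_iff.2 ⟨hf.contDiffOn.comp hT hTU, fun j => ?_⟩
  induction j generalizing f with
  | zero =>
    obtain ⟨c, hc⟩ := (bcInf_iff.1 hf).2 0
    refine ⟨c, fun s hs => ?_⟩
    simpa using hc _ (hTU hs)
  | succ j ih =>
    -- The derivative of `f ∘ T` is `(f' w) ∘ T`, and `f' w` again has bounded derivatives; hence
    -- the induction runs over all `f`.
    obtain ⟨c, hc⟩ := ih (hf.deriv hU |>.mul hU hw)
    refine ⟨c, fun s hs => ?_⟩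
    rw [iteratedDerivWithin_succ_eq hS (fun y hy =>
      (hasDerivAt_of_contDiffOn hU hf.contDiffOn (hTU hy)).comp y (hT' y hy)) j hs]
    exact hc s hs

/-- From `f' = q f`, each derivative has the form `p_j f`, where `p_0 = 1` and `p_{j+1} = p_j' + p_j
q` are bounded because `q` is bounded with all its derivatives. -/
theorem isModerate_of_deriv_eq_mul (hf : ContDiffOn ℝ ∞ f (Set.Ioi 0)) {c : ℝ} (hc : 0 < c)
    (hcf : ∀ s ∈ Set.Ioi (0 : ℝ), c ≤ f s) (hq : BCInf (Set.Ioi 0) q)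
    (hd : ∀ s ∈ Set.Ioi (0 : ℝ), HasDerivAt f (q s * f s) s) : IsModerate f := by
  have key : ∀ j : ℕ, ∃ p, BCInf (Set.Ioi 0) p ∧
      ∀ s ∈ Set.Ioi (0 : ℝ), iteratedDerivWithin j f (Set.Ioi 0) s = p s * f s := by
    intro j
    induction j with
    | zero => exact ⟨fun _ => 1, bcInf_const 1, fun s _ => by simp⟩
    | succ j ih =>
      obtain ⟨p, hp, hpf⟩ := ih
      refine ⟨fun s => deriv p s + p s * q s,
        (hp.deriv isOpen_Ioi).add isOpen_Ioi (hp.mul isOpen_Ioi hq), fun s hs => ?_⟩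
      rw [iteratedDerivWithin_succ, derivWithin_congr hpf (hpf s hs)]
      have := (hasDerivAt_of_contDiffOn isOpen_Ioi hp.contDiffOn hs).mul (hd s hs)
      exact (this.hasDerivWithinAt.derivWithin (isOpen_Ioi.uniqueDiffWithinAt hs)).trans (by ring)
  refine ⟨hf, ⟨c, hc, hcf⟩, fun j => ?_⟩
  obtain ⟨p, hp, hpf⟩ := key j
  obtain ⟨C, hC⟩ := (bcInf_iff.1 hp).2 0
  refine ⟨C, fun s hs => ?_⟩
  have hfs := hc.trans_le (hcf s hs)
  rw [hpf s hs, abs_mul, abs_of_pos hfs]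
  exact mul_le_mul_of_nonneg_right (by simpa using hC s hs) hfs.le

/-- A bound `C` for a derivative is at most `(C / c) f`, as `f ≥ c > 0`. The function `f` itself may
be unbounded, as for funnels. -/
theorem isModerate_of_hasDerivAt (hf : ContDiffOn ℝ ∞ f (Set.Ioi 0)) {c : ℝ} (hc : 0 < c)
    (hcf : ∀ s ∈ Set.Ioi (0 : ℝ), c ≤ f s) (hq : BCInf (Set.Ioi 0) q)
    (hd : ∀ s ∈ Set.Ioi (0 : ℝ), HasDerivAt f (q s) s) : IsModerate f := by
  refine ⟨hf, ⟨c, hc, hcf⟩, fun j => ?_⟩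
  rcases j with _ | j
  · exact ⟨1, fun s hs => by simp [abs_of_pos (hc.trans_le (hcf s hs))]⟩
  · obtain ⟨C, hC⟩ := (bcInf_iff.1 hq).2 j
    refine ⟨C / c, fun s hs => ?_⟩
    rw [iteratedDerivWithin_succ_eq isOpen_Ioi hd j hs, div_mul_eq_mul_div, le_div_iff₀ hc]
    exact mul_le_mul (hC s hs) (hcf s hs) hc.le ((abs_nonneg _).trans (hC s hs))

theorem isModerate_const {c : ℝ} (hc : 0 < c) : IsModerate fun _ => c :=
  isModerate_of_hasDerivAt (q := fun _ => 0) contDiffOn_const hc (fun _ _ => le_rfl)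
    (bcInf_const 0) fun s _ => hasDerivAt_const s c

end BCInf

/-! ### The change of the radial variable -/

/-- The direction in which the end `τ` is approached. -/
def Tip.sign : Tip → ℝ
  | .zero => -1
  | .infty => 1

theorem Tip.sign_mul_sign (τ : Tip) : τ.sign * τ.sign = 1 := by
  cases τ <;> norm_num [Tip.sign]

theorem Tip.one_mem (τ : Tip) : (1 : ℝ) ∈ τ.J := by
  cases τ <;> simp [Tip.J]

theorem Tip.ordConnected (τ : Tip) : τ.J.OrdConnected := by
  cases τ
  exacts [Set.ordConnected_Ioc, Set.ordConnected_Ici]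

theorem Tip.mem_interior_iff {τ : Tip} {t : ℝ} : t ∈ interior τ.J ↔ t ∈ τ.J ∧ t ≠ 1 := by
  cases τ
  · simp only [Tip.J, interior_Ioc, Set.mem_Ioo, Set.mem_Ioc]
    exact ⟨fun h => ⟨⟨h.1, h.2.le⟩, h.2.ne⟩, fun h => ⟨h.1.1, lt_of_le_of_ne h.1.2 h.2⟩⟩
  · simp only [Tip.J, interior_Ici, Set.mem_Ioi, Set.mem_Ici]
    exact ⟨fun h => ⟨h.le, h.ne'⟩, fun h => lt_of_le_of_ne h.1 h.2.symm⟩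

/-- A diffeomorphism `σ` from the interior of `J_τ` onto `(0, ∞)` with inverse `T` such that
`T' = ± w(T)` and `σ(t) → ∞` as `t → τ`. -/
structure TimeChange (τ : Tip) (w : ℝ → ℝ) where
  sigma : ℝ → ℝ
  T : ℝ → ℝ
  sigma_pos : ∀ t ∈ interior τ.J, 0 < sigma t
  T_mem : ∀ s, 0 < s → T s ∈ interior τ.J
  T_sigma : ∀ t ∈ interior τ.J, T (sigma t) = t
  sigma_T : ∀ s, 0 < s → sigma (T s) = s
  smooth_sigma : ContDiffOn ℝ ∞ sigma (interior τ.J)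
  smooth_T : ContDiffOn ℝ ∞ T (Set.Ioi 0)
  hasDerivAt_T : ∀ s, 0 < s → HasDerivAt T (τ.sign * w (T s)) s
  cofinal : IsCofinal τ {t | t ∈ interior τ.J ∧ 1 ≤ sigma t}

section TimeChange

variable {τ : Tip} {w : ℝ → ℝ}

/-- Monotonicity identifies the set with `(0, t₁]` or `[t₁, ∞)`, so its interior has a compact
interval as complement in `J`. -/
theorem isCofinal_of_strictMono {σ : ℝ → ℝ} {t₁ : ℝ}
    (hmono : StrictMonoOn (fun t => τ.sign * σ t) τ.J) (ht₁ : t₁ ∈ interior τ.J)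
    (h : σ t₁ = 1) : IsCofinal τ {t | t ∈ interior τ.J ∧ 1 ≤ σ t} := by
  cases τ
  · have ht := ht₁
    rw [Tip.J, interior_Ioc] at ht
    have hA : {t | t ∈ interior Tip.zero.J ∧ 1 ≤ σ t} = Set.Ioc 0 t₁ := by
      ext t
      rw [Set.mem_ofPred_eq]
      constructor
      · rintro ⟨h1, h2⟩
        have := (hmono.le_iff_le (interior_subset h1) (interior_subset ht₁)).1
          (by simp only [Tip.sign]; linarith)
        rw [Tip.J, interior_Ioc] at h1
        exact ⟨h1.1, this⟩
      · intro h1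
        have h2 : t ∈ interior Tip.zero.J := by
          rw [Tip.J, interior_Ioc]
          exact ⟨h1.1, h1.2.trans_lt ht.2⟩
        have := (hmono.le_iff_le (interior_subset h2) (interior_subset ht₁)).2 h1.2
        simp only [Tip.sign] at this
        exact ⟨h2, by linarith⟩
    have hc : Tip.zero.J \ interior (Set.Ioc 0 t₁) = Set.Icc t₁ 1 := by
      ext t
      simp only [Tip.J, interior_Ioc, Set.mem_sdiff, Set.mem_Ioc, Set.mem_Ioo, Set.mem_Icc, not_and,
        not_lt]
      exact ⟨fun h => ⟨h.2 h.1.1, h.1.2⟩, fun h => ⟨⟨ht.1.trans_le h.1, h.2⟩, fun _ => h.1⟩⟩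
    rw [hA]
    refine ⟨fun t h => ⟨h.1, h.2.trans ht.2.le⟩, Set.ordConnected_Ioc,
      fun h => absurd h.2 (not_le.2 ht.2), ?_, ?_⟩ <;> rw [hc]
    exacts [isCompact_Icc, Set.ordConnected_Icc]
  · have ht := ht₁
    rw [Tip.J, interior_Ici] at ht
    have hA : {t | t ∈ interior Tip.infty.J ∧ 1 ≤ σ t} = Set.Ici t₁ := by
      ext t
      rw [Set.mem_ofPred_eq]
      constructor
      · rintro ⟨h1, h2⟩
        exact (hmono.le_iff_le (interior_subset ht₁) (interior_subset h1)).1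
          (by simp only [Tip.sign]; linarith)
      · intro h1
        have h2 : t ∈ interior Tip.infty.J := by
          rw [Tip.J, interior_Ici]
          exact lt_of_lt_of_le (Set.mem_Ioi.1 ht) h1
        have := (hmono.le_iff_le (interior_subset ht₁) (interior_subset h2)).2 h1
        simp only [Tip.sign] at this
        exact ⟨h2, by linarith⟩
    have hc : Tip.infty.J \ interior (Set.Ici t₁) = Set.Icc 1 t₁ := by
      ext t
      simp [Tip.J]
    rw [hA]
    refine ⟨fun t h => (Set.mem_Ioi.1 ht).le.trans h, Set.ordConnected_Ici,
      fun h => absurd (Set.mem_Ici.1 h) (not_le.2 ht), ?_, ?_⟩ <;> rw [hc]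
    exacts [isCompact_Icc, Set.ordConnected_Icc]

/-- If the integrals from `1` towards the end were bounded, the positive function `1 / w` would be
integrable on `J`, contrary to the divergence. -/
theorem exists_lt_sign_mul_integral (hw : ContDiffOn ℝ ∞ w τ.J) (hpos : ∀ t ∈ τ.J, 0 < w t)
    (hint : ∫⁻ t in τ.J, ENNReal.ofReal (1 / w t) = ⊤) (C : ℝ) :
    ∃ t ∈ τ.J, C < τ.sign * ∫ x in (1 : ℝ)..t, 1 / w x := by
  have hcont : ContinuousOn (fun x => 1 / w x) τ.J :=
    continuousOn_const.div hw.continuousOn fun x hx => (hpos x hx).ne'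
  by_contra! hC
  have hI : MeasureTheory.IntegrableOn (fun x => 1 / w x) τ.J := by
    have hio : ∀ {a b}, a ∈ τ.J → b ∈ τ.J →
        MeasureTheory.IntegrableOn (fun x => 1 / w x) (Set.Ioc a b) := fun ha hb =>
      ((hcont.mono (τ.ordConnected.out ha hb)).integrableOn_Icc).mono_set Set.Ioc_subset_Icc_self
    cases τ
    · have ha : ∀ i : ℕ, 1 / ((i : ℝ) + 1) ∈ Tip.zero.J := fun i =>
        ⟨by positivity, by rw [div_le_one (by positivity)]; linarith [i.cast_nonneg (α := ℝ)]⟩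
      refine MeasureTheory.integrableOn_Ioc_of_intervalIntegral_norm_bounded_left (I := C)
        (fun i => hio (ha i) (Tip.one_mem _)) tendsto_one_div_add_atTop_nhds_zero_nat
        (Filter.Eventually.of_forall fun i => ?_)
      have h1 := hC _ (ha i)
      rw [intervalIntegral.integral_symm, intervalIntegral.integral_of_le (ha i).2, Tip.sign,
        neg_one_mul, neg_neg] at h1
      refine le_trans (le_of_eq (MeasureTheory.setIntegral_congr_fun measurableSet_Ioc ?_)) h1
      exact fun x hx => Real.norm_of_nonneg
        (one_div_pos.2 (hpos x ⟨(ha i).1.trans hx.1, hx.2⟩)).le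
    · have hb : ∀ i : ℕ, 1 + (i : ℝ) ∈ Tip.infty.J := fun i => by simp [Tip.J]
      rw [Tip.J, integrableOn_Ici_iff_integrableOn_Ioi]
      refine MeasureTheory.integrableOn_Ioi_of_intervalIntegral_norm_bounded C 1
        (fun i => hio (Tip.one_mem _) (hb i))
        (Filter.tendsto_atTop_add_const_left _ _ tendsto_natCast_atTop_atTop)
        (Filter.Eventually.of_forall fun i => ?_)
      have h1 := hC _ (hb i)
      rw [Tip.sign, one_mul] at h1
      refine le_trans (le_of_eq (intervalIntegral.integral_congr fun x hx => ?_)) h1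
      rw [Set.uIcc_of_le (hb i)] at hx
      exact Real.norm_of_nonneg (one_div_pos.2 (hpos x hx.1)).le
  have hm : MeasurableSet τ.J := by
    cases τ
    exacts [measurableSet_Ioc, measurableSet_Ici]
  have := (MeasureTheory.hasFiniteIntegral_iff_ofReal
    ((MeasureTheory.ae_restrict_mem hm).mono fun x hx => (one_div_pos.2 (hpos x hx)).le)).1 hI.2
  exact this.ne hint

/-- The variable `σ(t) = ±∫₁ᵗ dx / w` grows strictly towards the end from the value zero at `1`.
Divergence makes it reach every positive value, and the inverse function theorem makes its inverse
`T` smooth with `T' = ±w(T)`. -/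
theorem exists_timeChange (hw : ContDiffOn ℝ ∞ w τ.J) (hpos : ∀ t ∈ τ.J, 0 < w t)
    (hint : ∫⁻ t in τ.J, ENNReal.ofReal (1 / w t) = ⊤) : Nonempty (TimeChange τ w) := by
  have hcont : ContinuousOn (fun x => 1 / w x) τ.J :=
    continuousOn_const.div hw.continuousOn fun x hx => (hpos x hx).ne'
  have hsub : ∀ {a b}, a ∈ τ.J → b ∈ τ.J → Set.uIcc a b ⊆ τ.J := fun ha hb =>
    τ.ordConnected.uIcc_subset ha hb
  have hII : ∀ {a b}, a ∈ τ.J → b ∈ τ.J →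
      IntervalIntegrable (fun x => 1 / w x) MeasureTheory.volume a b := fun ha hb =>
    (hcont.mono (hsub ha hb)).intervalIntegrable
  set F : ℝ → ℝ := fun t => ∫ x in (1 : ℝ)..t, 1 / w x with hF
  have hmono : StrictMonoOn F τ.J := by
    intro a ha b hb hab
    have h1 := intervalIntegral.integral_interval_sub_left (hII τ.one_mem hb) (hII τ.one_mem ha)
    have h2 : 0 < ∫ x in a..b, 1 / w x :=
      intervalIntegral.intervalIntegral_pos_of_pos_on (hII ha hb) (fun x hx => one_div_pos.2
        (hpos x (τ.ordConnected.out ha hb (Set.Ioo_subset_Icc_self hx)))) hab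
    simp only [hF]
    linarith
  have hF1 : F 1 = 0 := intervalIntegral.integral_same
  have hFd : ∀ t ∈ interior τ.J, HasDerivAt F (1 / w t) t := by
    intro t ht
    have hc : ContinuousOn (fun x => 1 / w x) (interior τ.J) := hcont.mono interior_subset
    exact intervalIntegral.integral_hasDerivAt_right (hII τ.one_mem (interior_subset ht))
      (hc.stronglyMeasurableAtFilter isOpen_interior t ht)
      (hc.continuousAt (isOpen_interior.mem_nhds ht))
  set σ : ℝ → ℝ := fun t => τ.sign * F t with hσ
  have hsF : ∀ t, τ.sign * σ t = F t := fun t => by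
    rw [hσ, ← mul_assoc, τ.sign_mul_sign, one_mul]
  have hinj : Set.InjOn σ (interior τ.J) := fun a ha b hb hab =>
    hmono.injOn (interior_subset ha) (interior_subset hb) (by rw [← hsF, ← hsF, hab])
  have hσpos : ∀ t ∈ interior τ.J, 0 < σ t := by
    intro t ht
    have h1 := interior_subset ht
    cases τ
    · rw [Tip.J, interior_Ioc] at ht
      have := hmono h1 (Tip.one_mem _) ht.2
      simp only [hσ, Tip.sign]
      linarith
    · rw [Tip.J, interior_Ici] at ht
      have := hmono (Tip.one_mem _) h1 ht
      simp only [hσ, Tip.sign]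
      linarith
  have hσd : ∀ t ∈ interior τ.J, HasDerivAt σ (τ.sign * (1 / w t)) t := fun t ht =>
    (hFd t ht).const_mul _
  have hσs : ContDiffOn ℝ ∞ σ (interior τ.J) := by
    rw [contDiffOn_infty_iff_deriv_of_isOpen isOpen_interior]
    refine ⟨fun t ht => (hσd t ht).differentiableAt.differentiableWithinAt, ?_⟩
    refine ContDiffOn.congr ?_ fun t ht => (hσd t ht).deriv
    exact contDiffOn_const.mul (contDiffOn_const.div (hw.mono interior_subset)
      fun t ht => (hpos t (interior_subset ht)).ne')
  have hsurj : ∀ s, 0 < s → ∃ t ∈ interior τ.J, σ t = s := by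
    intro s hs
    obtain ⟨t₀, ht₀, hst⟩ := exists_lt_sign_mul_integral hw hpos hint s
    have hσc : ContinuousOn σ (Set.uIcc 1 t₀) :=
      (intervalIntegral.continuousOn_primitive_interval'
        (hII τ.one_mem ht₀) Set.left_mem_uIcc).const_smul τ.sign
    obtain ⟨t, ht, rfl⟩ := intermediate_value_uIcc hσc (show s ∈ Set.uIcc (σ 1) (σ t₀) by
      have h1 : σ 1 = 0 := by simp only [hσ, hF1, mul_zero]
      rw [h1]
      exact Set.mem_uIcc_of_le hs.le hst.le)
    refine ⟨t, Tip.mem_interior_iff.2 ⟨hsub τ.one_mem ht₀ ht, ?_⟩, rfl⟩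
    rintro rfl
    simp [hσ, hF1] at hs
  have hsurj' : ∀ s, 0 < s → s ∈ σ '' interior τ.J := hsurj
  set T : ℝ → ℝ := Function.invFunOn σ (interior τ.J) with hT
  have hTm : ∀ s, 0 < s → T s ∈ interior τ.J := fun s hs => Function.invFunOn_mem (hsurj' s hs)
  have hσT : ∀ s, 0 < s → σ (T s) = s := fun s hs => Function.invFunOn_eq (hsurj' s hs)
  have hTσ : ∀ t ∈ interior τ.J, T (σ t) = t := fun t ht =>
    hinj (hTm _ (hσpos t ht)) ht (hσT _ (hσpos t ht))
  have hne : ∀ t ∈ interior τ.J, τ.sign * (1 / w t) ≠ 0 := fun t ht =>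
    mul_ne_zero (fun h => by simpa [h] using τ.sign_mul_sign)
      (one_div_pos.2 (hpos t (interior_subset ht))).ne'
  have hTs : ∀ s, 0 < s → ContDiffAt ℝ ∞ T s := by
    intro s hs
    have hc : ContDiffAt ℝ ∞ σ (T s) := hσs.contDiffAt (isOpen_interior.mem_nhds (hTm s hs))
    have hd := (hσd _ (hTm s hs)).hasFDerivAt_equiv (hne _ (hTm s hs))
    have hg := hc.to_localInverse hd (by simp)
    have h1 := (hc.hasStrictFDerivAt' hd (by simp)).eventually_right_inverse
    have h2 : hc.localInverse hd (by simp) (σ (T s)) = T s := hc.localInverse_apply_image hd _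
    rw [hσT s hs] at hg h1 h2
    -- Near `s` the local inverse takes values in the interior of `J` and is a right inverse of `σ`,
    -- so it coincides there with the global inverse `T`.
    refine hg.congr_of_eventuallyEq ?_
    filter_upwards [h1, hg.continuousAt.eventually_mem
      (isOpen_interior.mem_nhds (h2.symm ▸ hTm s hs))] with y hy hy'
    have h3 : σ (hc.localInverse hd (by simp) y) = y := hy
    conv_lhs => rw [← h3]
    exact hTσ _ hy'
  have hTd : ∀ s, 0 < s → HasDerivAt T (τ.sign * w (T s)) s := by
    intro s hs
    have := HasDerivAt.of_local_left_inverse (hTs s hs).continuousAt (hσd _ (hTm s hs))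
      (hne _ (hTm s hs)) ((eventually_gt_nhds hs).mono hσT)
    rwa [mul_inv, one_div, inv_inv, ← eq_inv_of_mul_eq_one_left τ.sign_mul_sign] at this
  exact ⟨⟨σ, T, hσpos, hTm, hTσ, hσT, hσs, fun s hs => (hTs s hs).contDiffWithinAt, hTd,
    isCofinal_of_strictMono (by simpa only [hsF] using hmono) (hTm 1 one_pos)
      (hσT 1 one_pos)⟩⟩

end TimeChange

/-! ### Bounds for characteristics -/

section Characteristics

variable {τ : Tip} {R : ℝ → ℝ}

/-- At interior points, derivatives within `J` equal those within the interior. Only orders at least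
one are bounded by hypothesis, so the conclusion concerns `deriv R` and not `R`. -/
theorem bcInf_deriv_of_bounded (hR : ContDiffOn ℝ ∞ R τ.J)
    (h : ∀ k : ℕ, 1 ≤ k → ∃ c : ℝ, ∀ t ∈ τ.J, |iteratedDerivWithin k R τ.J t| ≤ c) :
    BCInf (interior τ.J) (deriv R) := by
  have hR' : ContDiffOn ℝ ∞ R (interior τ.J) := hR.mono interior_subset
  refine bcInf_iff.2 ⟨((contDiffOn_infty_iff_deriv_of_isOpen isOpen_interior).1 hR').2,
    fun j => ?_⟩
  obtain ⟨c, hc⟩ := h (j + 1) (by omega)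
  refine ⟨c, fun t ht => ?_⟩
  rw [← iteratedDerivWithin_succ_eq isOpen_interior
    (fun y hy => hasDerivAt_of_contDiffOn isOpen_interior hR' hy) j ht]
  have hset : interior τ.J =ᶠ[𝓝 t] τ.J := by
    filter_upwards [isOpen_interior.mem_nhds ht] with y hy
    exact propext ⟨fun _ => interior_subset hy, fun _ => hy⟩
  have := hc t (interior_subset ht)
  rwa [iteratedDerivWithin, ← iteratedFDerivWithin_congr_set hset, ← iteratedDerivWithin] at this

theorem bcInf_of_deriv {S : Set ℝ} (hS : IsOpen S) (hR : ContDiffOn ℝ ∞ R S)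
    (hd : BCInf S (deriv R)) {c : ℝ} (hc : ∀ t ∈ S, |R t| ≤ c) : BCInf S R := by
  refine bcInf_iff.2 ⟨hR, fun j => ?_⟩
  rcases j with _ | j
  · exact ⟨c, fun t ht => by simpa using hc t ht⟩
  · obtain ⟨C, hC⟩ := (bcInf_iff.1 hd).2 j
    refine ⟨C, fun t ht => ?_⟩
    rw [iteratedDerivWithin_succ_eq hS (fun y hy => hasDerivAt_of_contDiffOn hS hR hy) j ht]
    exact hC t ht

/-- On `(0, 1]` the bound on `R'` controls the variation from `R(1) = 1`. On `[1, ∞)` the limit zero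
leaves only a compact interval to consider. -/
theorem IsCuspCharacteristic.exists_le (h : IsCuspCharacteristic τ R) :
    ∃ C, ∀ t ∈ τ.J, R t ≤ C := by
  cases τ
  · obtain ⟨c, hc⟩ := h.bounded 1 le_rfl
    refine ⟨1 + c, fun t ht => ?_⟩
    have h1 := (convex_Ioc (0 : ℝ) 1).norm_image_sub_le_of_norm_derivWithin_le (f := R) (C := c)
      (h.smooth.differentiableOn (by simp)) (fun x hx => by
        have := hc x hx
        rwa [iteratedDerivWithin_one] at this) (Tip.one_mem .zero) ht
    rw [h.one, Real.norm_eq_abs, Real.norm_eq_abs] at h1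
    have hc0 : 0 ≤ c := (abs_nonneg _).trans (hc 1 (Tip.one_mem _))
    have h2 : |t - 1| ≤ 1 := abs_le.2 ⟨by linarith [ht.1], by linarith [ht.2]⟩
    have h3 := mul_le_mul_of_nonneg_left h2 hc0
    linarith [le_abs_self (R t - 1)]
  · obtain ⟨N, hN⟩ := Filter.eventually_atTop.1 ((h.limit_infty rfl).eventually_lt_const one_pos)
    obtain ⟨C, hC⟩ := isCompact_Icc.exists_bound_of_continuousOn
      (h.smooth.continuousOn.mono (Set.Icc_subset_Ici_self : Set.Icc 1 N ⊆ Set.Ici 1))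
    refine ⟨max 1 C, fun t ht => ?_⟩
    rcases le_total t N with htN | htN
    · exact ((le_abs_self _).trans (hC t ⟨ht, htN⟩)).trans (le_max_right _ _)
    · exact (hN t htN).le.trans (le_max_left _ _)

/-- The positive, possibly infinite, limit controls `R` far out, and a minimum on a compact interval
controls the rest. -/
theorem IsFunnelCharacteristic.exists_pos_le (h : IsFunnelCharacteristic R) :
    ∃ c, 0 < c ∧ ∀ t ∈ Tip.infty.J, c ≤ R t := by
  obtain ⟨L, hL, hlim⟩ := h.limit_pos
  obtain ⟨a, ha, haL⟩ := exists_between hL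
  obtain ⟨N, hN⟩ := Filter.eventually_atTop.1 (hlim.eventually_const_lt haL)
  have ha' : 0 < a.toReal := ENNReal.toReal_pos ha.ne' haL.ne_top
  have hNR : ∀ t, N ≤ t → a.toReal ≤ R t := fun t ht =>
    ((ENNReal.lt_ofReal_iff_toReal_lt haL.ne_top).1 (hN t ht)).le
  obtain ⟨x, hx, hmin⟩ := (isCompact_Icc (a := (1 : ℝ)) (b := max 1 N)).exists_isMinOn
    (Set.nonempty_Icc.2 (le_max_left _ _))
    (h.smooth.continuousOn.mono (Set.Icc_subset_Ici_self : Set.Icc 1 (max 1 N) ⊆ Set.Ici 1))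
  refine ⟨min a.toReal (R x), lt_min ha' (h.pos x hx.1), fun t ht => ?_⟩
  rcases le_total t (max 1 N) with htN | htN
  · exact (min_le_right _ _).trans (hmin ⟨ht, htN⟩)
  · exact (min_le_left _ _).trans (hNR t ((le_max_right _ _).trans htN))

end Characteristics

/-! ### The radial data of the model ends -/

section Models

variable {n : ℕ} {τ : Tip} {R : ℝ → ℝ}

theorem splitForm_apply (a : ℝ) (p q : ℝ × E n) :
    splitForm n a p q = a * (p.1 * q.1) + inner ℝ p.2 q.2 := by
  simp only [splitForm, euclideanForm, add_apply, smul_apply,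
    ContinuousLinearMap.bilinearComp_apply, ContinuousLinearMap.coe_fst', ContinuousLinearMap.coe_snd',
    ContinuousLinearMap.mul_apply', smul_eq_mul]
  rfl

theorem TimeChange.hasDerivAt_comp {w f : ℝ → ℝ} (c : TimeChange τ w)
    (hf : ContDiffOn ℝ ∞ f (interior τ.J)) {s : ℝ} (hs : 0 < s) :
    HasDerivAt (f ∘ c.T) (deriv f (c.T s) * (τ.sign * w (c.T s))) s :=
  (hasDerivAt_of_contDiffOn isOpen_interior hf (c.T_mem s hs)).comp s (c.hasDerivAt_T s hs)

theorem TimeChange.bcInf_comp {w f : ℝ → ℝ} (c : TimeChange τ w) (hw : BCInf (interior τ.J) w)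
    (hf : BCInf (interior τ.J) f) : BCInf (Set.Ioi 0) (f ∘ c.T) :=
  BCInf.comp_flow (w := fun t => τ.sign * w t) isOpen_Ioi isOpen_interior
    ((bcInf_const _).mul isOpen_interior hw) c.smooth_T c.T_mem c.hasDerivAt_T hf

/-- With `dt = ±R ds`, the metric `dt² + |R' y dt + R dy|²` equals `R² (ds² + |±R' y ds + dy|²)`.
Along the flow `1 / R` has logarithmic derivative `∓R'`, hence is moderate. -/
theorem IsCuspCharacteristic.nonempty_radialData (h : IsCuspCharacteristic τ R) :
    Nonempty (RadialData τ R R (embeddedMetric n)) := by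
  obtain ⟨c⟩ := exists_timeChange h.smooth h.pos h.integral
  obtain ⟨C, hC⟩ := h.exists_le
  have hsm : ContDiffOn ℝ ∞ R (interior τ.J) := h.smooth.mono interior_subset
  have hpos : ∀ t ∈ interior τ.J, 0 < R t := fun t ht => h.pos t (interior_subset ht)
  have hR' : BCInf (interior τ.J) (deriv R) := bcInf_deriv_of_bounded h.smooth h.bounded
  have hR : BCInf (interior τ.J) R := bcInf_of_deriv isOpen_interior hsm hR' fun t ht => by
    rw [abs_of_pos (hpos t ht)]
    exact hC t (interior_subset ht)
  have hu : BCInf (Set.Ioi 0) fun s => τ.sign * deriv R (c.T s) :=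
    (bcInf_const _).mul isOpen_Ioi (c.bcInf_comp hR hR')
  have hC0 : 0 < C := (h.pos 1 τ.one_mem).trans_le (hC 1 τ.one_mem)
  refine ⟨⟨c.sigma, c.T, fun s => τ.sign * deriv R (c.T s), fun _ => 1, c.sigma_pos, c.T_mem,
    c.T_sigma, c.sigma_T, c.smooth_sigma, c.smooth_T, hsm, hpos, hsm, hpos, c.cofinal, hu,
    isModerate_const one_pos, ?_, ?_⟩⟩
  · refine isModerate_of_deriv_eq_mul (c := C⁻¹) (q := fun s => -1 * (τ.sign * deriv R (c.T s)))
      ((hsm.comp c.smooth_T c.T_mem).inv fun s hs => (hpos _ (c.T_mem s hs)).ne')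
      (inv_pos.2 hC0) (fun s hs => ?_) ((bcInf_const _).mul isOpen_Ioi hu) fun s hs => ?_
    · exact inv_anti₀ (hpos _ (c.T_mem s hs)) (hC _ (interior_subset (c.T_mem s hs)))
    · have hne := (hpos _ (c.T_mem s hs)).ne'
      refine ((c.hasDerivAt_comp hsm hs).inv hne).congr_deriv ?_
      simp only [Function.comp_apply]
      field_simp
  · intro s hs y v v' a a'
    rw [(c.hasDerivAt_T s hs).deriv, (c.hasDerivAt_comp hsm hs).deriv, embeddedMetric,
      splitForm_apply]
    have key : ∀ (b : ℝ) (x : E n), (deriv R (c.T s) * (τ.sign * R (c.T s)) * b) • y + R (c.T s) • x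
        = R (c.T s) • ((τ.sign * deriv R (c.T s) * b) • y + (1 : ℝ) • x) := fun b x => by
      module
    simp only [key, real_inner_smul_left, real_inner_smul_right]
    linear_combination (R (c.T s) ^ 2 * (a * a')) * τ.sign_mul_sign

/-- Here `s` is `t` up to translation. The circumference factor `R` remains as `λ`; it is moderate,
being bounded below with bounded derivatives. -/
theorem IsFunnelCharacteristic.nonempty_radialData (h : IsFunnelCharacteristic R) :
    Nonempty (RadialData .infty R (fun _ => 1) (embeddedMetric n)) := by
  obtain ⟨c⟩ := exists_timeChange (τ := .infty) (w := fun _ => 1) contDiffOn_const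
    (fun _ _ => one_pos) (by simp [Tip.J])
  obtain ⟨C, hC0, hC⟩ := h.exists_pos_le
  have hsm : ContDiffOn ℝ ∞ R (interior Tip.infty.J) := h.smooth.mono interior_subset
  have hu : BCInf (Set.Ioi 0) (deriv R ∘ c.T) :=
    c.bcInf_comp (bcInf_const 1) (bcInf_deriv_of_bounded h.smooth h.bounded)
  have hRT : ∀ s, 0 < s → HasDerivAt (R ∘ c.T) (deriv R (c.T s)) s := fun s hs => by
    simpa [Tip.sign] using c.hasDerivAt_comp hsm hs
  refine ⟨⟨c.sigma, c.T, deriv R ∘ c.T, R ∘ c.T, c.sigma_pos, c.T_mem,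
    c.T_sigma, c.sigma_T, c.smooth_sigma, c.smooth_T, hsm,
    fun t ht => h.pos t (interior_subset ht), contDiffOn_const, fun _ _ => one_pos, c.cofinal, hu,
    ?_, isModerate_const (by norm_num), ?_⟩⟩
  · exact isModerate_of_hasDerivAt (hsm.comp c.smooth_T c.T_mem) hC0
      (fun s hs => hC _ (interior_subset (c.T_mem s hs))) hu hRT
  · intro s hs y v v' a a'
    rw [(c.hasDerivAt_T s hs).deriv, (hRT s hs).deriv, embeddedMetric, splitForm_apply]
    simp [Tip.sign]

/-- The tangent vector is the image of `(a, v)` under the derivative of `(t, y) ↦ (t, R(t) y)`,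
which the derivative of `stretch R` undoes. -/
theorem fderiv_stretch_apply {t R' : ℝ} (hR : HasDerivAt R R' t) (hne : R t ≠ 0) (y v : E n)
    (a : ℝ) :
    fderiv ℝ (stretch R) (t, R t • y) (a, (R' * a) • y + R t • v) = (a, v) := by
  have hfst : HasFDerivAt (fun p : ℝ × E n => p.1) (ContinuousLinearMap.fst ℝ ℝ (E n))
      (t, R t • y) := hasFDerivAt_fst
  have h1 := HasDerivAt.comp_hasFDerivAt (h₂ := fun t => (R t)⁻¹) (t, R t • y) (hR.inv hne) hfst
  have h2 : HasFDerivAt (stretch (n := n) R) _ (t, R t • y) :=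
    hfst.prodMk (h1.smul hasFDerivAt_snd)
  rw [h2.fderiv]
  refine Prod.ext rfl ?_
  simp only [ContinuousLinearMap.prod_apply, add_apply,
    smul_apply, ContinuousLinearMap.smulRight_apply,
    ContinuousLinearMap.coe_fst', ContinuousLinearMap.coe_snd', smul_eq_mul, Function.comp_apply]
  match_scalars
  all_goals field_simp
  all_goals ring

theorem lintegral_one_div_rpow_eq_top {γ : ℝ} (hγ : 0 ≤ γ) :
    ∫⁻ t in Tip.zero.J, ENNReal.ofReal (1 / t ^ (1 + γ)) = ⊤ := by
  by_contra hfin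
  have hI : MeasureTheory.IntegrableOn (fun t : ℝ => 1 / t ^ (1 + γ)) (Set.Ioc 0 1) := by
    refine ⟨ContinuousOn.aestronglyMeasurable ?_ measurableSet_Ioc, ?_⟩
    · exact continuousOn_const.div
        (continuousOn_id.rpow_const fun t ht => Or.inl (Set.mem_Ioc.1 ht).1.ne')
        fun t ht => (Real.rpow_pos_of_pos ht.1 _).ne'
    · exact (MeasureTheory.hasFiniteIntegral_iff_ofReal
        ((MeasureTheory.ae_restrict_mem measurableSet_Ioc).mono fun x hx =>
          (one_div_pos.2 (Real.rpow_pos_of_pos hx.1 _)).le)).2 (lt_top_iff_ne_top.2 hfin)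
  have h2 : MeasureTheory.IntegrableOn (fun t : ℝ => t ^ (-(1 + γ))) (Set.Ioo 0 1) :=
    (hI.mono_set Set.Ioo_subset_Ioc_self).congr_fun
      (fun t ht => by simp only [Real.rpow_neg ht.1.le, one_div]) measurableSet_Ioo
  linarith [(intervalIntegral.integrableOn_Ioo_rpow_iff one_pos).1 h2]

theorem contDiffOn_rpow_const {S : Set ℝ} (hS : ∀ t ∈ S, 0 < t) (p : ℝ) :
    ContDiffOn ℝ ∞ (fun t : ℝ => t ^ p) S :=
  contDiffOn_id.rpow_const_of_ne fun t ht => (hS t ht).ne'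

/-- The exponent of `w` is forced: with `dt = -t^(1 + γ) ds` and `γ = a - β`, the term `t^(2(β - 1))
dt²` becomes `t^(2a) ds²`, that is, `r² ds²`. After stretching, `y` and `s` are orthogonal, so `u =
0` and `λ = 1 / r`, whatever `α` is. -/
theorem nonempty_radialData_anisotropic {α β a : ℝ} (ha : 0 ≤ a) (hβ : β ≤ a) :
    Nonempty (RadialData .zero (fun t => t ^ α) (fun t => t ^ a)
      (anisotropicMetric n (fun t => t ^ α) β)) := by
  set γ := a - β with hγ
  have hγ0 : 0 ≤ γ := sub_nonneg.2 hβ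
  have hJ : ∀ t ∈ interior Tip.zero.J, 0 < t ∧ t < 1 := fun t ht => by
    rwa [Tip.J, interior_Ioc] at ht
  have hsm : ∀ p : ℝ, ContDiffOn ℝ ∞ (fun t : ℝ => t ^ p) (interior Tip.zero.J) :=
    contDiffOn_rpow_const fun t ht => (hJ t ht).1
  have hpos : ∀ p : ℝ, ∀ t ∈ interior Tip.zero.J, 0 < t ^ p := fun p t ht =>
    Real.rpow_pos_of_pos (hJ t ht).1 p
  obtain ⟨c⟩ := exists_timeChange (τ := .zero) (w := fun t => t ^ (1 + γ))
    (contDiffOn_rpow_const (fun t ht => ht.1) _) (fun t ht => Real.rpow_pos_of_pos ht.1 _)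
    (lintegral_one_div_rpow_eq_top hγ0)
  have hTd : ∀ s, 0 < s → HasDerivAt c.T (-c.T s ^ (1 + γ)) s := fun s hs => by
    simpa [Tip.sign] using c.hasDerivAt_T s hs
  have hTp : ∀ p s, 0 < s → HasDerivAt (fun s => c.T s ^ p) (-p * c.T s ^ (p + γ)) s := by
    intro p s hs
    have hT := (hJ _ (c.T_mem s hs)).1
    refine ((hTd s hs).rpow_const (p := p) (Or.inl hT.ne')).congr_deriv ?_
    rw [show p + γ = (1 + γ) + (p - 1) by ring, Real.rpow_add hT (1 + γ)]
    ring
  have hTs : ∀ p : ℝ, ContDiffOn ℝ ∞ (fun s => c.T s ^ p) (Set.Ioi 0) := fun p =>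
    (hsm p).comp c.smooth_T c.T_mem
  have hq : BCInf (Set.Ioi 0) fun s => c.T s ^ γ := by
    -- Each differentiation along the flow raises the exponent by `γ ≥ 0`. The exponents stay
    -- nonnegative, and `0 < T < 1` makes the powers at most one.
    have key : ∀ j : ℕ, ∃ C δ : ℝ, 0 ≤ δ ∧ ∀ s ∈ Set.Ioi (0 : ℝ),
        iteratedDerivWithin j (fun s => c.T s ^ γ) (Set.Ioi 0) s = C * c.T s ^ δ := by
      intro j
      induction j with
      | zero => exact ⟨1, γ, hγ0, fun s _ => by simp⟩
      | succ j ih =>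
        obtain ⟨C, δ, hδ, h⟩ := ih
        refine ⟨C * -δ, δ + γ, by positivity, fun s hs => ?_⟩
        rw [iteratedDerivWithin_succ, derivWithin_congr h (h s hs),
          ((hTp δ s hs).const_mul C).hasDerivWithinAt.derivWithin
            (isOpen_Ioi.uniqueDiffWithinAt hs), mul_assoc]
    refine bcInf_iff.2 ⟨hTs γ, fun j => ?_⟩
    obtain ⟨C, δ, hδ, h⟩ := key j
    refine ⟨|C|, fun s hs => ?_⟩
    obtain ⟨h0, h1⟩ := hJ _ (c.T_mem s hs)
    rw [h s hs, abs_mul, abs_of_pos (Real.rpow_pos_of_pos h0 _)]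
    exact mul_le_of_le_one_right (abs_nonneg _) (Real.rpow_le_one h0.le h1.le hδ)
  have hmod : IsModerate fun s => (c.T s ^ a)⁻¹ := by
    refine isModerate_of_deriv_eq_mul (c := 1) (q := fun s => a * c.T s ^ γ)
      ((hTs a).inv fun s hs => (hpos a _ (c.T_mem s hs)).ne') one_pos (fun s hs => ?_)
      ((bcInf_const a).mul isOpen_Ioi hq) fun s hs => ?_
    · obtain ⟨h0, h1⟩ := hJ _ (c.T_mem s hs)
      exact one_le_inv_iff₀.2 ⟨Real.rpow_pos_of_pos h0 _, Real.rpow_le_one h0.le h1.le ha⟩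
    · have h0 := (hJ _ (c.T_mem s hs)).1
      have hne := (Real.rpow_pos_of_pos h0 a).ne'
      refine ((hTp a s hs).inv hne).congr_deriv ?_
      rw [Real.rpow_add h0]
      field_simp
  refine ⟨⟨c.sigma, c.T, fun _ => 0, fun s => (c.T s ^ a)⁻¹, c.sigma_pos, c.T_mem,
    c.T_sigma, c.sigma_T, c.smooth_sigma, c.smooth_T, hsm α, hpos α, hsm a, hpos a, c.cofinal,
    bcInf_const 0, hmod, hmod, ?_⟩⟩
  intro s hs y v v' b b'
  have h0 := (hJ _ (c.T_mem s hs)).1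
  have hRd := hasDerivAt_of_contDiffOn isOpen_interior (hsm α) (c.T_mem s hs)
  have hne := (Real.rpow_pos_of_pos h0 a).ne'
  have hα := (Real.rpow_pos_of_pos h0 α).ne'
  rw [(hTd s hs).deriv, (hRd.comp s (hTd s hs)).deriv, mul_assoc, mul_assoc, anisotropicMetric,
    ContinuousLinearMap.bilinearComp_apply, fderiv_stretch_apply hRd hα,
    fderiv_stretch_apply hRd hα, splitForm_apply]
  have hk : c.T s ^ (2 * (β - 1)) * (c.T s ^ (1 + γ) * c.T s ^ (1 + γ)) = c.T s ^ a * c.T s ^ a := by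
    rw [← Real.rpow_add h0, ← Real.rpow_add h0, ← Real.rpow_add h0,
      show 2 * (β - 1) + (1 + γ + (1 + γ)) = a + a by rw [hγ]; ring]
  simp only [stretch, zero_mul, zero_smul, zero_add, real_inner_smul_left, real_inner_smul_right]
  have hk2 : c.T s ^ a * (c.T s ^ a)⁻¹ = 1 := mul_inv_cancel₀ hne
  linear_combination (b * b') * hk -
    (inner ℝ v v') * (c.T s ^ a * (c.T s ^ a)⁻¹ + 1) * hk2

end Models

end SingularEnds

/-! ### The cases of the proposition. -/

theorem proposition8p2
    (d e m n : ℕ) (hm : m = 1 + d + e)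
    -- the Riemannian manifold `(M, g)` of dimension `m`, possibly with boundary
    {H : Type*} [TopologicalSpace H] (I : ModelWithCorners ℝ (EuclideanSpace ℝ (Fin m)) H)
    {M : Type*} [TopologicalSpace M] [T2Space M] [SecondCountableTopology M]
    [ChartedSpace H M] [IsManifold I ∞ M]
    (g : Bundle.ContMDiffRiemannianMetric I ∞ (EuclideanSpace ℝ (Fin m))
      (fun p : M => TangentSpace I p))
    -- the compact connected Riemannian manifold `(Γ, g_Γ)` of dimension `e`, without boundary
    {Γ : Type*} [TopologicalSpace Γ] [T2Space Γ] [CompactSpace Γ] [ConnectedSpace Γ]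
    [ChartedSpace (EuclideanSpace ℝ (Fin e)) Γ] [IsManifold (𝓡 e) ∞ Γ]
    (gΓ : Bundle.ContMDiffRiemannianMetric (𝓡 e) ∞ (EuclideanSpace ℝ (Fin e))
      (fun z : Γ => TangentSpace (𝓡 e) z))
    -- the compact basis `B` of dimension `d` in `ℝ^n`, possibly with boundary
    (B : Set (EuclideanSpace ℝ (Fin n))) (hBc : IsCompact B)
    (hB : SingularEnds.IsSubmanifold 𝓘(ℝ, EuclideanSpace ℝ (Fin n)) d B)
    -- the modelling data
    (τ : SingularEnds.Tip) (R r : ℝ → ℝ)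
    (hP : ℝ × EuclideanSpace ℝ (Fin n) →
      (ℝ × EuclideanSpace ℝ (Fin n)) →L[ℝ] (ℝ × EuclideanSpace ℝ (Fin n)) →L[ℝ] ℝ)
    (V : Set M) (Φ : PartialEquiv M ((ℝ × EuclideanSpace ℝ (Fin n)) × Γ))
    (hV : SingularEnds.IsModeledBy I g.inner V Φ τ R B hP gΓ.inner)
    (hcase :
      -- (i) the embedded metric
      (hP = SingularEnds.embeddedMetric n ∧
        ((SingularEnds.IsCuspCharacteristic τ R ∧ r = R) ∨
          (τ = .infty ∧ SingularEnds.IsFunnelCharacteristic R ∧ r = fun _ => 1))) ∨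
      -- (ii) the anisotropic metric over the power `t ^ α` on `(0, 1]`
      (τ = .zero ∧ ∃ α β : ℝ, α ≤ 1 ∧ R = (fun t => t ^ α) ∧
        β ≠ 0 ∧ β ≤ α ∧ (0 < α → 0 < β) ∧
        hP = SingularEnds.anisotropicMetric n R β ∧
        r = if 0 < α then (fun t => t ^ α) else fun _ => 1)) :
    SingularEnds.IsCofinalSingularityFunction I g.inner V Φ τ R B
      (SingularEnds.pullbackRadial Φ R r) := by
  have hcof {r' : ℝ → ℝ} (D : Nonempty (SingularEnds.RadialData τ R r' hP)) :
      SingularEnds.IsCofinalSingularityFunction I g.inner V Φ τ R B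
        (SingularEnds.pullbackRadial Φ R r') :=
    D.elim fun D => D.isCofinalSingularityFunction hm gΓ hBc hB hV
  rcases hcase with ⟨rfl, ⟨hR, rfl⟩ | ⟨rfl, hR, rfl⟩⟩ | ⟨rfl, α, β, -, rfl, -, hβα, -, rfl, rfl⟩
  · exact hcof hR.nonempty_radialData
  · exact hcof hR.nonempty_radialData
  · by_cases hα : 0 < α
    · rw [if_pos hα]
      exact hcof (SingularEnds.nonempty_radialData_anisotropic hα.le hβα)
    · rw [if_neg hα]
      -- For `α ≤ 0` the exponent of `r` is `a = 0`, so that `r = t^0 = 1`; the required `β ≤ 0`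
      -- follows from `β ≤ α`.
      have h := SingularEnds.nonempty_radialData_anisotropic (n := n) (α := α) le_rfl
        (hβα.trans (not_lt.1 hα))
      simp only [Real.rpow_zero] at h
      exact hcof h
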